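/- Let $\hat T=\{(x_1,x_2):0<x_1<1,\ 0<x_2<x_1\}$ and $\hat Q=(0,1)^2$, and let $\hat K$ be $\hat T$ or $\hat Q$. For $0<s<1$ let $\|v\|_{H^s(\hat K)}^2=\|v\|_{0,\hat K}^2+\int_{\hat K}\int_{\hat K}\frac{|v(x)-v(y)|^2}{|x-y|^{2+2s}}\,dx\,dy$, where $\|\cdot\|_{0,\hat K}$ is the $L^2(\hat K)$ norm; let $\mathbf H^s(\hat K)=H^s(\hat K)^2$, and let $\mathbf H(\mathrm{div},\hat K)$ be the space of fields in $L^2(\hat K)^2$ with weak divergence in $L^2(\hat K)$. Let $\mathcal{RT}_0(\hat T)=\{(a,b)^\top+c(x_1,x_2)^\top\}$ and $\mathcal{RT}_0(\hat Q)=\{(a+cx_1,b+dx_2)^\top\}$ with real $a,b,c,d$. For $\mathbf u\in\mathbf H^s(\hat K)\cap\mathbf H(\mathrm{div},\hat K)$, $s>0$, the flux of $\mathbf u$ through an edge $e$ of $\hat K$ (outward unit normal $\mathbf n$) is defined by Green's formula $(\mathbf u\cdot\mathbf n,1)_{0,e}:=(\mathbf u,\nabla\varphi)_{0,\hat K}+\int_{\hat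 K}\mathrm{div}\,\mathbf u\,\varphi$, where $\varphi\in H^{1-\varepsilon}(\hat K)$, $\varepsilon\in(0,s)$, equals $1$ on $e$ and $0$ on $\partial\hat K\setminus e$ (its value does not depend on $\varphi$), and the Raviart–Thomas interpolant $\hat\Pi_{\rm RT}\mathbf u$ is the unique field in $\mathcal{RT}_0(\hat K)$ with the same flux as $\mathbf u$ through every edge of $\hat K$. (a) For every $s\in(0,1/2]$, every $l\in\{1,2\}$ and $\hat K=\hat T$ as well as $\hat K=\hat Q$, there is no constant $C$ such that $$\|(\hat\Pi_{\rm RT}\mathbf u)_l\|_{0,\hat K}\le C\big(\|u_l\|_{H^s(\hat K)}+\|\mathrm{div}\,\mathbf u\|_{0,\hat K}\big)\qquad\text{for all }\mathbf u\in\mathbf H^s(\hat K)\cap\mathbf H(\mathrm{div},\hat K).$$ In particular, this holds for $\hat K=\hat T$, $s=1/2$, $l=2$. (b) For $\varepsilon>0$ let $w^\varepsilon(x_2,x_3)=\min\{1,\varepsilon\log\log(e/r)\}$ with $r=(x_2^2+x_3^2)^{1/2}$, where $e$ is Euler's number, and let $\mathbf u^\varepsilon(x_1,x_2)=\big((1-x_1)\,\partial_2w^\varepsilon(x_2,0),\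 w^\varepsilon(x_2,0)\big)^\top$ on $\hat T$. Then, as $\varepsilon\to0$, $\|w^\varepsilon\|_{H^1(\hat T\times(0,1))}\to0$ and $\|(\mathbf u^\varepsilon)_2\|_{H^{1/2}(\hat T)}\to0$. For every $\varepsilon>0$, $\mathbf u^\varepsilon\in\mathbf H(\mathrm{div},\hat T)$, $\mathrm{div}\,\mathbf u^\varepsilon=0$ and $\hat\Pi_{\rm RT}\mathbf u^\varepsilon=(0,1)^\top$; moreover there are smooth functions $w_n$ with $w_n\to w^\varepsilon(\cdot,0)$ in $H^1(0,1)$ such that the fields $\mathbf u_n=((1-x_1)w_n'(x_2),\,w_n(x_2))^\top$ satisfy $\mathbf u_n\in\mathbf H^{1/2}(\hat T)$, $\mathrm{div}\,\mathbf u_n=0$ and $\hat\Pi_{\rm RT}\mathbf u_n\to\hat\Pi_{\rm RT}\mathbf u^\varepsilon$ in $L^2(\hat T)^2$ as $n\to\infty$. -/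

import Mathlib

open MeasureTheory Filter Topology
open scoped NNReal ENNReal ContDiff

noncomputable section

/-- The Euclidean plane. -/
abbrev Plane : Type := EuclideanSpace ℝ (Fin 2)

/-! ### Sobolev spaces

All norms take values in `[0, ∞]`. -/

/-- Test functions on `Ω`: smooth functions with compact support inside `Ω`. -/
def IsTestFunction {E : Type*} [NormedAddCommGroup E] [NormedSpace ℝ E]
    (Ω : Set E) (φ : E → ℝ) : Prop :=
  ContDiff ℝ ∞ φ ∧ HasCompactSupport φ ∧ tsupport φ ⊆ Ω

/-- `f ∈ L²(Ω)` has the weak gradient `g ∈ L²(Ω)`. -/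
def HasWeakGradient {E : Type*} [NormedAddCommGroup E] [InnerProductSpace ℝ E]
    [MeasureSpace E] (Ω : Set E) (f : E → ℝ) (g : E → E) : Prop :=
  MemLp f 2 (volume.restrict Ω) ∧ MemLp g 2 (volume.restrict Ω) ∧
    ∀ φ : E → ℝ, IsTestFunction Ω φ → ∀ v : E,
      ∫ x in Ω, f x * fderiv ℝ φ x v = -∫ x in Ω, inner ℝ (g x) v * φ x

/-- The norm `(‖f‖² + ‖∇f‖²)^(1/2)` of `H¹(Ω)`; it is `∞` if `f ∉ H¹(Ω)`. (The weak gradient is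
unique up to null sets, so the infimum is over one value, or over none.) -/
def hOneNorm {E : Type*} [NormedAddCommGroup E] [InnerProductSpace ℝ E]
    [MeasureSpace E] (Ω : Set E) (f : E → ℝ) : ℝ≥0∞ :=
  ⨅ (g : E → E) (_ : HasWeakGradient Ω f g),
    (eLpNorm f 2 (volume.restrict Ω) ^ 2 + eLpNorm g 2 (volume.restrict Ω) ^ 2) ^ (1 / 2 : ℝ)

/-- The `L²(Ω)` norm. -/
def lTwoNorm (Ω : Set Plane) (f : Plane → ℝ) : ℝ≥0∞ :=
  eLpNorm f 2 (volume.restrict Ω)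

/-- The square of the Sobolev–Slobodeckij seminorm of `H^s(Ω)`, `0 < s < 1`, `Ω ⊆ ℝ²`. -/
def slobodeckijSq (s : ℝ) (Ω : Set Plane) (f : Plane → ℝ) : ℝ≥0∞ :=
  ∫⁻ x in Ω, ∫⁻ y in Ω, ‖f x - f y‖ₑ ^ 2 / edist x y ^ (2 + 2 * s)

/-- The norm of `H^s(Ω)`, `0 < s < 1`, `Ω ⊆ ℝ²`. -/
def hsNorm (s : ℝ) (Ω : Set Plane) (f : Plane → ℝ) : ℝ≥0∞ :=
  (lTwoNorm Ω f ^ 2 + slobodeckijSq s Ω f) ^ (1 / 2 : ℝ)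

/-- `f ∈ H^s(Ω)`, `0 < s < 1`. -/
def MemHs (s : ℝ) (Ω : Set Plane) (f : Plane → ℝ) : Prop :=
  AEStronglyMeasurable f (volume.restrict Ω) ∧ hsNorm s Ω f < ⊤

/-- `u ∈ 𝐇^s(Ω) = H^s(Ω)²`, componentwise. -/
def VecMemHs (s : ℝ) (Ω : Set Plane) (u : Plane → Plane) : Prop :=
  ∀ i : Fin 2, MemHs s Ω (fun x => u x i)

/-- The field `u ∈ L²(Ω)²` has the weak divergence `d ∈ L²(Ω)`. -/
def HasWeakDiv (Ω : Set Plane) (u : Plane → Plane) (d : Plane → ℝ) : Prop :=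
  MemLp u 2 (volume.restrict Ω) ∧ MemLp d 2 (volume.restrict Ω) ∧
    ∀ φ : Plane → ℝ, IsTestFunction Ω φ →
      ∫ x in Ω, fderiv ℝ φ x (u x) = -∫ x in Ω, d x * φ x

/-- `u ∈ 𝐇(div, Ω)`. -/
def MemHdiv (Ω : Set Plane) (u : Plane → Plane) : Prop :=
  ∃ d : Plane → ℝ, HasWeakDiv Ω u d

open Classical in
/-- `div u` for `u ∈ 𝐇(div, Ω)`, determined up to null sets. -/
def weakDiv (Ω : Set Plane) (u : Plane → Plane) : Plane → ℝ :=
  if h : MemHdiv Ω u then h.choose else 0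

/-! ### Edge fluxes -/

/-- `∫ p · n ds` over the segment from `A` to `B`, for a continuous field `p`, where `n` is the unit
normal to the right of the direction `A → B` (the outward one, if the segment is an edge of a polygon
whose boundary is run through counterclockwise); `|B - A| n = (B₂ - A₂, -(B₁ - A₁))`. -/
def edgeFlux (A B : Plane) (p : Plane → Plane) : ℝ :=
  ∫ t in (0 : ℝ)..1,
    (p (A + t • (B - A)) 0 * (B 1 - A 1) - p (A + t • (B - A)) 1 * (B 0 - A 0))

/-- The flux of `u ∈ 𝐇^s(K) ∩ 𝐇(div, K)`, `s > 0`, through an edge `e` of `K`, by Green's formula: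
`(u · n, 1)_e = (u, ∇φ)_K + ∫_K (div u) φ`, where `φ = 1` on `e` and `φ = 0` on the other edges.

The functions `φ` used below are smooth in `K`, bounded, continuous up to the boundary except at the
end points of `e`, and `|∇φ|` is at most a constant over the distance to these two points. So they are
in `H^(1-ε)(K)` for all `ε > 0`, and `∇φ ∈ L^p(K)` for all `p < 2`; since `H^s(K) ⊆ L^q(K)` with
`q = 2 / (1 - s) > 2`, the pairing `(u, ∇φ)_K` is a convergent integral. -/
def greenFlux (K : Set Plane) (φ : Plane → ℝ) (u : Plane → Plane) : ℝ :=
  (∫ x in K, fderiv ℝ φ x (u x)) + ∫ x in K, weakDiv K u x * φ x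

/-! ### The reference triangle -/

/-- The open triangle with vertices `(0,0)`, `(1,0)`, `(1,1)`. -/
def refTriangle : Set Plane := {x | 0 < x 0 ∧ x 0 < 1 ∧ 0 < x 1 ∧ x 1 < x 0}

/-- The vertices of the triangle, counterclockwise; edge `i` runs from vertex `i` to `i + 1`. -/
def triVertex : Fin 3 → Plane := ![!₂[0, 0], !₂[1, 0], !₂[1, 1]]

/-- Functions on the triangle with the value `1` on edge `i` and `0` on the other two edges. -/
def triCutoff : Fin 3 → Plane → ℝ :=
  ![fun x => (1 - x 0) * (x 0 - x 1) / ((1 - x 0 + x 1) * x 0),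
    fun x => (x 0 - x 1) * x 1 / ((1 - x 1) * (1 - x 0 + x 1)),
    fun x => (1 - x 0) * x 1 / ((1 - x 1) * x 0)]

/-- The lowest order Raviart–Thomas space `{(a, b) + c (x₁, x₂)}` on the triangle. -/
def triRT : Set (Plane → Plane) :=
  {p | ∃ a b c : ℝ, p = fun x => !₂[a + c * x 0, b + c * x 1]}

/-- A field in the Raviart–Thomas space of the triangle is determined by its edge fluxes. -/
theorem existsUnique_triRT (f : Fin 3 → ℝ) :
    ∃! p : Plane → Plane, p ∈ triRT ∧
      ∀ i : Fin 3, edgeFlux (triVertex i) (triVertex (i + 1)) p = f i := by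
  have key : ∀ a b c : ℝ, (∀ i : Fin 3, edgeFlux (triVertex i) (triVertex (i + 1))
      (fun x => !₂[a + c * x 0, b + c * x 1]) = f i) ↔
      (-b = f 0 ∧ a + c = f 1 ∧ b - a = f 2) := by
    intro a b c
    rw [Fin.forall_fin_succ, Fin.forall_fin_succ, Fin.forall_fin_succ]
    simp [edgeFlux, triVertex]
    intro _ _
    rw [neg_add_eq_sub]
  refine ⟨fun x => !₂[(-f 0 - f 2) + (f 0 + f 1 + f 2) * x 0, (-f 0) + (f 0 + f 1 + f 2) * x 1],
    ⟨⟨_, _, _, rfl⟩, (key _ _ _).2 ⟨by ring, by ring, by ring⟩⟩, ?_⟩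
  rintro p ⟨⟨a, b, c, rfl⟩, hp⟩
  obtain ⟨h0, h1, h2⟩ := (key _ _ _).1 hp
  have hb : b = -f 0 := by linarith
  have ha : a = -f 0 - f 2 := by linarith
  have hc : c = f 0 + f 1 + f 2 := by linarith
  rw [ha, hb, hc]

/-- The Raviart–Thomas interpolant on the triangle: the field in the Raviart–Thomas space with the
same flux through each edge. -/
def triInterp (u : Plane → Plane) : Plane → Plane :=
  (existsUnique_triRT fun i => greenFlux refTriangle (triCutoff i) u).choose

/-! ### The reference square -/

/-- The open unit square. -/
def refSquare : Set Plane := {x | 0 < x 0 ∧ x 0 < 1 ∧ 0 < x 1 ∧ x 1 < 1}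

/-- The vertices of the square, counterclockwise; edge `i` runs from vertex `i` to `i + 1`. -/
def sqVertex : Fin 4 → Plane := ![!₂[0, 0], !₂[1, 0], !₂[1, 1], !₂[0, 1]]

/-- Functions on the square with the value `1` on edge `i` and `0` on the other three edges. -/
def sqCutoff : Fin 4 → Plane → ℝ :=
  ![fun x => x 0 * (1 - x 0) * (1 - x 1) / ((x 0 + x 1) * (1 - x 0 + x 1)),
    fun x => x 1 * (1 - x 1) * x 0 / ((x 1 + (1 - x 0)) * (1 - x 1 + (1 - x 0))),
    fun x => x 0 * (1 - x 0) * x 1 / ((x 0 + (1 - x 1)) * (1 - x 0 + (1 - x 1))),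
    fun x => x 1 * (1 - x 1) * (1 - x 0) / ((x 1 + x 0) * (1 - x 1 + x 0))]

/-- The lowest order Raviart–Thomas space `{(a + c x₁, b + d x₂)}` on the square. -/
def sqRT : Set (Plane → Plane) :=
  {p | ∃ a b c d : ℝ, p = fun x => !₂[a + c * x 0, b + d * x 1]}

/-- A field in the Raviart–Thomas space of the square is determined by its edge fluxes. -/
theorem existsUnique_sqRT (f : Fin 4 → ℝ) :
    ∃! p : Plane → Plane, p ∈ sqRT ∧
      ∀ i : Fin 4, edgeFlux (sqVertex i) (sqVertex (i + 1)) p = f i := by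
  have key : ∀ a b c d : ℝ, (∀ i : Fin 4, edgeFlux (sqVertex i) (sqVertex (i + 1))
      (fun x => !₂[a + c * x 0, b + d * x 1]) = f i) ↔
      (-b = f 0 ∧ a + c = f 1 ∧ b + d = f 2 ∧ -a = f 3) := by
    intro a b c d
    rw [Fin.forall_fin_succ, Fin.forall_fin_succ, Fin.forall_fin_succ, Fin.forall_fin_succ]
    simp [edgeFlux, sqVertex]
  refine ⟨fun x => !₂[(-f 3) + (f 1 + f 3) * x 0, (-f 0) + (f 0 + f 2) * x 1],
    ⟨⟨_, _, _, _, rfl⟩, (key _ _ _ _).2 ⟨by ring, by ring, by ring, by ring⟩⟩, ?_⟩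
  rintro p ⟨⟨a, b, c, d, rfl⟩, hp⟩
  obtain ⟨h0, h1, h2, h3⟩ := (key _ _ _ _).1 hp
  have hb : b = -f 0 := by linarith
  have ha : a = -f 3 := by linarith
  have hc : c = f 1 + f 3 := by linarith
  have hd : d = f 0 + f 2 := by linarith
  rw [ha, hb, hc, hd]

/-- The Raviart–Thomas interpolant on the square: the field in the Raviart–Thomas space with the
same flux through each edge. -/
def sqInterp (u : Plane → Plane) : Plane → Plane :=
  (existsUnique_sqRT fun i => greenFlux refSquare (sqCutoff i) u).choose

/-! ### The fields of the counterexample -/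

/-- `w^ε(x₂, x₃) = min {1, ε log log (e / r)}`, `r = (x₂² + x₃²)^(1/2)`. -/
def wEps (ε x₂ x₃ : ℝ) : ℝ :=
  min 1 (ε * Real.log (Real.log (Real.exp 1 / √(x₂ ^ 2 + x₃ ^ 2))))

/-- The prism: triangle times `(0, 1)`. -/
def refPrism : Set (EuclideanSpace ℝ (Fin 3)) :=
  {x | 0 < x 0 ∧ x 0 < 1 ∧ 0 < x 1 ∧ x 1 < x 0 ∧ 0 < x 2 ∧ x 2 < 1}

/-- The field `((1 - x₁) w'(x₂), w(x₂))`. -/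
def curlField (w : ℝ → ℝ) : Plane → Plane :=
  fun x => !₂[(1 - x 0) * deriv w (x 1), w (x 1)]

/-- `u^ε(x₁, x₂) = ((1 - x₁) ∂₂ w^ε(x₂, 0), w^ε(x₂, 0))`. -/
def uEps (ε : ℝ) : Plane → Plane := curlField fun y => wEps ε y 0

end

/-! A field `(∂₂ψ, -∂₁ψ)` is divergence free, and its flux through an edge is the difference of `ψ`
at the two end points, so its Raviart–Thomas interpolant sees only the values of `ψ` at the
vertices. For `ψ = (1 - x₁) F(x₂)` the second component of the field is `F(x₂)`, while that of the
interpolant is `F 0` on the triangle and, if `F 1 = 0`, `F 0 * (1 - x₂)` on the square. The stream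
function `x₂ F(1 - x₁)` plays the same role for the first component. An estimate as in (a) would
thus bound the point value `F 0` by the norm of `F` in `H^(1/2)(0, 1)`, and no such bound exists:
`log log (e / y)` is unbounded at `0` but belongs to `H^(1/2)(0, 1)`.

The quantitative core is `logLog_sub_sq_le`, an integrable majorant of the squared difference
quotient of `logLog`. It applies to every function whose increments are dominated by those of
`logLog` (`IsLogLogDominated`). Smooth truncations of `logLog` have uniformly bounded norms and
arbitrarily large values at `0`, which gives (a) through `not_estimate`; `w^ε(·, 0)` is dominated
with the factor `ε`, which gives the decay of the fractional norm in (b), although its limit at `0`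
stays `1`. `slobodeckijSq_half_le` transfers the bounds from the interval to functions of one
coordinate in the plane.

Since fluxes are defined by volume integrals against singular cutoffs, the flux formula needs a
proof of Green's formula: `IsFluxWeight.integral_fderiv_curlProd` integrates by parts along
horizontal and vertical lines. The gradients of the cutoffs have at most first order poles at the
vertices and are therefore integrable.

On the prism, `|∇w^ε|` is at most a multiple of `ε / (r (1 - log r))`, which is square integrable
across the axis. The smooth `w_n` round off the kink of `w^ε(·, 0)` but keep the value `1` at `0`,
so their fields have exactly the interpolant of `u^ε`. -/

noncomputable section

/-! ### Fubini in the plane -/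

/-- The coordinates of the plane, as a measurable equivalence. -/
def planeProd : Plane ≃ᵐ ℝ × ℝ :=
  (MeasurableEquiv.toLp 2 (Fin 2 → ℝ)).symm.trans MeasurableEquiv.finTwoArrow

theorem planeProd_apply (x : Plane) : planeProd x = (x 0, x 1) := rfl

theorem planeProd_symm_apply (p : ℝ × ℝ) : planeProd.symm p = !₂[p.1, p.2] := by
  rw [MeasurableEquiv.symm_apply_eq]
  simp [planeProd_apply]

theorem measurePreserving_planeProd : MeasurePreserving planeProd volume volume :=
  (volume_preserving_finTwoArrow ℝ).comp (EuclideanSpace.volume_preserving_symm_measurableEquiv_toLp (Fin 2))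

theorem plane_eta (x : Plane) : !₂[x 0, x 1] = x := by
  ext i; fin_cases i <;> rfl

theorem lintegral_plane (f : Plane → ℝ≥0∞) (hf : Measurable f) :
    ∫⁻ x, f x = ∫⁻ a, ∫⁻ b, f !₂[a, b] := by
  rw [← (measurePreserving_planeProd.symm).lintegral_comp hf,
    Measure.volume_eq_prod, lintegral_prod _ (by fun_prop)]
  simp [planeProd_symm_apply]

theorem integrable_plane_iff {f : Plane → ℝ} :
    Integrable (fun p : ℝ × ℝ => f !₂[p.1, p.2]) ↔ Integrable f := by
  have := (measurePreserving_planeProd.symm).integrable_comp_emb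
    planeProd.symm.measurableEmbedding (g := f)
  simpa [Function.comp_def, planeProd_symm_apply] using this

theorem integral_plane (f : Plane → ℝ) :
    ∫ x, f x = ∫ p : ℝ × ℝ, f !₂[p.1, p.2] := by
  rw [← (measurePreserving_planeProd.symm).integral_comp planeProd.symm.measurableEmbedding]
  simp [planeProd_symm_apply]

/-- A domain in the unit square whose horizontal slices are the intervals `(l x₂, 1)` and whose
vertical slices are the intervals `(0, b x₁)`. -/
structure IsSliced (K : Set Plane) (l b : ℝ → ℝ) : Prop where
  isOpen : IsOpen K
  mem_horizontal : ∀ x y : ℝ, !₂[x, y] ∈ K ↔ (0 < y ∧ y < 1) ∧ l y < x ∧ x < 1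
  mem_vertical : ∀ x y : ℝ, !₂[x, y] ∈ K ↔ (0 < x ∧ x < 1) ∧ 0 < y ∧ y < b x
  left_mem : ∀ y, 0 < y → y < 1 → 0 ≤ l y ∧ l y < 1
  top_mem : ∀ x, 0 < x → x < 1 → 0 < b x ∧ b x ≤ 1

theorem continuous_mk_plane {X : Type*} [TopologicalSpace X] {f g : X → ℝ} (hf : Continuous f)
    (hg : Continuous g) : Continuous fun x => (!₂[f x, g x] : Plane) := by
  refine (PiLp.continuous_toLp 2 _).comp (continuous_pi fun i => ?_)
  fin_cases i <;> simpa

theorem isSliced_refTriangle : IsSliced refTriangle (fun y => y) (fun x => x) where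
  isOpen := by
    have h0 : Continuous fun x : Plane => x 0 := by fun_prop
    have h1 : Continuous fun x : Plane => x 1 := by fun_prop
    exact (isOpen_lt continuous_const h0).inter ((isOpen_lt h0 continuous_const).inter
      ((isOpen_lt continuous_const h1).inter (isOpen_lt h1 h0)))
  mem_horizontal x y := by simp [refTriangle]; grind
  mem_vertical x y := by simp [refTriangle]; grind
  left_mem y h0 h1 := ⟨h0.le, h1⟩
  top_mem y h0 h1 := ⟨h0, h1.le⟩

theorem isSliced_refSquare : IsSliced refSquare (fun _ => 0) (fun _ => 1) where
  isOpen := by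
    have h0 : Continuous fun x : Plane => x 0 := by fun_prop
    have h1 : Continuous fun x : Plane => x 1 := by fun_prop
    exact (isOpen_lt continuous_const h0).inter ((isOpen_lt h0 continuous_const).inter
      ((isOpen_lt continuous_const h1).inter (isOpen_lt h1 continuous_const)))
  mem_horizontal x y := by simp [refSquare]; grind
  mem_vertical x y := by simp [refSquare]; grind
  left_mem y h0 h1 := ⟨le_rfl, one_pos⟩
  top_mem y h0 h1 := ⟨one_pos, le_rfl⟩

namespace IsSliced

variable {K : Set Plane} {l b : ℝ → ℝ}

theorem subset_refSquare (hK : IsSliced K l b) : K ⊆ refSquare := by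
  intro x hx
  rw [← plane_eta x] at hx
  have h1 := (hK.mem_horizontal _ _).1 hx
  have h2 := (hK.mem_vertical _ _).1 hx
  exact ⟨h2.1.1, h2.1.2, h1.1.1, h1.1.2⟩

theorem integrable_prod_indicator (hK : IsSliced K l b) {f : Plane → ℝ}
    (hf : IntegrableOn f K) :
    Integrable (fun p : ℝ × ℝ => K.indicator f !₂[p.1, p.2]) :=
  integrable_plane_iff.2 ((integrable_indicator_iff hK.isOpen.measurableSet).2 hf)

theorem indicator_horizontal (hK : IsSliced K l b) (f : Plane → ℝ) {y : ℝ}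
    (hy : y ∈ Set.Ioo (0 : ℝ) 1) :
    (fun x => K.indicator f !₂[x, y]) = (Set.Ioo (l y) 1).indicator fun x => f !₂[x, y] := by
  funext x
  have := hK.mem_horizontal x y
  by_cases h : x ∈ Set.Ioo (l y) 1
  · rw [Set.indicator_of_mem h, Set.indicator_of_mem (this.2 ⟨hy, h⟩)]
  · rw [Set.indicator_of_notMem h, Set.indicator_of_notMem fun h' => h (this.1 h').2]

theorem indicator_vertical (hK : IsSliced K l b) (f : Plane → ℝ) {x : ℝ}
    (hx : x ∈ Set.Ioo (0 : ℝ) 1) :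
    (fun y => K.indicator f !₂[x, y]) = (Set.Ioo 0 (b x)).indicator fun y => f !₂[x, y] := by
  funext y
  have := hK.mem_vertical x y
  by_cases h : y ∈ Set.Ioo 0 (b x)
  · rw [Set.indicator_of_mem h, Set.indicator_of_mem (this.2 ⟨hx, h⟩)]
  · rw [Set.indicator_of_notMem h, Set.indicator_of_notMem fun h' => h (this.1 h').2]

theorem ae_integrableOn_horizontal (hK : IsSliced K l b) {f : Plane → ℝ}
    (hf : IntegrableOn f K) :
    ∀ᵐ y, y ∈ Set.Ioo (0 : ℝ) 1 → IntegrableOn (fun x => f !₂[x, y]) (Set.Ioo (l y) 1) := by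
  filter_upwards [(hK.integrable_prod_indicator hf).prod_left_ae] with y hy h
  rw [← integrable_indicator_iff measurableSet_Ioo, ← hK.indicator_horizontal f h]
  exact hy

theorem ae_integrableOn_vertical (hK : IsSliced K l b) {f : Plane → ℝ}
    (hf : IntegrableOn f K) :
    ∀ᵐ x, x ∈ Set.Ioo (0 : ℝ) 1 → IntegrableOn (fun y => f !₂[x, y]) (Set.Ioo 0 (b x)) := by
  filter_upwards [(hK.integrable_prod_indicator hf).prod_right_ae] with y hy h
  rw [← integrable_indicator_iff measurableSet_Ioo, ← hK.indicator_vertical f h]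
  exact hy

theorem integral_horizontal (hK : IsSliced K l b) {f : Plane → ℝ} (hf : IntegrableOn f K) :
    ∫ x in K, f x = ∫ y in Set.Ioo (0 : ℝ) 1, ∫ x in Set.Ioo (l y) 1, f !₂[x, y] := by
  rw [← integral_indicator hK.isOpen.measurableSet, integral_plane, Measure.volume_eq_prod,
    integral_prod_symm _ (hK.integrable_prod_indicator hf), ← integral_indicator measurableSet_Ioo]
  congr 1
  funext y
  by_cases hy : y ∈ Set.Ioo (0 : ℝ) 1
  · rw [Set.indicator_of_mem hy, ← integral_indicator measurableSet_Ioo,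
      ← hK.indicator_horizontal f hy]
  · rw [Set.indicator_of_notMem hy]
    refine integral_eq_zero_of_ae (Eventually.of_forall fun x => ?_)
    exact Set.indicator_of_notMem (fun h => hy ((hK.mem_horizontal x y).1 h).1) _

theorem integral_vertical (hK : IsSliced K l b) {f : Plane → ℝ} (hf : IntegrableOn f K) :
    ∫ x in K, f x = ∫ x in Set.Ioo (0 : ℝ) 1, ∫ y in Set.Ioo 0 (b x), f !₂[x, y] := by
  rw [← integral_indicator hK.isOpen.measurableSet, integral_plane, Measure.volume_eq_prod,
    integral_prod _ (hK.integrable_prod_indicator hf), ← integral_indicator measurableSet_Ioo]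
  congr 1
  funext y
  by_cases hy : y ∈ Set.Ioo (0 : ℝ) 1
  · rw [Set.indicator_of_mem hy, ← integral_indicator measurableSet_Ioo,
      ← hK.indicator_vertical f hy]
  · rw [Set.indicator_of_notMem hy]
    refine integral_eq_zero_of_ae (Eventually.of_forall fun x => ?_)
    exact Set.indicator_of_notMem (fun h => hy ((hK.mem_vertical y x).1 h).1) _

end IsSliced

/-! ### Fluxes of curls -/

/-- `g` is continuous on `[0, 1]` and has the bounded measurable derivative `g'` in `(0, 1)`, up to
countably many points. -/
structure HasBoundedDeriv (g g' : ℝ → ℝ) : Prop where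
  continuousOn : ContinuousOn g (Set.Icc 0 1)
  hasDerivAt : ∃ s : Set ℝ, s.Countable ∧ ∀ x ∈ Set.Ioo (0 : ℝ) 1 \ s, HasDerivAt g (g' x) x
  measurable : Measurable g'
  bounded : ∃ C : ℝ, ∀ x ∈ Set.Ioo (0 : ℝ) 1, |g' x| ≤ C

/-- `φ` is bounded and has an integrable gradient in a sliced domain, and it is differentiable up to
the boundary, except perhaps at the end points of the sides. -/
structure IsFluxWeight (K : Set Plane) (l b : ℝ → ℝ) (φ : Plane → ℝ) : Prop where
  bounded : ∃ C : ℝ, ∀ x ∈ K, |φ x| ≤ C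
  integrable : IntegrableOn (fun x => fderiv ℝ φ x) K
  differentiable_horizontal : ∀ y ∈ Set.Ioo (0 : ℝ) 1, ∀ x ∈ Set.Icc (l y) 1,
    DifferentiableAt ℝ φ !₂[x, y]
  differentiable_vertical : ∀ x ∈ Set.Ioo (0 : ℝ) 1, ∀ y ∈ Set.Icc 0 (b x),
    DifferentiableAt ℝ φ !₂[x, y]

theorem hasDerivAt_horizontal {φ : Plane → ℝ} {x y : ℝ} (h : DifferentiableAt ℝ φ !₂[x, y]) :
    HasDerivAt (fun x => φ !₂[x, y]) (fderiv ℝ φ !₂[x, y] !₂[1, 0]) x := by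
  have h1 : HasDerivAt (fun x : ℝ => (!₂[x, y] : Plane)) !₂[1, 0] x := by
    have e : (fun x : ℝ => (!₂[x, y] : Plane)) = fun x => !₂[0, y] + x • !₂[1, 0] := by
      funext x; ext i; fin_cases i <;> simp
    rw [e]
    simpa using ((hasDerivAt_id x).smul_const (!₂[1, 0] : Plane)).const_add !₂[0, y]
  exact h.hasFDerivAt.comp_hasDerivAt x h1

theorem hasDerivAt_vertical {φ : Plane → ℝ} {x y : ℝ} (h : DifferentiableAt ℝ φ !₂[x, y]) :
    HasDerivAt (fun y => φ !₂[x, y]) (fderiv ℝ φ !₂[x, y] !₂[0, 1]) y := by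
  have h1 : HasDerivAt (fun y : ℝ => (!₂[x, y] : Plane)) !₂[0, 1] y := by
    have e : (fun y : ℝ => (!₂[x, y] : Plane)) = fun y => !₂[x, 0] + y • !₂[0, 1] := by
      funext y; ext i; fin_cases i <;> simp
    rw [e]
    simpa using ((hasDerivAt_id y).smul_const (!₂[0, 1] : Plane)).const_add !₂[x, 0]
  exact h.hasFDerivAt.comp_hasDerivAt y h1

theorem clm_plane_apply (A : Plane →L[ℝ] ℝ) (s t : ℝ) :
    A !₂[s, t] = s * A !₂[1, 0] + t * A !₂[0, 1] := by
  have : (!₂[s, t] : Plane) = s • !₂[1, 0] + t • !₂[0, 1] := by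
    ext i; fin_cases i <;> simp
  rw [this, map_add, map_smul, map_smul, smul_eq_mul, smul_eq_mul]

namespace HasBoundedDeriv

variable {g g' h h' : ℝ → ℝ}

theorem exists_bound (hg : HasBoundedDeriv g g') : ∃ C : ℝ, ∀ x ∈ Set.Icc (0 : ℝ) 1, |g x| ≤ C :=
  isCompact_Icc.exists_bound_of_continuousOn hg.continuousOn

/-- The fundamental theorem of calculus for `F * g`, off the countable exceptional set of `g`.
Integrability is a hypothesis because `F` will be a slice of a cutoff, whose gradient is unbounded;
Fubini provides it on almost every slice. -/
theorem integral_eq_sub (hg : HasBoundedDeriv g g') {F F' : ℝ → ℝ} {p q : ℝ} (hp : 0 ≤ p)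
    (hpq : p ≤ q) (hq : q ≤ 1) (hF : ∀ x ∈ Set.Icc p q, HasDerivAt F (F' x) x)
    (hi : IntegrableOn (fun x => F' x * g x + F x * g' x) (Set.Ioo p q)) :
    ∫ x in Set.Ioo p q, (F' x * g x + F x * g' x) = F q * g q - F p * g p := by
  obtain ⟨s, hs, hd⟩ := hg.hasDerivAt
  rw [← integral_Ioc_eq_integral_Ioo, ← intervalIntegral.integral_of_le hpq]
  refine integral_eq_of_hasDerivAt_off_countable_of_le (fun x => F x * g x) _ hpq hs ?_ ?_ ?_
  · have hc : ContinuousOn F (Set.Icc p q) := fun x hx => (hF x hx).continuousAt.continuousWithinAt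
    exact hc.mul (hg.continuousOn.mono (Set.Icc_subset_Icc hp hq))
  · intro x hx
    exact (hF x (Set.Ioo_subset_Icc_self hx.1)).mul
      (hd x ⟨⟨hp.trans_lt hx.1.1, hx.1.2.trans_le hq⟩, hx.2⟩)
  · rw [intervalIntegrable_iff_integrableOn_Ioo_of_le hpq]
    exact hi

theorem integral_deriv (hg : HasBoundedDeriv g g') :
    ∫ x in Set.Ioo (0 : ℝ) 1, g' x = g 1 - g 0 := by
  have := hg.integral_eq_sub (F := fun _ => 1) (F' := fun _ => 0) le_rfl zero_le_one le_rfl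
    (fun x _ => hasDerivAt_const x 1) ?_
  · simpa using this
  · obtain ⟨C, hC⟩ := hg.bounded
    simp only [zero_mul, one_mul, zero_add]
    exact Measure.integrableOn_of_bounded (by simp) hg.measurable.aestronglyMeasurable
      ((ae_restrict_mem measurableSet_Ioo).mono hC)

theorem integrableOn_deriv (hg : HasBoundedDeriv g g') : IntegrableOn g' (Set.Ioo 0 1) := by
  obtain ⟨C, hC⟩ := hg.bounded
  exact Measure.integrableOn_of_bounded (by simp) hg.measurable.aestronglyMeasurable
      ((ae_restrict_mem measurableSet_Ioo).mono hC)

/-- Needed on the diagonal of the triangle, which contributes to both boundary integrals of Green's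
formula. -/
theorem integral_deriv_mul (hg : HasBoundedDeriv g g') (hh : HasBoundedDeriv h h') :
    ∫ x in Set.Ioo (0 : ℝ) 1, g' x * h x + g x * h' x = g 1 * h 1 - g 0 * h 0 := by
  obtain ⟨s, hs, hd⟩ := hg.hasDerivAt
  obtain ⟨s', hs', hd'⟩ := hh.hasDerivAt
  rw [← integral_Ioc_eq_integral_Ioo, ← intervalIntegral.integral_of_le zero_le_one]
  refine integral_eq_of_hasDerivAt_off_countable_of_le (fun x => g x * h x) _ zero_le_one
    (hs.union hs') (hg.continuousOn.mul hh.continuousOn) ?_ ?_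
  · intro x hx
    exact (hd x ⟨hx.1, fun h => hx.2 (Or.inl h)⟩).mul (hd' x ⟨hx.1, fun h => hx.2 (Or.inr h)⟩)
  · rw [intervalIntegrable_iff_integrableOn_Icc_of_le zero_le_one]
    have e1 := hg.integrableOn_deriv
    have e2 := hh.integrableOn_deriv
    rw [← integrableOn_Icc_iff_integrableOn_Ioo] at e1 e2
    exact (e1.mul_continuousOn hh.continuousOn isCompact_Icc).add
      (e2.continuousOn_mul hg.continuousOn isCompact_Icc)

end HasBoundedDeriv

/-- The field `(∂₂ψ, -∂₁ψ)` for `ψ(x) = g(x₁) h(x₂)`. -/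
def curlProd (g g' h h' : ℝ → ℝ) : Plane → Plane :=
  fun x => !₂[g (x 0) * h' (x 1), -(g' (x 0) * h (x 1))]

section

variable {K : Set Plane} {l b : ℝ → ℝ} {φ : Plane → ℝ} {g g' h h' : ℝ → ℝ}

/-- Only the behaviour of `g` on `(0, 1)` is known, so `g` is extended by zero and then pulled back
along the coordinate, under which preimages of null sets are null. -/
theorem aestronglyMeasurable_comp_coord {g : ℝ → ℝ} (hg : AEStronglyMeasurable g (volume.restrict (Set.Ioo 0 1)))
    (hK : K ⊆ refSquare) (i : Fin 2) :
    AEStronglyMeasurable (fun x : Plane => g (x i)) (volume.restrict K) := by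
  have hm : Measure.QuasiMeasurePreserving (fun x : Plane => x i) volume volume := by
    have h1 : Measure.QuasiMeasurePreserving (fun p : Fin 2 → ℝ => p i) volume volume :=
      Measure.quasiMeasurePreserving_eval _ i
    exact h1.comp (EuclideanSpace.volume_preserving_symm_measurableEquiv_toLp
      (Fin 2)).quasiMeasurePreserving
  have h2 := (aestronglyMeasurable_indicator_iff measurableSet_Ioo).2 hg
  refine (AEStronglyMeasurable.congr (f := fun x : Plane => (Set.Ioo (0 : ℝ) 1).indicator g (x i))
    (h2.comp_quasiMeasurePreserving hm).restrict ?_).mono_measure (Measure.restrict_mono hK le_rfl)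
  filter_upwards [ae_restrict_mem isSliced_refSquare.isOpen.measurableSet] with x hx
  refine Set.indicator_of_mem ?_ _
  fin_cases i
  exacts [⟨hx.1, hx.2.1⟩, ⟨hx.2.2.1, hx.2.2.2⟩]

theorem HasBoundedDeriv.aestronglyMeasurable_comp_coord (hg : HasBoundedDeriv g g')
    (hK : K ⊆ refSquare) (i : Fin 2) :
    AEStronglyMeasurable (fun x : Plane => g (x i)) (volume.restrict K) :=
  _root_.aestronglyMeasurable_comp_coord
    ((hg.continuousOn.mono Set.Ioo_subset_Icc_self).aestronglyMeasurable measurableSet_Ioo) hK i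

theorem HasBoundedDeriv.exists_bound_comp_coord (hg : HasBoundedDeriv g g')
    (hK : K ⊆ refSquare) (i : Fin 2) :
    ∃ C : ℝ, ∀ x ∈ K, |g (x i)| ≤ C := by
  obtain ⟨C, hC⟩ := hg.exists_bound
  refine ⟨C, fun x hx => hC _ ?_⟩
  obtain ⟨h1, h2, h3, h4⟩ := hK hx
  fin_cases i
  exacts [⟨h1.le, h2.le⟩, ⟨h3.le, h4.le⟩]

theorem HasBoundedDeriv.exists_bound_deriv_comp_coord (hg : HasBoundedDeriv g g')
    (hK : K ⊆ refSquare) (i : Fin 2) :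
    ∃ C : ℝ, ∀ x ∈ K, |g' (x i)| ≤ C := by
  obtain ⟨C, hC⟩ := hg.bounded
  refine ⟨C, fun x hx => hC _ ?_⟩
  obtain ⟨h1, h2, h3, h4⟩ := hK hx
  fin_cases i
  exacts [⟨h1, h2⟩, ⟨h3, h4⟩]

theorem IsSliced.volume_lt_top (hK : IsSliced K l b) : volume K < ⊤ := by
  refine (measure_mono hK.subset_refSquare).trans_lt (Bornology.IsBounded.measure_lt_top ?_)
  refine (Metric.isBounded_iff_subset_closedBall (0 : Plane)).2 ⟨2, fun x hx => ?_⟩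
  obtain ⟨h1, h2, h3, h4⟩ := hx
  rw [mem_closedBall_zero_iff, EuclideanSpace.norm_eq, Fin.sum_univ_two]
  refine Real.sqrt_le_iff.2 ⟨by norm_num, ?_⟩
  simp only [Real.norm_eq_abs, sq_abs]
  nlinarith

theorem IsFluxWeight.differentiableAt (hK : IsSliced K l b) (hφ : IsFluxWeight K l b φ) {x : Plane}
    (hx : x ∈ K) : DifferentiableAt ℝ φ x := by
  rw [← plane_eta x] at hx ⊢
  obtain ⟨h1, h2, h3⟩ := (hK.mem_horizontal _ _).1 hx
  exact hφ.differentiable_horizontal _ h1 _ ⟨h2.le, h3.le⟩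

theorem IsFluxWeight.aestronglyMeasurable (hK : IsSliced K l b) (hφ : IsFluxWeight K l b φ) :
    AEStronglyMeasurable φ (volume.restrict K) := by
  exact ContinuousOn.aestronglyMeasurable (fun x hx =>
    (hφ.differentiableAt hK hx).continuousAt.continuousWithinAt) hK.isOpen.measurableSet

/-- Green's formula for the field `curlProd g g' h h'`. -/
theorem IsFluxWeight.integral_fderiv_curlProd (hK : IsSliced K l b) (hφ : IsFluxWeight K l b φ)
    (hg : HasBoundedDeriv g g') (hh : HasBoundedDeriv h h') :
    IntegrableOn (fun x => fderiv ℝ φ x (curlProd g g' h h' x)) K ∧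
    ∫ x in K, fderiv ℝ φ x (curlProd g g' h h' x) =
      (∫ y in Set.Ioo (0 : ℝ) 1, h' y * (φ !₂[1, y] * g 1 - φ !₂[l y, y] * g (l y))) -
      ∫ x in Set.Ioo (0 : ℝ) 1, g' x * (φ !₂[x, b x] * h (b x) - φ !₂[x, 0] * h 0) := by
  have hm := hK.subset_refSquare
  have mg := hg.aestronglyMeasurable_comp_coord hm 0
  have mh := hh.aestronglyMeasurable_comp_coord hm 1
  have mg' : AEStronglyMeasurable (fun x : Plane => g' (x 0)) (volume.restrict K) :=
    (hg.measurable.comp (by fun_prop)).aestronglyMeasurable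
  have mh' : AEStronglyMeasurable (fun x : Plane => h' (x 1)) (volume.restrict K) :=
    (hh.measurable.comp (by fun_prop)).aestronglyMeasurable
  obtain ⟨Cg, hCg⟩ := hg.exists_bound_comp_coord hm 0
  obtain ⟨Ch, hCh⟩ := hh.exists_bound_comp_coord hm 1
  obtain ⟨Cg', hCg'⟩ := hg.exists_bound_deriv_comp_coord hm 0
  obtain ⟨Ch', hCh'⟩ := hh.exists_bound_deriv_comp_coord hm 1
  obtain ⟨Cφ, hCφ⟩ := hφ.bounded
  have aeK := ae_restrict_mem (μ := (volume : Measure Plane)) hK.isOpen.measurableSet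
  have : IsFiniteMeasure (volume.restrict K) := ⟨by simpa using hK.volume_lt_top⟩
  have iφ : IntegrableOn φ K := Integrable.of_bound (hφ.aestronglyMeasurable hK) Cφ (aeK.mono hCφ)
  have i1 : IntegrableOn (fun x => fderiv ℝ φ x !₂[1, 0]) K :=
    hφ.integrable.apply_continuousLinearMap _
  have i2 : IntegrableOn (fun x => fderiv ℝ φ x !₂[0, 1]) K :=
    hφ.integrable.apply_continuousLinearMap _
  have iP : IntegrableOn (fun x => fderiv ℝ φ x !₂[1, 0] * g (x 0) + φ x * g' (x 0)) K :=
    (Integrable.mul_bdd i1 mg (aeK.mono hCg)).add (Integrable.mul_bdd iφ mg' (aeK.mono hCg'))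
  have iQ : IntegrableOn (fun x => fderiv ℝ φ x !₂[0, 1] * h (x 1) + φ x * h' (x 1)) K :=
    (Integrable.mul_bdd i2 mh (aeK.mono hCh)).add (Integrable.mul_bdd iφ mh' (aeK.mono hCh'))
  have iP' := Integrable.mul_bdd iP mh' (aeK.mono hCh')
  have iQ' := Integrable.mul_bdd iQ mg' (aeK.mono hCg')
  -- The terms `φ g' h'` added to the two products cancel. They complete each bracket to a full
  -- derivative, `∂₁(φ g)` and `∂₂(φ h)`, while the remaining factor is constant on the slice; so no
  -- second derivatives of `g h` are needed.
  have e : (fun x => fderiv ℝ φ x (curlProd g g' h h' x)) = fun x =>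
      (fderiv ℝ φ x !₂[1, 0] * g (x 0) + φ x * g' (x 0)) * h' (x 1) -
      (fderiv ℝ φ x !₂[0, 1] * h (x 1) + φ x * h' (x 1)) * g' (x 0) := by
    funext x
    rw [curlProd, clm_plane_apply]
    ring
  rw [e]
  refine ⟨iP'.sub iQ', ?_⟩
  rw [integral_sub iP' iQ', hK.integral_horizontal iP', hK.integral_vertical iQ']
  congr 1
  · refine setIntegral_congr_ae measurableSet_Ioo ?_
    -- On almost every horizontal slice the bracket is integrable, and only the values of `φ g` at
    -- the two ends survive.
    filter_upwards [hK.ae_integrableOn_horizontal iP] with y hy hy01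
    obtain ⟨hl0, hl1⟩ := hK.left_mem y hy01.1 hy01.2
    have := hg.integral_eq_sub (F := fun x => φ !₂[x, y]) hl0 hl1.le le_rfl
      (fun x hx => hasDerivAt_horizontal (hφ.differentiable_horizontal y hy01 x hx)) (hy hy01)
    rw [← this, mul_comm, ← integral_mul_const]
    rfl
  · refine setIntegral_congr_ae measurableSet_Ioo ?_
    filter_upwards [hK.ae_integrableOn_vertical iQ] with x hx hx01
    obtain ⟨hb0, hb1⟩ := hK.top_mem x hx01.1 hx01.2
    have := hh.integral_eq_sub (F := fun y => φ !₂[x, y]) le_rfl hb0.le hb1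
      (fun y hy => hasDerivAt_vertical (hφ.differentiable_vertical x hx01 y hy)) (hx hx01)
    rw [← this, mul_comm, ← integral_mul_const]
    rfl

end

/-! ### Cutoff functions -/

/-- An integrable function on `(0, 1)` with inverse square root singularities at the end points. -/
def invSqrtEnds (t : ℝ) : ℝ := 1 / √t + 1 / √(1 - t)

theorem invSqrtEnds_one_sub (t : ℝ) : invSqrtEnds (1 - t) = invSqrtEnds t := by
  simp [invSqrtEnds, add_comm]

theorem integrableOn_one_div_sqrt : IntegrableOn (fun t : ℝ => 1 / √t) (Set.Ioo 0 1) := by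
  have h := intervalIntegral.intervalIntegrable_rpow' (a := 0) (b := 1) (r := -(1 / 2))
    (by norm_num)
  rw [intervalIntegrable_iff_integrableOn_Ioo_of_le zero_le_one] at h
  refine h.congr_fun (fun t ht => ?_) measurableSet_Ioo
  simp only
  rw [Real.rpow_neg ht.1.le, ← Real.sqrt_eq_rpow, one_div]

theorem integrableOn_invSqrtEnds : IntegrableOn invSqrtEnds (Set.Ioo 0 1) := by
  refine integrableOn_one_div_sqrt.add ?_
  have h := integrableOn_one_div_sqrt
  rw [← intervalIntegrable_iff_integrableOn_Ioo_of_le zero_le_one] at h ⊢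
  simpa using (h.comp_sub_left 1).symm

theorem invSqrtEnds_nonneg (t : ℝ) : 0 ≤ invSqrtEnds t := by
  unfold invSqrtEnds; positivity

theorem one_le_invSqrtEnds {t : ℝ} (ht : t ∈ Set.Ioo (0 : ℝ) 1) : 1 ≤ invSqrtEnds t := by
  have h1 : 1 ≤ 1 / √t := by
    rw [le_div_iff₀ (Real.sqrt_pos.2 ht.1), one_mul]
    exact Real.sqrt_le_one.2 ht.2.le
  have h2 : 0 ≤ 1 / √(1 - t) := by positivity
  unfold invSqrtEnds
  linarith

/-- Splits a first order pole into a product of integrable functions of one variable: `a b ≤ r²`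
gives `1 / r ≤ (1 / √a) (1 / √b)`. -/
theorem one_div_le_invSqrtEnds_mul {a b r : ℝ} (ha : 0 < a) (hb : 0 < b) (hr : 0 < r)
    (h : a * b ≤ r ^ 2) : 1 / r ≤ invSqrtEnds a * invSqrtEnds b := by
  have h1 : 1 / r ≤ (1 / √a) * (1 / √b) := by
    rw [one_div_mul_one_div, ← Real.sqrt_mul ha.le]
    exact one_div_le_one_div_of_le (Real.sqrt_pos.2 (mul_pos ha hb)) (Real.sqrt_le_iff.2 ⟨hr.le, h⟩)
  refine h1.trans (mul_le_mul ?_ ?_ (by positivity) (invSqrtEnds_nonneg _)) <;>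
  · unfold invSqrtEnds
    exact le_add_of_nonneg_right (by positivity)

/-- A majorant for functions which have a pole of first order at each corner of the square. -/
def cornerWeight (x : Plane) : ℝ := invSqrtEnds (x 0) * invSqrtEnds (x 1)

theorem integrableOn_cornerWeight : IntegrableOn cornerWeight refSquare := by
  rw [← integrable_indicator_iff isSliced_refSquare.isOpen.measurableSet, ← integrable_plane_iff]
  have h := (integrable_indicator_iff measurableSet_Ioo).2 integrableOn_invSqrtEnds
  refine (h.mul_prod h).congr (Eventually.of_forall fun p => ?_)
  simp only [Set.indicator, refSquare, cornerWeight]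
  simp
  grind

/-- Every cutoff is a product of quotients `p / (p + q)` of affine functions, so closure under
products reduces the cutoffs to one such quotient. -/
theorem IsFluxWeight.mul {K : Set Plane} {l b : ℝ → ℝ} {φ ψ : Plane → ℝ} (hK : IsSliced K l b)
    (hφ : IsFluxWeight K l b φ) (hψ : IsFluxWeight K l b ψ) :
    IsFluxWeight K l b fun x => φ x * ψ x := by
  obtain ⟨C, hC⟩ := hφ.bounded
  obtain ⟨D, hD⟩ := hψ.bounded
  have ae := ae_restrict_mem (μ := (volume : Measure Plane)) hK.isOpen.measurableSet
  refine ⟨⟨C * D, fun x hx => ?_⟩, ?_, fun y hy x hx => ?_, fun x hx y hy => ?_⟩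
  · rw [abs_mul]
    exact mul_le_mul (hC x hx) (hD x hx) (abs_nonneg _) ((abs_nonneg _).trans (hC x hx))
  · have h1 : IntegrableOn (fun x => φ x • fderiv ℝ ψ x + ψ x • fderiv ℝ φ x) K :=
      (hψ.integrable.bdd_smul C (hφ.aestronglyMeasurable hK) (ae.mono hC)).add
        (hφ.integrable.bdd_smul D (hψ.aestronglyMeasurable hK) (ae.mono hD))
    refine h1.congr_fun (fun x hx => ?_) hK.isOpen.measurableSet
    exact (fderiv_fun_mul (hφ.differentiableAt hK hx) (hψ.differentiableAt hK hx)).symm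
  · exact (hφ.differentiable_horizontal y hy x hx).mul (hψ.differentiable_horizontal y hy x hx)
  · exact (hφ.differentiable_vertical x hx y hy).mul (hψ.differentiable_vertical x hx y hy)

/-- The affine function `c + a x₁ + b x₂`. -/
def affineFun (c a b : ℝ) (x : Plane) : ℝ := c + a * x 0 + b * x 1

theorem hasFDerivAt_affineFun (c a b : ℝ) (x : Plane) :
    HasFDerivAt (affineFun c a b) (a • EuclideanSpace.proj (𝕜 := ℝ) 0 +
      b • EuclideanSpace.proj (𝕜 := ℝ) 1 : Plane →L[ℝ] ℝ) x := by
  have h0 : HasFDerivAt (fun x : Plane => x 0) (EuclideanSpace.proj (𝕜 := ℝ) 0 : Plane →L[ℝ] ℝ) x :=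
    (EuclideanSpace.proj (𝕜 := ℝ) 0 : Plane →L[ℝ] ℝ).hasFDerivAt
  have h1 : HasFDerivAt (fun x : Plane => x 1) (EuclideanSpace.proj (𝕜 := ℝ) 1 : Plane →L[ℝ] ℝ) x :=
    (EuclideanSpace.proj (𝕜 := ℝ) 1 : Plane →L[ℝ] ℝ).hasFDerivAt
  exact ((h0.const_mul a).const_add c).add (h1.const_mul b)

/-- The gradient of `p / (p + q)` is `(q ∇p - p ∇q) / (p + q)²`. For positive `p` and `q` the
fractions `p / (p + q)` and `q / (p + q)` are at most `1`, so the gradient is bounded by a constant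
times `1 / (p + q)`, which `cornerWeight` majorizes. -/
theorem isFluxWeight_affineFun_div {K : Set Plane} {l b : ℝ → ℝ} (hK : IsSliced K l b)
    (c₁ a₁ b₁ c₂ a₂ b₂ : ℝ) (hp : ∀ x ∈ K, 0 < affineFun c₁ a₁ b₁ x)
    (hq : ∀ x ∈ K, 0 < affineFun c₂ a₂ b₂ x)
    (hpq : ∀ x ∈ K, 1 / (affineFun c₁ a₁ b₁ x + affineFun c₂ a₂ b₂ x) ≤ cornerWeight x)
    (hh : ∀ y ∈ Set.Ioo (0 : ℝ) 1, ∀ x ∈ Set.Icc (l y) 1,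
      affineFun c₁ a₁ b₁ !₂[x, y] + affineFun c₂ a₂ b₂ !₂[x, y] ≠ 0)
    (hv : ∀ x ∈ Set.Ioo (0 : ℝ) 1, ∀ y ∈ Set.Icc 0 (b x),
      affineFun c₁ a₁ b₁ !₂[x, y] + affineFun c₂ a₂ b₂ !₂[x, y] ≠ 0) :
    IsFluxWeight K l b fun x => affineFun c₁ a₁ b₁ x /
      (affineFun c₁ a₁ b₁ x + affineFun c₂ a₂ b₂ x) := by
  set A : Plane →L[ℝ] ℝ := a₁ • EuclideanSpace.proj (𝕜 := ℝ) 0 + b₁ • EuclideanSpace.proj (𝕜 := ℝ) 1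
  set B : Plane →L[ℝ] ℝ := a₂ • EuclideanSpace.proj (𝕜 := ℝ) 0 + b₂ • EuclideanSpace.proj (𝕜 := ℝ) 1
  have hd : ∀ x, affineFun c₁ a₁ b₁ x + affineFun c₂ a₂ b₂ x ≠ 0 →
      HasFDerivAt (fun x => affineFun c₁ a₁ b₁ x / (affineFun c₁ a₁ b₁ x + affineFun c₂ a₂ b₂ x))
      (affineFun c₁ a₁ b₁ x • (-((affineFun c₁ a₁ b₁ x + affineFun c₂ a₂ b₂ x) ^ 2)⁻¹ • (A + B)) +
        (affineFun c₁ a₁ b₁ x + affineFun c₂ a₂ b₂ x)⁻¹ • A) x := fun x hx => by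
    have hA := hasFDerivAt_affineFun c₁ a₁ b₁ x
    have hB := hasFDerivAt_affineFun c₂ a₂ b₂ x
    simp only [div_eq_mul_inv]
    exact hA.mul ((hasDerivAt_inv hx).comp_hasFDerivAt x (hA.add hB))
  refine ⟨⟨1, fun x hx => ?_⟩, ?_, fun y hy x hx => (hd _ (hh y hy x hx)).differentiableAt,
    fun x hx y hy => (hd _ (hv x hx y hy)).differentiableAt⟩
  · have hp := hp x hx
    have hq := hq x hx
    rw [abs_of_nonneg (by positivity), div_le_one (by positivity)]
    linarith
  · refine Integrable.mono' ((integrableOn_cornerWeight.mono_set hK.subset_refSquare).const_mul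
      (‖A‖ + ‖B‖)) (measurable_fderiv ℝ _).aestronglyMeasurable ?_
    filter_upwards [ae_restrict_mem hK.isOpen.measurableSet] with x hx
    have hp := hp x hx
    have hq := hq x hx
    have hpq := hpq x hx
    rw [(hd x (by positivity)).fderiv]
    set p := affineFun c₁ a₁ b₁ x
    set q := affineFun c₂ a₂ b₂ x
    have hs : 0 < p + q := by positivity
    have e : p • (-((p + q) ^ 2)⁻¹ • (A + B)) + (p + q)⁻¹ • A =
        (1 / (p + q)) • ((q / (p + q)) • A - (p / (p + q)) • B) := by
      have h1 : (1 / (p + q)) * (q / (p + q)) = (p + q)⁻¹ - p * ((p + q) ^ 2)⁻¹ := by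
        field_simp
        ring
      have h2 : (1 / (p + q)) * (p / (p + q)) = p * ((p + q) ^ 2)⁻¹ := by
        field_simp
      rw [smul_sub, smul_smul (1 / (p + q)), smul_smul (1 / (p + q)), h1, h2]
      module
    have e' : ‖(1 / (p + q)) • ((q / (p + q)) • A - (p / (p + q)) • B)‖ ≤
        (1 / (p + q)) * (‖A‖ + ‖B‖) := by
      rw [norm_smul, Real.norm_of_nonneg (by positivity)]
      gcongr
      refine (norm_sub_le _ _).trans ?_
      rw [norm_smul, norm_smul, Real.norm_of_nonneg (by positivity),
        Real.norm_of_nonneg (by positivity)]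
      have h1 : q / (p + q) ≤ 1 := by rw [div_le_one hs]; linarith
      have h2 : p / (p + q) ≤ 1 := by rw [div_le_one hs]; linarith
      have h3 := mul_le_mul_of_nonneg_right h1 (norm_nonneg A)
      have h4 := mul_le_mul_of_nonneg_right h2 (norm_nonneg B)
      linarith
    rw [e]
    refine e'.trans ?_
    rw [mul_comm]
    gcongr

theorem IsTestFunction.isFluxWeight {K : Set Plane} {l b : ℝ → ℝ} {φ : Plane → ℝ}
    (hφ : IsTestFunction K φ) : IsFluxWeight K l b φ := by
  obtain ⟨h1, h2, h3⟩ := hφ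
  have hd : Differentiable ℝ φ := h1.differentiable (by simp)
  obtain ⟨C, hC⟩ := h1.continuous.bounded_above_of_compact_support h2
  refine ⟨⟨C, fun x _ => hC x⟩, ?_, fun _ _ _ _ => hd _, fun _ _ _ _ => hd _⟩
  exact ((h1.continuous_fderiv (by simp)).integrable_of_hasCompactSupport
    (h2.fderiv ℝ)).integrableOn

theorem IsTestFunction.eq_zero_of_notMem {K : Set Plane} {φ : Plane → ℝ}
    (hφ : IsTestFunction K φ) {x : Plane} (hx : x ∉ K) : φ x = 0 :=
  image_eq_zero_of_notMem_tsupport fun h => hx (hφ.2.2 h)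

/-! ### Divergence-free fields -/

/-- `weakDiv` is an arbitrary choice among the weak divergences; the fundamental lemma of the
calculus of variations makes any two of them agree almost everywhere. -/
theorem weakDiv_ae_eq_zero {K : Set Plane} (hK : IsOpen K) {u : Plane → Plane}
    (hu : HasWeakDiv K u 0) : ∀ᵐ x ∂volume.restrict K, weakDiv K u x = 0 := by
  have hm : MemHdiv K u := ⟨0, hu⟩
  have hd : HasWeakDiv K u (weakDiv K u) := by
    rw [weakDiv, dif_pos hm]
    exact hm.choose_spec
  rw [ae_restrict_iff' hK.measurableSet]
  refine hK.ae_eq_zero_of_integral_contDiff_smul_eq_zero ?_ fun φ h1 h2 h3 => ?_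
  · rw [locallyIntegrableOn_iff hK.isLocallyClosed]
    intro k hk hkc
    have := hd.2.1.mono_measure (Measure.restrict_mono hk le_rfl)
    have : IsFiniteMeasure (volume.restrict k) := ⟨by simpa using hkc.measure_lt_top⟩
    exact MemLp.integrable one_le_two ‹_›
  · have e1 := hd.2.2 φ ⟨h1, h2, h3⟩
    rw [hu.2.2 φ ⟨h1, h2, h3⟩] at e1
    simp only [Pi.zero_apply, zero_mul, integral_zero, neg_zero, zero_eq_neg] at e1
    rw [setIntegral_eq_integral_of_forall_compl_eq_zero] at e1
    · simpa [mul_comm] using e1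
    · intro x hx
      rw [IsTestFunction.eq_zero_of_notMem ⟨h1, h2, h3⟩ hx, mul_zero]

section

variable {K : Set Plane} {l b : ℝ → ℝ} {φ : Plane → ℝ} {g g' h h' : ℝ → ℝ} {u : Plane → Plane}

theorem aestronglyMeasurable_plane {u₁ u₂ : Plane → ℝ} {μ : Measure Plane}
    (h₁ : AEStronglyMeasurable u₁ μ) (h₂ : AEStronglyMeasurable u₂ μ) :
    AEStronglyMeasurable (fun x => (!₂[u₁ x, u₂ x] : Plane)) μ :=
  (continuous_mk_plane continuous_fst continuous_snd).comp_aestronglyMeasurable (h₁.prodMk h₂)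

/-- The ends of all slices lie outside `K`, where a test function vanishes, so both boundary
integrals in Green's formula are zero. -/
theorem hasWeakDiv_curlProd (hK : IsSliced K l b) (hg : HasBoundedDeriv g g')
    (hh : HasBoundedDeriv h h') (hu : ∀ x ∈ K, u x = curlProd g g' h h' x)
    (hl : ∀ y ∈ Set.Ioo (0 : ℝ) 1, !₂[l y, y] ∉ K) (hb : ∀ x ∈ Set.Ioo (0 : ℝ) 1, !₂[x, b x] ∉ K) :
    HasWeakDiv K u 0 := by
  have hm := hK.subset_refSquare
  have ae := ae_restrict_mem (μ := (volume : Measure Plane)) hK.isOpen.measurableSet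
  have : IsFiniteMeasure (volume.restrict K) := ⟨by simpa using hK.volume_lt_top⟩
  refine ⟨?_, MemLp.zero, fun φ hφ => ?_⟩
  · refine MemLp.ae_eq (f := curlProd g g' h h') (ae.mono fun x hx => (hu x hx).symm) ?_
    obtain ⟨Cg, hCg⟩ := hg.exists_bound_comp_coord hm 0
    obtain ⟨Ch, hCh⟩ := hh.exists_bound_comp_coord hm 1
    obtain ⟨Cg', hCg'⟩ := hg.exists_bound_deriv_comp_coord hm 0
    obtain ⟨Ch', hCh'⟩ := hh.exists_bound_deriv_comp_coord hm 1
    refine MemLp.of_bound ?_ (Cg * Ch' + Cg' * Ch) (ae.mono fun x hx => ?_)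
    · exact aestronglyMeasurable_plane
        ((hg.aestronglyMeasurable_comp_coord hm 0).mul
          (hh.measurable.comp (by fun_prop)).aestronglyMeasurable)
        (((hg.measurable.comp (by fun_prop)).aestronglyMeasurable.mul
          (hh.aestronglyMeasurable_comp_coord hm 1)).neg)
    · have h1 : |g (x 0) * h' (x 1)| ≤ Cg * Ch' := by
        rw [abs_mul]
        exact mul_le_mul (hCg x hx) (hCh' x hx) (abs_nonneg _) ((abs_nonneg _).trans (hCg x hx))
      have h2 : |g' (x 0) * h (x 1)| ≤ Cg' * Ch := by
        rw [abs_mul]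
        exact mul_le_mul (hCg' x hx) (hCh x hx) (abs_nonneg _) ((abs_nonneg _).trans (hCg' x hx))
      have h3 := abs_nonneg (g (x 0) * h' (x 1))
      have h4 := abs_nonneg (g' (x 0) * h (x 1))
      rw [EuclideanSpace.norm_eq, Fin.sum_univ_two]
      refine Real.sqrt_le_iff.2 ⟨by linarith, ?_⟩
      simp only [curlProd, Real.norm_eq_abs]
      simp only [Matrix.cons_val_zero, Matrix.cons_val_one, abs_neg]
      nlinarith [mul_nonneg (h3.trans h1) (h4.trans h2)]
  · rw [setIntegral_congr_fun hK.isOpen.measurableSet (g := fun x => fderiv ℝ φ x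
      (curlProd g g' h h' x)) fun x hx => by simp only [hu x hx],
      (hφ.isFluxWeight.integral_fderiv_curlProd hK hg hh).2]
    have e1 : ∀ y ∈ Set.Ioo (0 : ℝ) 1,
        h' y * (φ !₂[1, y] * g 1 - φ !₂[l y, y] * g (l y)) = 0 := fun y hy => by
      rw [hφ.eq_zero_of_notMem (hl y hy),
        hφ.eq_zero_of_notMem fun h => lt_irrefl _ ((hK.mem_horizontal 1 y).1 h).2.2]
      ring
    have e2 : ∀ x ∈ Set.Ioo (0 : ℝ) 1,
        g' x * (φ !₂[x, b x] * h (b x) - φ !₂[x, 0] * h 0) = 0 := fun x hx => by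
      rw [hφ.eq_zero_of_notMem (hb x hx),
        hφ.eq_zero_of_notMem fun h => lt_irrefl _ ((hK.mem_vertical x 0).1 h).2.1]
      ring
    rw [setIntegral_congr_fun measurableSet_Ioo e1, setIntegral_congr_fun measurableSet_Ioo e2]
    simp

theorem greenFlux_curlProd (hK : IsSliced K l b) (hφ : IsFluxWeight K l b φ)
    (hg : HasBoundedDeriv g g') (hh : HasBoundedDeriv h h')
    (hu : ∀ x ∈ K, u x = curlProd g g' h h' x) (hdiv : HasWeakDiv K u 0) :
    greenFlux K φ u =
      (∫ y in Set.Ioo (0 : ℝ) 1, h' y * (φ !₂[1, y] * g 1 - φ !₂[l y, y] * g (l y))) -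
      ∫ x in Set.Ioo (0 : ℝ) 1, g' x * (φ !₂[x, b x] * h (b x) - φ !₂[x, 0] * h 0) := by
  rw [greenFlux, ← (hφ.integral_fderiv_curlProd hK hg hh).2,
    setIntegral_congr_fun hK.isOpen.measurableSet (g := fun x => fderiv ℝ φ x
      (curlProd g g' h h' x)) fun x hx => by simp only [hu x hx]]
  rw [integral_eq_zero_of_ae (f := fun x => weakDiv K u x * φ x), add_zero]
  filter_upwards [weakDiv_ae_eq_zero hK.isOpen hdiv] with x hx
  simp [hx]

end

/-! ### The interpolants of curls -/

/-! ### Admissibility of the cutoffs of the triangle and the square in Green's formula -/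

theorem one_div_le_cornerWeight {a b r : ℝ} {x : Plane} (ha : a = x 0 ∨ a = 1 - x 0)
    (hb : b = x 1 ∨ b = 1 - x 1) (ha0 : 0 < a) (hb0 : 0 < b) (hr : 0 < r) (h : a * b ≤ r ^ 2) :
    1 / r ≤ cornerWeight x := by
  have := one_div_le_invSqrtEnds_mul ha0 hb0 hr h
  rcases ha with rfl | rfl <;> rcases hb with rfl | rfl <;>
    simpa only [cornerWeight, invSqrtEnds_one_sub] using this

theorem IsFluxWeight.congr {K : Set Plane} {l b : ℝ → ℝ} {φ ψ : Plane → ℝ}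
    (hφ : IsFluxWeight K l b φ) (h : ∀ x, ψ x = φ x) : IsFluxWeight K l b ψ := by
  rwa [funext h]

/-- One quotient `p / (p + q)` for each end point of the edge: `q = 0` on the edge, `p = 0` on the
other edge through that end point, and `p + q` vanishes there. -/
theorem isFluxWeight_triCutoff (i : Fin 3) :
    IsFluxWeight refTriangle (fun y => y) (fun x => x) (triCutoff i) := by
  have hl : ∀ x ∈ refTriangle, 1 / (x 0) ≤ cornerWeight x := fun x ⟨h1, h2, h3, h4⟩ =>
    one_div_le_cornerWeight (Or.inl rfl) (Or.inl rfl) h1 h3 h1 (by nlinarith)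
  have hr : ∀ x ∈ refTriangle, 1 / (1 - x 0 + x 1) ≤ cornerWeight x := fun x ⟨h1, h2, h3, h4⟩ =>
    one_div_le_cornerWeight (Or.inr rfl) (Or.inl rfl) (by linarith) h3 (by linarith) (by nlinarith)
  have ht : ∀ x ∈ refTriangle, 1 / (1 - x 1) ≤ cornerWeight x := fun x ⟨h1, h2, h3, h4⟩ =>
    one_div_le_cornerWeight (Or.inr rfl) (Or.inr rfl) (by linarith) (by linarith) (by linarith)
      (by nlinarith)
  have hK := isSliced_refTriangle
  fin_cases i
  · refine ((isFluxWeight_affineFun_div hK 1 (-1) 0 0 0 1 ?_ ?_ ?_ ?_ ?_).mul hK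
      (isFluxWeight_affineFun_div hK 0 1 (-1) 0 0 1 ?_ ?_ ?_ ?_ ?_)).congr ?_
    case refine_11 =>
      intro x
      rw [div_mul_div_comm]
      simp only [triCutoff, affineFun, Fin.zero_eta, Matrix.cons_val_zero]
      ring_nf
    all_goals simp only [affineFun, refTriangle, Set.mem_ofPred_eq, Set.mem_Icc, Set.mem_Ioo] at *
    all_goals ring_nf at *
    all_goals simp
    all_goals grind
  · refine ((isFluxWeight_affineFun_div hK 0 0 1 1 (-1) 0 ?_ ?_ ?_ ?_ ?_).mul hK
      (isFluxWeight_affineFun_div hK 0 1 (-1) 1 (-1) 0 ?_ ?_ ?_ ?_ ?_)).congr ?_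
    case refine_11 =>
      intro x
      rw [div_mul_div_comm]
      simp only [triCutoff, affineFun, Fin.mk_one, Matrix.cons_val_one, Matrix.cons_val_zero]
      ring_nf
    all_goals simp only [affineFun, refTriangle, Set.mem_ofPred_eq, Set.mem_Icc, Set.mem_Ioo] at *
    all_goals ring_nf at *
    all_goals simp
    all_goals grind
  · refine ((isFluxWeight_affineFun_div hK 1 (-1) 0 0 1 (-1) ?_ ?_ ?_ ?_ ?_).mul hK
      (isFluxWeight_affineFun_div hK 0 0 1 0 1 (-1) ?_ ?_ ?_ ?_ ?_)).congr ?_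
    case refine_11 =>
      intro x
      rw [div_mul_div_comm]
      simp only [triCutoff, affineFun, Fin.reduceFinMk, Matrix.cons_val]
      ring_nf
    all_goals simp only [affineFun, refTriangle, Set.mem_ofPred_eq, Set.mem_Icc, Set.mem_Ioo] at *
    all_goals ring_nf at *
    all_goals simp
    all_goals grind

theorem one_le_cornerWeight {x : Plane} (hx : x ∈ refSquare) : 1 ≤ cornerWeight x :=
  one_le_mul_of_one_le_of_one_le (one_le_invSqrtEnds ⟨hx.1, hx.2.1⟩)
    (one_le_invSqrtEnds ⟨hx.2.2.1, hx.2.2.2⟩)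

/-- Two quotients belong to the end points of the edge, as for the triangle. The third has the
denominator `1` and vanishes on the opposite edge. -/
theorem isFluxWeight_sqCutoff_zero :
    IsFluxWeight refSquare (fun _ => 0) (fun _ => 1) (sqCutoff 0) := by
  have h00 : ∀ x ∈ refSquare, 1 / (x 0 + x 1) ≤ cornerWeight x := fun x ⟨h1, h2, h3, h4⟩ =>
    one_div_le_cornerWeight (Or.inl rfl) (Or.inl rfl) h1 h3 (by linarith) (by nlinarith)
  have h10 : ∀ x ∈ refSquare, 1 / (1 - x 0 + x 1) ≤ cornerWeight x := fun x ⟨h1, h2, h3, h4⟩ =>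
    one_div_le_cornerWeight (Or.inr rfl) (Or.inl rfl) (by linarith) h3 (by linarith)
      (by nlinarith)
  have h := @one_le_cornerWeight
  have hK := isSliced_refSquare
  refine (((isFluxWeight_affineFun_div hK 0 1 0 0 0 1 ?_ ?_ ?_ ?_ ?_).mul hK
    (isFluxWeight_affineFun_div hK 1 (-1) 0 0 0 1 ?_ ?_ ?_ ?_ ?_)).mul hK
    (isFluxWeight_affineFun_div hK 1 0 (-1) 0 0 1 ?_ ?_ ?_ ?_ ?_)).congr ?_
  case refine_16 =>
    intro x
    rw [div_mul_div_comm, div_mul_div_comm]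
    simp only [sqCutoff, affineFun, Matrix.cons_val]
    ring_nf
  all_goals simp only [affineFun, refSquare, Set.mem_ofPred_eq, Set.mem_Icc, Set.mem_Ioo] at *
  all_goals ring_nf at *
  all_goals simp
  all_goals grind

theorem isFluxWeight_sqCutoff_one :
    IsFluxWeight refSquare (fun _ => 0) (fun _ => 1) (sqCutoff 1) := by
  have h10 : ∀ x ∈ refSquare, 1 / (1 - x 0 + x 1) ≤ cornerWeight x := fun x ⟨h1, h2, h3, h4⟩ =>
    one_div_le_cornerWeight (Or.inr rfl) (Or.inl rfl) (by linarith) h3 (by linarith)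
      (by nlinarith)
  have h11 : ∀ x ∈ refSquare, 1 / (2 - x 0 - x 1) ≤ cornerWeight x := fun x ⟨h1, h2, h3, h4⟩ =>
    one_div_le_cornerWeight (Or.inr rfl) (Or.inr rfl) (by linarith) (by linarith) (by linarith)
      (by nlinarith)
  have h := @one_le_cornerWeight
  have hK := isSliced_refSquare
  refine (((isFluxWeight_affineFun_div hK 0 0 1 1 (-1) 0 ?_ ?_ ?_ ?_ ?_).mul hK
    (isFluxWeight_affineFun_div hK 1 0 (-1) 1 (-1) 0 ?_ ?_ ?_ ?_ ?_)).mul hK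
    (isFluxWeight_affineFun_div hK 0 1 0 1 (-1) 0 ?_ ?_ ?_ ?_ ?_)).congr ?_
  case refine_16 =>
    intro x
    rw [div_mul_div_comm, div_mul_div_comm]
    simp only [sqCutoff, affineFun, Matrix.cons_val]
    ring_nf
  all_goals simp only [affineFun, refSquare, Set.mem_ofPred_eq, Set.mem_Icc, Set.mem_Ioo] at *
  all_goals ring_nf at *
  all_goals simp
  all_goals grind

theorem isFluxWeight_sqCutoff_two :
    IsFluxWeight refSquare (fun _ => 0) (fun _ => 1) (sqCutoff 2) := by
  have h01 : ∀ x ∈ refSquare, 1 / (1 + x 0 - x 1) ≤ cornerWeight x := fun x ⟨h1, h2, h3, h4⟩ =>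
    one_div_le_cornerWeight (Or.inl rfl) (Or.inr rfl) h1 (by linarith) (by linarith)
      (by nlinarith)
  have h11 : ∀ x ∈ refSquare, 1 / (2 - x 0 - x 1) ≤ cornerWeight x := fun x ⟨h1, h2, h3, h4⟩ =>
    one_div_le_cornerWeight (Or.inr rfl) (Or.inr rfl) (by linarith) (by linarith) (by linarith)
      (by nlinarith)
  have h := @one_le_cornerWeight
  have hK := isSliced_refSquare
  refine (((isFluxWeight_affineFun_div hK 0 1 0 1 0 (-1) ?_ ?_ ?_ ?_ ?_).mul hK
    (isFluxWeight_affineFun_div hK 1 (-1) 0 1 0 (-1) ?_ ?_ ?_ ?_ ?_)).mul hK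
    (isFluxWeight_affineFun_div hK 0 0 1 1 0 (-1) ?_ ?_ ?_ ?_ ?_)).congr ?_
  case refine_16 =>
    intro x
    rw [div_mul_div_comm, div_mul_div_comm]
    simp only [sqCutoff, affineFun, Matrix.cons_val]
    ring_nf
  all_goals simp only [affineFun, refSquare, Set.mem_ofPred_eq, Set.mem_Icc, Set.mem_Ioo] at *
  all_goals ring_nf at *
  all_goals simp
  all_goals grind

theorem isFluxWeight_sqCutoff_three :
    IsFluxWeight refSquare (fun _ => 0) (fun _ => 1) (sqCutoff 3) := by
  have h00 : ∀ x ∈ refSquare, 1 / (x 0 + x 1) ≤ cornerWeight x := fun x ⟨h1, h2, h3, h4⟩ =>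
    one_div_le_cornerWeight (Or.inl rfl) (Or.inl rfl) h1 h3 (by linarith) (by nlinarith)
  have h01 : ∀ x ∈ refSquare, 1 / (1 + x 0 - x 1) ≤ cornerWeight x := fun x ⟨h1, h2, h3, h4⟩ =>
    one_div_le_cornerWeight (Or.inl rfl) (Or.inr rfl) h1 (by linarith) (by linarith)
      (by nlinarith)
  have h := @one_le_cornerWeight
  have hK := isSliced_refSquare
  refine (((isFluxWeight_affineFun_div hK 0 0 1 0 1 0 ?_ ?_ ?_ ?_ ?_).mul hK
    (isFluxWeight_affineFun_div hK 1 0 (-1) 0 1 0 ?_ ?_ ?_ ?_ ?_)).mul hK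
    (isFluxWeight_affineFun_div hK 1 (-1) 0 0 1 0 ?_ ?_ ?_ ?_ ?_)).congr ?_
  case refine_16 =>
    intro x
    rw [div_mul_div_comm, div_mul_div_comm]
    simp only [sqCutoff, affineFun, Matrix.cons_val]
    ring_nf
  all_goals simp only [affineFun, refSquare, Set.mem_ofPred_eq, Set.mem_Icc, Set.mem_Ioo] at *
  all_goals ring_nf at *
  all_goals simp
  all_goals grind

theorem isFluxWeight_sqCutoff (i : Fin 4) :
    IsFluxWeight refSquare (fun _ => 0) (fun _ => 1) (sqCutoff i) := by
  fin_cases i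
  exacts [isFluxWeight_sqCutoff_zero, isFluxWeight_sqCutoff_one, isFluxWeight_sqCutoff_two,
    isFluxWeight_sqCutoff_three]

/-! ### Fluxes and interpolants of product curls on the two domains -/

section

variable {g g' h h' : ℝ → ℝ} {u : Plane → Plane}

theorem hasWeakDiv_refTriangle (hg : HasBoundedDeriv g g') (hh : HasBoundedDeriv h h')
    (hu : ∀ x ∈ refTriangle, u x = curlProd g g' h h' x) : HasWeakDiv refTriangle u 0 :=
  hasWeakDiv_curlProd isSliced_refTriangle hg hh hu (by simp [refTriangle]) (by simp [refTriangle])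

theorem hasWeakDiv_refSquare (hg : HasBoundedDeriv g g') (hh : HasBoundedDeriv h h')
    (hu : ∀ x ∈ refSquare, u x = curlProd g g' h h' x) : HasWeakDiv refSquare u 0 :=
  hasWeakDiv_curlProd isSliced_refSquare hg hh hu (by simp [refSquare]) (by simp [refSquare])

/-- Each bracket is the increment of `g(x₁) h(x₂)` along one edge, run through counterclockwise. -/
theorem greenFlux_refTriangle (hg : HasBoundedDeriv g g') (hh : HasBoundedDeriv h h')
    (hu : ∀ x ∈ refTriangle, u x = curlProd g g' h h' x) {φ : Plane → ℝ}
    (hφ : IsFluxWeight refTriangle (fun y => y) (fun x => x) φ) {cB cR cD : ℝ}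
    (hB : ∀ x ∈ Set.Ioo (0 : ℝ) 1, φ !₂[x, 0] = cB) (hR : ∀ y ∈ Set.Ioo (0 : ℝ) 1, φ !₂[1, y] = cR)
    (hD : ∀ y ∈ Set.Ioo (0 : ℝ) 1, φ !₂[y, y] = cD) :
    greenFlux refTriangle φ u = cB * (g 1 * h 0 - g 0 * h 0) + cR * (g 1 * h 1 - g 1 * h 0) +
      cD * (g 0 * h 0 - g 1 * h 1) := by
  rw [greenFlux_curlProd isSliced_refTriangle hφ hg hh hu (hasWeakDiv_refTriangle hg hh hu)]
  have cg := (integrableOn_Icc_iff_integrableOn_Ioo (by simp) (by simp)).2 hg.integrableOn_deriv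
  have ch := (integrableOn_Icc_iff_integrableOn_Ioo (by simp) (by simp)).2 hh.integrableOn_deriv
  have i1 : IntegrableOn (fun y => h' y * g y) (Set.Ioo 0 1) :=
    (ch.mul_continuousOn hg.continuousOn isCompact_Icc).mono_set Set.Ioo_subset_Icc_self
  have i2 : IntegrableOn (fun y => g' y * h y) (Set.Ioo 0 1) :=
    (cg.mul_continuousOn hh.continuousOn isCompact_Icc).mono_set Set.Ioo_subset_Icc_self
  have e1 : ∫ y in Set.Ioo (0 : ℝ) 1, h' y * (φ !₂[1, y] * g 1 - φ !₂[y, y] * g y) =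
      (h 1 - h 0) * (cR * g 1) - cD * ∫ y in Set.Ioo (0 : ℝ) 1, h' y * g y := by
    rw [← hh.integral_deriv, ← integral_mul_const, ← integral_const_mul,
      ← integral_sub (hh.integrableOn_deriv.mul_const _) (i1.const_mul _)]
    refine setIntegral_congr_fun measurableSet_Ioo fun y hy => ?_
    simp only [hR y hy, hD y hy]
    ring
  have e2 : ∫ x in Set.Ioo (0 : ℝ) 1, g' x * (φ !₂[x, x] * h x - φ !₂[x, 0] * h 0) =
      cD * (∫ y in Set.Ioo (0 : ℝ) 1, g' y * h y) - (g 1 - g 0) * (cB * h 0) := by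
    rw [← hg.integral_deriv, ← integral_mul_const, ← integral_const_mul,
      ← integral_sub (i2.const_mul _) (hg.integrableOn_deriv.mul_const _)]
    refine setIntegral_congr_fun measurableSet_Ioo fun y hy => ?_
    simp only [hB y hy, hD y hy]
    ring
  -- The two integrals along the diagonal, of `h' g` and of `g' h`, depend on more than the vertex
  -- values; their sum does not.
  have e3 := hg.integral_deriv_mul hh
  rw [show (fun x => g' x * h x + g x * h' x) = fun x => g' x * h x + h' x * g x by
    funext x; ring, integral_add i2 i1] at e3
  rw [e1, e2]
  linear_combination (-cD) * e3

theorem greenFlux_refSquare (hg : HasBoundedDeriv g g') (hh : HasBoundedDeriv h h')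
    (hu : ∀ x ∈ refSquare, u x = curlProd g g' h h' x) {φ : Plane → ℝ}
    (hφ : IsFluxWeight refSquare (fun _ => 0) (fun _ => 1) φ) {cB cR cT cL : ℝ}
    (hB : ∀ x ∈ Set.Ioo (0 : ℝ) 1, φ !₂[x, 0] = cB) (hR : ∀ y ∈ Set.Ioo (0 : ℝ) 1, φ !₂[1, y] = cR)
    (hT : ∀ x ∈ Set.Ioo (0 : ℝ) 1, φ !₂[x, 1] = cT)
    (hL : ∀ y ∈ Set.Ioo (0 : ℝ) 1, φ !₂[0, y] = cL) :
    greenFlux refSquare φ u = cB * (g 1 * h 0 - g 0 * h 0) + cR * (g 1 * h 1 - g 1 * h 0) +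
      cT * (g 0 * h 1 - g 1 * h 1) + cL * (g 0 * h 0 - g 0 * h 1) := by
  rw [greenFlux_curlProd isSliced_refSquare hφ hg hh hu (hasWeakDiv_refSquare hg hh hu)]
  have e1 : ∫ y in Set.Ioo (0 : ℝ) 1, h' y * (φ !₂[1, y] * g 1 - φ !₂[0, y] * g 0) =
      (h 1 - h 0) * (cR * g 1 - cL * g 0) := by
    rw [← hh.integral_deriv, ← integral_mul_const]
    refine setIntegral_congr_fun measurableSet_Ioo fun y hy => ?_
    simp only [hR y hy, hL y hy]
  have e2 : ∫ x in Set.Ioo (0 : ℝ) 1, g' x * (φ !₂[x, 1] * h 1 - φ !₂[x, 0] * h 0) =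
      (g 1 - g 0) * (cT * h 1 - cB * h 0) := by
    rw [← hg.integral_deriv, ← integral_mul_const]
    refine setIntegral_congr_fun measurableSet_Ioo fun y hy => ?_
    simp only [hB y hy, hT y hy]
  rw [e1, e2]
  ring

/-- The interpolant of the curl of `g(x₁) h(x₂)` on the triangle. -/
theorem triInterp_curlProd (hg : HasBoundedDeriv g g') (hh : HasBoundedDeriv h h')
    (hu : ∀ x ∈ refTriangle, u x = curlProd g g' h h' x) :
    triInterp u = fun _ => !₂[g 1 * h 1 - g 1 * h 0, g 0 * h 0 - g 1 * h 0] := by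
  have hne : ∀ y ∈ Set.Ioo (0 : ℝ) 1, y ≠ 0 ∧ 1 - y ≠ 0 := fun y hy =>
    ⟨hy.1.ne', (sub_pos.2 hy.2).ne'⟩
  have h0 : greenFlux refTriangle (triCutoff 0) u = g 1 * h 0 - g 0 * h 0 := by
    rw [greenFlux_refTriangle hg hh hu (isFluxWeight_triCutoff 0) (cB := 1) (cR := 0) (cD := 0)]
    · ring
    all_goals
      intro y hy
      obtain ⟨h1, h2⟩ := hne y hy
      simp [triCutoff, h1, h2]
  have h1 : greenFlux refTriangle (triCutoff 1) u = g 1 * h 1 - g 1 * h 0 := by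
    rw [greenFlux_refTriangle hg hh hu (isFluxWeight_triCutoff 1) (cB := 0) (cR := 1) (cD := 0)]
    · ring
    all_goals
      intro y hy
      obtain ⟨h1, h2⟩ := hne y hy
      simp [triCutoff, h1, h2]
  have h2 : greenFlux refTriangle (triCutoff 2) u = g 0 * h 0 - g 1 * h 1 := by
    rw [greenFlux_refTriangle hg hh hu (isFluxWeight_triCutoff 2) (cB := 0) (cR := 0) (cD := 1)]
    · ring
    all_goals
      intro y hy
      obtain ⟨h1, h2⟩ := hne y hy
      simp [triCutoff, h1, h2]
  -- The three fluxes add up to zero, so the interpolant has no linear part.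
  refine (existsUnique_triRT fun i => greenFlux refTriangle (triCutoff i) u).unique
    (existsUnique_triRT fun i => greenFlux refTriangle (triCutoff i) u).choose_spec.1
    ⟨⟨g 1 * h 1 - g 1 * h 0, g 0 * h 0 - g 1 * h 0, 0, by simp⟩, ?_⟩
  simp only [Fin.forall_fin_succ, Fin.succ_zero_eq_one, Fin.succ_one_eq_two, h0, h1, h2,
    IsEmpty.forall_iff, and_true]
  simp [edgeFlux, triVertex]

/-- The interpolant of the curl of `g(x₁) h(x₂)` on the square. -/
theorem sqInterp_curlProd (hg : HasBoundedDeriv g g') (hh : HasBoundedDeriv h h')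
    (hu : ∀ x ∈ refSquare, u x = curlProd g g' h h' x) :
    sqInterp u = fun x =>
      !₂[g 0 * h 1 - g 0 * h 0 + (g 1 - g 0) * (h 1 - h 0) * x 0,
        g 0 * h 0 - g 1 * h 0 - (g 1 - g 0) * (h 1 - h 0) * x 1] := by
  have hne : ∀ y ∈ Set.Ioo (0 : ℝ) 1, y ≠ 0 ∧ 1 - y ≠ 0 := fun y hy =>
    ⟨hy.1.ne', (sub_pos.2 hy.2).ne'⟩
  have h0 : greenFlux refSquare (sqCutoff 0) u = g 1 * h 0 - g 0 * h 0 := by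
    rw [greenFlux_refSquare hg hh hu (isFluxWeight_sqCutoff 0) (cB := 1) (cR := 0) (cT := 0)
      (cL := 0)]
    · ring
    all_goals
      intro y hy
      obtain ⟨h1, h2⟩ := hne y hy
      simp [sqCutoff, h1, h2]
  have h1 : greenFlux refSquare (sqCutoff 1) u = g 1 * h 1 - g 1 * h 0 := by
    rw [greenFlux_refSquare hg hh hu (isFluxWeight_sqCutoff 1) (cB := 0) (cR := 1) (cT := 0)
      (cL := 0)]
    · ring
    all_goals
      intro y hy
      obtain ⟨h1, h2⟩ := hne y hy
      simp [sqCutoff, h1, h2]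
  have h2 : greenFlux refSquare (sqCutoff 2) u = g 0 * h 1 - g 1 * h 1 := by
    rw [greenFlux_refSquare hg hh hu (isFluxWeight_sqCutoff 2) (cB := 0) (cR := 0) (cT := 1)
      (cL := 0)]
    · ring
    all_goals
      intro y hy
      obtain ⟨h1, h2⟩ := hne y hy
      simp [sqCutoff, h1, h2]
  have h3 : greenFlux refSquare (sqCutoff 3) u = g 0 * h 0 - g 0 * h 1 := by
    rw [greenFlux_refSquare hg hh hu (isFluxWeight_sqCutoff 3) (cB := 0) (cR := 0) (cT := 0)
      (cL := 1)]
    · ring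
    all_goals
      intro y hy
      obtain ⟨h1, h2⟩ := hne y hy
      simp [sqCutoff, h1, h2]
  -- The four fluxes add up to zero, so the two linear coefficients are opposite.
  refine (existsUnique_sqRT fun i => greenFlux refSquare (sqCutoff i) u).unique
    (existsUnique_sqRT fun i => greenFlux refSquare (sqCutoff i) u).choose_spec.1
    ⟨⟨g 0 * h 1 - g 0 * h 0, g 0 * h 0 - g 1 * h 0, (g 1 - g 0) * (h 1 - h 0),
      -((g 1 - g 0) * (h 1 - h 0)), ?_⟩, ?_⟩
  · funext x
    ring_nf
  · rintro i
    fin_cases i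
    · simp [edgeFlux, sqVertex, h0]
    · simp [edgeFlux, sqVertex, h1]; ring
    · simp [edgeFlux, sqVertex, h2]; ring
    · simp [edgeFlux, sqVertex, h3]

end

/-! ### The iterated logarithm -/

/-- The function `log (1 - log y) = log log (e / y)`. -/
def logLog (y : ℝ) : ℝ := Real.log (1 - Real.log y)

theorem logLog_one : logLog 1 = 0 := by simp [logLog]

/-- The range extends to `2` because distances to the axis up to `√2` occur in the prism; `log 2 <
1` keeps `logLog` regular there. -/
theorem one_sub_log_pos {t : ℝ} (ht0 : 0 < t) (ht : t ≤ 2) : 0 < 1 - Real.log t := by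
  have h1 := Real.log_le_log ht0 ht
  have h2 := Real.log_two_lt_d9
  linarith

theorem hasDerivAt_logLog {t : ℝ} (ht0 : 0 < t) (ht : t ≤ 2) :
    HasDerivAt logLog (-(1 / (t * (1 - Real.log t)))) t := by
  have h := one_sub_log_pos ht0 ht
  refine HasDerivAt.congr_deriv (((Real.hasDerivAt_log ht0.ne').const_sub 1).log h.ne') ?_
  field_simp

theorem logLog_le_logLog {s t : ℝ} (hs : 0 < s) (hst : s ≤ t) (ht : t ≤ 2) :
    logLog t ≤ logLog s := by
  have := Real.log_le_log hs hst
  exact Real.log_le_log (one_sub_log_pos (hs.trans_le hst) ht) (by linarith)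

theorem logLog_nonneg {t : ℝ} (ht0 : 0 < t) (ht : t ≤ 1) : 0 ≤ logLog t := by
  rw [← logLog_one]
  exact logLog_le_logLog ht0 ht (by norm_num)

/-- The difference is the logarithm of `(1 - log s) / (1 - log t) = 1 + log (t / s) / (1 - log t)`,
and `log (1 + x) ≤ x`. -/
theorem logLog_sub_le {s t : ℝ} (hs : 0 < s) (hst : s ≤ t) (ht : t ≤ 2) :
    logLog s - logLog t ≤ Real.log (t / s) / (1 - Real.log t) := by
  have ht0 := hs.trans_le hst
  have h1 := one_sub_log_pos hs (hst.trans ht)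
  have h2 := one_sub_log_pos ht0 ht
  rw [logLog, logLog, ← Real.log_div h1.ne' h2.ne', Real.log_div ht0.ne' hs.ne']
  refine (Real.log_le_sub_one_of_pos (by positivity)).trans (le_of_eq ?_)
  field_simp
  ring

/-- The logarithm grows more slowly than the fourth root. -/
theorem log_sq_le {r : ℝ} (hr : 1 ≤ r) : Real.log r ^ 2 ≤ 16 * (1 - 1 / r) ^ 2 * √r := by
  set z := √(√r)
  have hr0 : 0 < r := by linarith
  have hz2 : z ^ 2 = √r := Real.sq_sqrt (Real.sqrt_nonneg _)
  have hz4 : r = z ^ 4 := by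
    rw [show z ^ 4 = (z ^ 2) ^ 2 by ring, hz2, Real.sq_sqrt hr0.le]
  have hz1 : 1 ≤ z := Real.one_le_sqrt.2 (Real.one_le_sqrt.2 hr)
  have hz0 : 0 < z := by linarith
  -- `log r = 4 log z ≤ 4 (z - 1)`, and `z - 1 ≤ z - z⁻³ = (1 - 1 / z⁴) z`. The factor `1 - 1 / r`,
  -- which vanishes at `r = 1`, will absorb the denominator of the difference quotient.
  have h1 : Real.log r ≤ 4 * (1 - 1 / r) * z := by
    rw [hz4, Real.log_pow]
    have h2 := Real.log_le_sub_one_of_pos hz0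
    have h3 : z - 1 ≤ (1 - 1 / z ^ 4) * z := by
      have h4 : (1 / z ^ 4) * z = 1 / z ^ 3 := by field_simp
      have h5 : 1 / z ^ 3 ≤ 1 := by
        rw [div_le_one (by positivity)]
        exact one_le_pow₀ hz1
      nlinarith
    push_cast
    linarith
  have h0 := Real.log_nonneg hr
  calc Real.log r ^ 2 ≤ (4 * (1 - 1 / r) * z) ^ 2 := by gcongr
    _ = 16 * (1 - 1 / r) ^ 2 * √r := by rw [← hz2]; ring

/-- With `r = t / s` in `log_sq_le`, the factor `(1 - s / t)²` cancels `(s - t)²`. What remains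
behaves like `s^(-1/2) t^(-3/2) (1 - log t)⁻²`; integration over `s < t` leaves a multiple of `1 /
(t (1 - log t)²)`, which is integrable at `0`. -/
theorem logLog_sub_sq_le {s t : ℝ} (hs : 0 < s) (hst : s < t) (ht : t ≤ 2) :
    (logLog s - logLog t) ^ 2 / (s - t) ^ 2 ≤
      16 * (1 / √s * (1 / (t * √t * (1 - Real.log t) ^ 2))) := by
  have ht0 := hs.trans hst
  have h2 := one_sub_log_pos ht0 ht
  have h0 : 0 ≤ logLog s - logLog t := sub_nonneg.2 (logLog_le_logLog hs hst.le ht)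
  have h1 := log_sq_le ((one_le_div hs).2 hst.le)
  have h3 : 0 < t - s := by linarith
  calc (logLog s - logLog t) ^ 2 / (s - t) ^ 2
      ≤ (Real.log (t / s) / (1 - Real.log t)) ^ 2 / (s - t) ^ 2 := by
        gcongr
        exact logLog_sub_le hs hst.le ht
    _ ≤ (16 * (1 - 1 / (t / s)) ^ 2 * √(t / s)) / (1 - Real.log t) ^ 2 / (s - t) ^ 2 := by
        rw [div_pow]
        gcongr
    _ = 16 * (1 / √s * (1 / (t * √t * (1 - Real.log t) ^ 2))) := by
        rw [Real.sqrt_div ht0.le, show (s - t) ^ 2 = (t - s) ^ 2 by ring, one_div_div,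
          show 1 - s / t = (t - s) / t by field_simp]
        have h4 : √t ≠ 0 := (Real.sqrt_pos.2 ht0).ne'
        have h5 : √s ≠ 0 := (Real.sqrt_pos.2 hs).ne'
        have h6 : √t * √t = t := Real.mul_self_sqrt ht0.le
        field_simp
        linear_combination h6

theorem logLog_sq_le {s : ℝ} (hs : 0 < s) (hs1 : s < 1) : logLog s ^ 2 ≤ 16 * (1 / √s) := by
  have h := logLog_sub_sq_le hs hs1 (by norm_num)
  have h0 : (s - 1) ^ 2 ≤ 1 := by nlinarith
  have h1 : 0 < (s - 1) ^ 2 := by nlinarith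
  simp only [logLog_one, sub_zero, Real.log_one, Real.sqrt_one, mul_one, one_pow, div_one] at h
  rw [div_le_iff₀ h1] at h
  refine h.trans ?_
  have : 0 ≤ 16 * (1 / √s) := by positivity
  nlinarith

/-! ### Integrals -/

theorem lintegral_deriv_of_nonneg {g g' : ℝ → ℝ} {a b : ℝ} (hab : a ≤ b)
    (hc : ContinuousOn g (Set.Icc a b)) (hd : ∀ x ∈ Set.Ioo a b, HasDerivAt g (g' x) x)
    (hp : ∀ x ∈ Set.Ioo a b, 0 ≤ g' x) :
    ∫⁻ x in Set.Ioo a b, ENNReal.ofReal (g' x) = ENNReal.ofReal (g b - g a) := by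
  have hi : IntegrableOn g' (Set.Ioc a b) := intervalIntegral.integrableOn_deriv_of_nonneg hc hd hp
  rw [← intervalIntegral.integral_eq_sub_of_hasDerivAt_of_le hab hc hd
    ((intervalIntegrable_iff_integrableOn_Ioc_of_le hab).2 hi),
    intervalIntegral.integral_of_le hab, integral_Ioc_eq_integral_Ioo,
    ofReal_integral_eq_lintegral_ofReal (hi.mono_set Set.Ioo_subset_Ioc_self)]
  filter_upwards [ae_restrict_mem measurableSet_Ioo] with x hx using hp x hx

theorem lintegral_one_div_sqrt {t : ℝ} (ht : 0 ≤ t) :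
    ∫⁻ s in Set.Ioo 0 t, ENNReal.ofReal (1 / √s) = ENNReal.ofReal (2 * √t) := by
  rw [lintegral_deriv_of_nonneg (g := fun s => 2 * √s) ht (by fun_prop) (fun s hs => ?_)
    fun s hs => by positivity]
  · simp
  · refine ((Real.hasDerivAt_sqrt hs.1.ne').const_mul 2).congr_deriv ?_
    rw [mul_one_div, div_mul_cancel_left₀ two_ne_zero, one_div]

theorem lintegral_one_div_mul_log_sq :
    ∫⁻ t in Set.Ioo (0 : ℝ) 1, ENNReal.ofReal (1 / (t * (1 - Real.log t) ^ 2)) = 1 := by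
  have hpos : ∀ t ∈ Set.Ioc (0 : ℝ) 1, 0 < 1 - Real.log t := fun t ht =>
    one_sub_log_pos ht.1 (by linarith [ht.2])
  -- The antiderivative `1 / (1 - log t)` tends to `0` at `0`, but with `Real.log 0 = 0` it would
  -- have the value `1` there; the case distinction restores continuity.
  rw [lintegral_deriv_of_nonneg (g := fun t => if t ≤ 0 then 0 else 1 / (1 - Real.log t))
    zero_le_one]
  · simp
  · intro t ht
    rcases ht.1.eq_or_lt with rfl | h0
    · refine ContinuousAt.continuousWithinAt ?_
      rw [continuousAt_iff_continuous_left'_right']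
      constructor
      · refine tendsto_const_nhds.congr' ?_
        filter_upwards [self_mem_nhdsWithin] with t ht
        rw [if_pos (le_of_lt (Set.mem_Iio.1 ht)), if_pos le_rfl]
      · have h1 : Tendsto (fun t => 1 / (1 - Real.log t)) (𝓝[>] 0) (𝓝 0) := by
          simp only [one_div]
          refine Tendsto.inv_tendsto_atTop ?_
          simp only [sub_eq_add_neg]
          exact tendsto_atTop_add_const_left _ _
            (tendsto_neg_atBot_atTop.comp Real.tendsto_log_nhdsGT_zero)
        rw [ContinuousWithinAt, if_pos le_rfl]
        refine h1.congr' ?_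
        filter_upwards [self_mem_nhdsWithin] with t ht
        rw [if_neg (not_le.2 ht)]
    · refine ContinuousAt.continuousWithinAt ?_
      refine ContinuousAt.congr (f := fun t => 1 / (1 - Real.log t)) ?_ ?_
      · exact continuousAt_const.div (continuousAt_const.sub (Real.continuousAt_log h0.ne'))
          (hpos t ⟨h0, ht.2⟩).ne'
      · filter_upwards [lt_mem_nhds h0] with s hs
        rw [if_neg (not_le.2 hs)]
  · intro t ht
    have h := hpos t ⟨ht.1, ht.2.le⟩
    refine HasDerivAt.congr_of_eventuallyEq (f := fun t => 1 / (1 - Real.log t)) ?_ ?_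
    · simp only [one_div]
      refine (((Real.hasDerivAt_log ht.1.ne').const_sub 1).fun_inv h.ne').congr_deriv ?_
      rw [neg_neg, mul_inv, div_eq_mul_inv]
    · filter_upwards [lt_mem_nhds ht.1] with s hs
      rw [if_neg (not_le.2 hs)]
  · intro t ht
    have := hpos t ⟨ht.1, ht.2.le⟩
    have := ht.1
    positivity

theorem lintegral_inv_sq_add_sq (c : ℝ) {τ : ℝ} (hτ : τ ≠ 0) :
    ∫⁻ r, ENNReal.ofReal (1 / (τ ^ 2 + (c - r) ^ 2)) = ENNReal.ofReal (Real.pi / |τ|) := by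
  have hτ' : 0 < |τ| := abs_pos.2 hτ
  have h1 : ∀ r, 1 / (τ ^ 2 + (c - r) ^ 2) = (1 / τ ^ 2) * (1 + ((c - r) / τ) ^ 2)⁻¹ := fun r => by
    have : 0 < τ ^ 2 + (c - r) ^ 2 := by positivity
    field_simp
  have hi : Integrable fun r => (1 + ((c - r) / τ) ^ 2)⁻¹ :=
    (integrable_inv_one_add_sq.comp_div hτ).comp_sub_left c
  rw [← ofReal_integral_eq_lintegral_ofReal]
  · congr 1
    simp only [h1]
    rw [integral_const_mul, integral_sub_left_eq_self (fun r => (1 + (r / τ) ^ 2)⁻¹) volume c,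
      Measure.integral_comp_div (fun r => (1 + r ^ 2)⁻¹), integral_univ_inv_one_add_sq, smul_eq_mul,
      ← sq_abs τ]
    field_simp
  · simp only [h1]
    exact hi.const_mul _
  · exact Eventually.of_forall fun r => by positivity

/-! ### One-dimensional norms -/

/-- The square of the norm of `L²(0, 1)`. -/
def lTwoSqInterval (F : ℝ → ℝ) : ℝ≥0∞ := ∫⁻ s in Set.Ioo (0 : ℝ) 1, ENNReal.ofReal (F s ^ 2)

/-- The square of the seminorm of `H^(1/2)(0, 1)`. -/
def hHalfSqInterval (F : ℝ → ℝ) : ℝ≥0∞ :=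
  ∫⁻ s in Set.Ioo (0 : ℝ) 1, ∫⁻ t in Set.Ioo (0 : ℝ) 1,
    ENNReal.ofReal ((F s - F t) ^ 2 / (s - t) ^ 2)

theorem lintegral_Ioo_one_sub (f : ℝ → ℝ≥0∞) :
    ∫⁻ s in Set.Ioo (0 : ℝ) 1, f (1 - s) = ∫⁻ s in Set.Ioo (0 : ℝ) 1, f s := by
  rw [← lintegral_indicator measurableSet_Ioo, ← lintegral_indicator measurableSet_Ioo,
    ← lintegral_sub_left_eq_self _ (1 : ℝ)]
  congr 1
  funext s
  simp only [Set.indicator, Set.mem_Ioo]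
  rw [sub_sub_cancel]
  congr 1
  simp only [eq_iff_iff]
  constructor <;> rintro ⟨h1, h2⟩ <;> constructor <;> linarith

theorem lTwoSqInterval_one_sub (F : ℝ → ℝ) :
    lTwoSqInterval (fun s => F (1 - s)) = lTwoSqInterval F :=
  lintegral_Ioo_one_sub fun s => ENNReal.ofReal (F s ^ 2)

theorem hHalfSqInterval_one_sub (F : ℝ → ℝ) :
    hHalfSqInterval (fun s => F (1 - s)) = hHalfSqInterval F := by
  unfold hHalfSqInterval
  rw [← lintegral_Ioo_one_sub]
  refine lintegral_congr fun s => ?_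
  rw [← lintegral_Ioo_one_sub]
  refine lintegral_congr fun t => ?_
  simp only [sub_sub_cancel]
  rw [show (1 - s - (1 - t)) ^ 2 = (s - t) ^ 2 by ring]

/-- `F` is, up to the factor `c`, at most as large and as variable as `logLog` in `(0, 1)`. -/
structure IsLogLogDominated (c : ℝ) (F : ℝ → ℝ) : Prop where
  abs_le : ∀ s ∈ Set.Ioo (0 : ℝ) 1, |F s| ≤ c * logLog s
  abs_sub_le : ∀ s ∈ Set.Ioo (0 : ℝ) 1, ∀ t ∈ Set.Ioo (0 : ℝ) 1,
    |F s - F t| ≤ c * |logLog s - logLog t|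

theorem IsLogLogDominated.lTwoSqInterval_le {c : ℝ} {F : ℝ → ℝ} (h : IsLogLogDominated c F) :
    lTwoSqInterval F ≤ ENNReal.ofReal (c ^ 2) * 32 := by
  have h1 : ∀ s ∈ Set.Ioo (0 : ℝ) 1,
      ENNReal.ofReal (F s ^ 2) ≤ ENNReal.ofReal (c ^ 2 * 16) * ENNReal.ofReal (1 / √s) :=
    fun s hs => by
      rw [← ENNReal.ofReal_mul (by positivity)]
      refine ENNReal.ofReal_le_ofReal ?_
      calc F s ^ 2 = |F s| ^ 2 := (sq_abs _).symm
        _ ≤ (c * logLog s) ^ 2 := by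
          have := h.abs_le s hs
          gcongr
        _ ≤ c ^ 2 * 16 * (1 / √s) := by
          rw [mul_pow, mul_assoc]
          have := logLog_sq_le hs.1 hs.2
          gcongr
  refine (setLIntegral_mono' measurableSet_Ioo h1).trans (le_of_eq ?_)
  rw [lintegral_const_mul _ (by fun_prop), lintegral_one_div_sqrt zero_le_one,
    ENNReal.ofReal_mul (by positivity), mul_assoc, ← ENNReal.ofReal_mul (by norm_num)]
  norm_num

theorem IsLogLogDominated.hHalfSqInterval_le {c : ℝ} {F : ℝ → ℝ} (h : IsLogLogDominated c F) :
    hHalfSqInterval F ≤ ENNReal.ofReal (c ^ 2) * 64 := by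
  set I : Set ℝ := Set.Ioo 0 1
  let H : ℝ × ℝ → ℝ≥0∞ := fun p => {p : ℝ × ℝ | p.1 < p.2}.indicator
    (fun p => ENNReal.ofReal (1 / √p.1) *
      ENNReal.ofReal (1 / (p.2 * √p.2 * (1 - Real.log p.2) ^ 2))) p
  have hH : Measurable H := Measurable.indicator (by fun_prop)
    (measurableSet_lt measurable_fst measurable_snd)
  -- The integral over `s < t` is `2 √t`, which turns the power `t^(-3/2)` into `t⁻¹`; the integral
  -- over `t` is then `1`.
  have hHint : ∫⁻ t in I, ∫⁻ s in I, H (s, t) = 2 := by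
    have e : ∀ t ∈ I, ∫⁻ s in I, H (s, t) =
        2 * ENNReal.ofReal (1 / (t * (1 - Real.log t) ^ 2)) := fun t ht => by
      have e1 : ∫⁻ s in I, H (s, t) = ∫⁻ s in Set.Ioo 0 t, ENNReal.ofReal (1 / √s) *
          ENNReal.ofReal (1 / (t * √t * (1 - Real.log t) ^ 2)) := by
        rw [← lintegral_indicator measurableSet_Ioo, ← lintegral_indicator measurableSet_Ioo]
        congr 1
        funext s
        simp only [Set.indicator, Set.mem_Ioo, H, Set.mem_ofPred_eq]
        have := ht.2
        split_ifs <;> grind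
      rw [e1, lintegral_mul_const _ (by fun_prop), lintegral_one_div_sqrt ht.1.le,
        ← ENNReal.ofReal_mul (by positivity), show (2 : ℝ≥0∞) = ENNReal.ofReal 2 by simp,
        ← ENNReal.ofReal_mul (by positivity)]
      congr 1
      have h4 : √t ≠ 0 := (Real.sqrt_pos.2 ht.1).ne'
      field_simp
    rw [setLIntegral_congr_fun measurableSet_Ioo e, lintegral_const_mul _ (by fun_prop),
      lintegral_one_div_mul_log_sq, mul_one]
  have hHint' : ∫⁻ s in I, ∫⁻ t in I, H (s, t) = 2 := by
    rw [← hHint, lintegral_lintegral_swap hH.aemeasurable]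
  have key : ∀ s ∈ I, ∀ t ∈ I, ENNReal.ofReal ((F s - F t) ^ 2 / (s - t) ^ 2) ≤
      ENNReal.ofReal (c ^ 2 * 16) * (H (s, t) + H (t, s)) := by
    have key' : ∀ s ∈ I, ∀ t ∈ I, s < t → ENNReal.ofReal ((F s - F t) ^ 2 / (s - t) ^ 2) ≤
      ENNReal.ofReal (c ^ 2 * 16) * H (s, t) := fun s hs t ht hst => by
      simp only [H]
      rw [Set.indicator_of_mem (by exact hst), ← ENNReal.ofReal_mul (by positivity),
        ← ENNReal.ofReal_mul (by positivity)]
      refine ENNReal.ofReal_le_ofReal ?_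
      calc (F s - F t) ^ 2 / (s - t) ^ 2
          ≤ (c * |logLog s - logLog t|) ^ 2 / (s - t) ^ 2 := by
            rw [← sq_abs (F s - F t)]
            have := h.abs_sub_le s hs t ht
            gcongr
        _ = c ^ 2 * ((logLog s - logLog t) ^ 2 / (s - t) ^ 2) := by
            rw [mul_pow, sq_abs, mul_div_assoc]
        _ ≤ c ^ 2 * (16 * (1 / √s * (1 / (t * √t * (1 - Real.log t) ^ 2)))) := by
            have := logLog_sub_sq_le hs.1 hst (by linarith [ht.2])
            gcongr
        _ = _ := by ring
    intro s hs t ht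
    rw [mul_add]
    rcases lt_trichotomy s t with hst | rfl | hst
    · exact (key' s hs t ht hst).trans (le_add_of_nonneg_right zero_le)
    · simp
    · rw [show (F s - F t) ^ 2 / (s - t) ^ 2 = (F t - F s) ^ 2 / (t - s) ^ 2 by
        rw [sub_sq_comm, sub_sq_comm s]]
      exact (key' t ht s hs hst).trans (le_add_of_nonneg_left zero_le)
  calc hHalfSqInterval F
      ≤ ∫⁻ s in I, ∫⁻ t in I, ENNReal.ofReal (c ^ 2 * 16) * (H (s, t) + H (t, s)) :=
        setLIntegral_mono' measurableSet_Ioo fun s hs =>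
          setLIntegral_mono' measurableSet_Ioo fun t ht => key s hs t ht
    _ = ENNReal.ofReal (c ^ 2 * 16) * (2 + 2) := by
        have m1 : ∀ s, Measurable fun t => H (s, t) := fun s => hH.comp (by fun_prop)
        have m2 : ∀ s, Measurable fun t => H (t, s) := fun s => hH.comp (by fun_prop)
        have e : ∀ s, ∫⁻ t in I, ENNReal.ofReal (c ^ 2 * 16) * (H (s, t) + H (t, s)) =
            ENNReal.ofReal (c ^ 2 * 16) * ((∫⁻ t in I, H (s, t)) + ∫⁻ t in I, H (t, s)) := fun s => by
          rw [← lintegral_add_left (m1 s), lintegral_const_mul]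
          exact (m1 s).add (m2 s)
        simp only [e]
        rw [lintegral_const_mul, lintegral_add_left, hHint, hHint']
        · exact hH.lintegral_prod_right'
        · exact hH.lintegral_prod_right'.add hH.lintegral_prod_left'
    _ = _ := by
        rw [ENNReal.ofReal_mul (by positivity), mul_assoc]
        norm_num

/-! ### Fractional norms in the plane -/

/-- The point with `i`-th coordinate `t` and other coordinate `r`. -/
def planeMk (i : Fin 2) (t r : ℝ) : Plane := if i = 0 then !₂[t, r] else !₂[r, t]

theorem planeMk_apply_self (i : Fin 2) (t r : ℝ) : planeMk i t r i = t := by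
  fin_cases i <;> simp [planeMk]

theorem planeMk_apply_rev (i : Fin 2) (t r : ℝ) : planeMk i t r i.rev = r := by
  fin_cases i <;> simp [planeMk]

theorem dist_sq_plane (i : Fin 2) (x y : Plane) :
    dist x y ^ 2 = (x i - y i) ^ 2 + (x i.rev - y i.rev) ^ 2 := by
  rw [EuclideanSpace.dist_eq, Real.sq_sqrt (by positivity), Fin.sum_univ_two]
  fin_cases i <;> simp [Real.dist_eq, add_comm]

theorem lintegral_refSquare (i : Fin 2) {f : Plane → ℝ≥0∞} (hf : Measurable f) :
    ∫⁻ x in refSquare, f x =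
      ∫⁻ t in Set.Ioo (0 : ℝ) 1, ∫⁻ r in Set.Ioo (0 : ℝ) 1, f (planeMk i t r) := by
  have hm : Measurable fun p : ℝ × ℝ => f !₂[p.1, p.2] :=
    hf.comp (continuous_mk_plane continuous_fst continuous_snd).measurable
  have h0 : ∫⁻ x in refSquare, f x =
      ∫⁻ t in Set.Ioo (0 : ℝ) 1, ∫⁻ r in Set.Ioo (0 : ℝ) 1, f !₂[t, r] := by
    rw [← lintegral_indicator isSliced_refSquare.isOpen.measurableSet,
      lintegral_plane _ (hf.indicator isSliced_refSquare.isOpen.measurableSet),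
      ← lintegral_indicator measurableSet_Ioo]
    congr 1
    funext t
    by_cases ht : t ∈ Set.Ioo (0 : ℝ) 1
    · rw [Set.indicator_of_mem ht, ← lintegral_indicator measurableSet_Ioo]
      congr 1
      funext r
      by_cases hr : r ∈ Set.Ioo (0 : ℝ) 1
      · rw [Set.indicator_of_mem hr, Set.indicator_of_mem]
        exact ⟨ht.1, ht.2, hr.1, hr.2⟩
      · rw [Set.indicator_of_notMem hr, Set.indicator_of_notMem]
        exact fun h => hr ⟨h.2.2.1, h.2.2.2⟩
    · rw [Set.indicator_of_notMem ht]
      have : ∀ r : ℝ, refSquare.indicator f !₂[t, r] = 0 := fun r =>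
        Set.indicator_of_notMem (fun h => ht ⟨h.1, h.2.1⟩) _
      simp [this]
  fin_cases i
  · exact h0
  · rw [h0, lintegral_lintegral_swap (f := fun t r => f !₂[t, r]) hm.aemeasurable]
    rfl

theorem volume_Ioo_zero_one : volume (Set.Ioo (0 : ℝ) 1) = 1 := by simp

theorem lintegral_refSquare_coord (i : Fin 2) {G : ℝ → ℝ≥0∞} (hG : Measurable G) :
    ∫⁻ x in refSquare, G (x i) = ∫⁻ t in Set.Ioo (0 : ℝ) 1, G t := by
  rw [lintegral_refSquare i (f := fun x => G (x i)) (by fun_prop)]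
  simp only [planeMk_apply_self, lintegral_const, Measure.restrict_apply MeasurableSet.univ,
    Set.univ_inter, volume_Ioo_zero_one, mul_one]

theorem slobodeckij_integrand_eq {A : ℝ} {x y : Plane} (hxy : x ≠ y) (s : ℝ) :
    ‖A‖ₑ ^ 2 / edist x y ^ (2 + 2 * s) = ENNReal.ofReal (A ^ 2 / dist x y ^ (2 + 2 * s)) := by
  have hd := dist_pos.2 hxy
  rw [edist_dist, ENNReal.ofReal_rpow_of_pos hd, ENNReal.ofReal_div_of_pos (by positivity),
    Real.enorm_eq_ofReal_abs, ← ENNReal.ofReal_pow (abs_nonneg _), sq_abs]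

/-- Let `τ` and `ρ` be the differences of the `i`-th and of the other coordinates. Then `|x - y|³ ≥
|τ| (τ² + ρ²)`, and `1 / (τ² + ρ²)` has the integral `π / |τ|` over all `ρ`. So integrating out the
other coordinate leaves at most `π / τ²`, the kernel of `H^(1/2)(0, 1)`. -/
theorem slobodeckijSq_half_le {F : ℝ → ℝ} (hF : Measurable F) (i : Fin 2) :
    slobodeckijSq (1 / 2) refSquare (fun x => F (x i)) ≤
      ENNReal.ofReal Real.pi * hHalfSqInterval F := by
  have hmI : Measurable fun p : ℝ × ℝ => ENNReal.ofReal ((F p.1 - F p.2) ^ 2 / (p.1 - p.2) ^ 2) := by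
    fun_prop
  have inner : ∀ x : Plane, ∫⁻ y in refSquare, ‖F (x i) - F (y i)‖ₑ ^ 2 /
      edist x y ^ (2 + 2 * (1 / 2) : ℝ) ≤ ENNReal.ofReal Real.pi * ∫⁻ t in Set.Ioo (0 : ℝ) 1,
        ENNReal.ofReal ((F (x i) - F t) ^ 2 / (x i - t) ^ 2) := fun x => by
    rw [lintegral_refSquare i (by fun_prop), ← lintegral_const_mul _ (by fun_prop)]
    refine lintegral_mono fun t => ?_
    simp only [planeMk_apply_self]
    rcases eq_or_ne (x i) t with h | h
    · simp [h]
    have hτ : x i - t ≠ 0 := sub_ne_zero.2 h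
    have hτ' : 0 < |x i - t| := abs_pos.2 hτ
    calc ∫⁻ r in Set.Ioo (0 : ℝ) 1, ‖F (x i) - F t‖ₑ ^ 2 /
          edist x (planeMk i t r) ^ (2 + 2 * (1 / 2) : ℝ)
        ≤ ∫⁻ r in Set.Ioo (0 : ℝ) 1, ENNReal.ofReal ((F (x i) - F t) ^ 2 / |x i - t|) *
            ENNReal.ofReal (1 / ((x i - t) ^ 2 + (x i.rev - r) ^ 2)) := by
          refine lintegral_mono fun r => ?_
          simp only
          have hne : x ≠ planeMk i t r := fun e => h (by rw [e, planeMk_apply_self])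
          have hD := dist_sq_plane i x (planeMk i t r)
          rw [planeMk_apply_self, planeMk_apply_rev] at hD
          have hd := dist_pos.2 hne
          rw [slobodeckij_integrand_eq hne, ← ENNReal.ofReal_mul (by positivity)]
          refine ENNReal.ofReal_le_ofReal ?_
          rw [show (2 + 2 * (1 / 2) : ℝ) = (3 : ℕ) by norm_num, Real.rpow_natCast, ← hD,
            div_mul_div_comm, mul_one]
          have h1 : |x i - t| ≤ dist x (planeMk i t r) := by
            refine abs_le_of_sq_le_sq ?_ hd.le
            rw [hD]
            nlinarith [sq_nonneg (x i.rev - r)]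
          refine div_le_div_of_nonneg_left (sq_nonneg _) (by positivity) ?_
          calc _ ≤ dist x (planeMk i t r) * dist x (planeMk i t r) ^ 2 := by gcongr
            _ = _ := by ring
      _ ≤ ENNReal.ofReal ((F (x i) - F t) ^ 2 / |x i - t|) * ENNReal.ofReal (Real.pi / |x i - t|) := by
          rw [lintegral_const_mul _ (by fun_prop), ← lintegral_inv_sq_add_sq (x i.rev) hτ]
          gcongr
          exact Measure.restrict_le_self
      _ = ENNReal.ofReal Real.pi * ENNReal.ofReal ((F (x i) - F t) ^ 2 / (x i - t) ^ 2) := by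
          rw [← ENNReal.ofReal_mul (by positivity), ← ENNReal.ofReal_mul (by positivity),
            ← sq_abs (x i - t)]
          congr 1
          field_simp
  have hG : Measurable fun s => ∫⁻ t in Set.Ioo (0 : ℝ) 1,
      ENNReal.ofReal ((F s - F t) ^ 2 / (s - t) ^ 2) := hmI.lintegral_prod_right'
  calc slobodeckijSq (1 / 2) refSquare (fun x => F (x i))
      ≤ ∫⁻ x in refSquare, ENNReal.ofReal Real.pi * ∫⁻ t in Set.Ioo (0 : ℝ) 1,
        ENNReal.ofReal ((F (x i) - F t) ^ 2 / (x i - t) ^ 2) := lintegral_mono fun x => inner x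
    _ = ENNReal.ofReal Real.pi * hHalfSqInterval F := by
      have hG' : Measurable fun x : Plane => ∫⁻ t in Set.Ioo (0 : ℝ) 1,
        ENNReal.ofReal ((F (x i) - F t) ^ 2 / (x i - t) ^ 2) := hG.comp (g := fun s => ∫⁻ t in
          Set.Ioo (0 : ℝ) 1, ENNReal.ofReal ((F s - F t) ^ 2 / (s - t) ^ 2)) (by fun_prop)
      rw [lintegral_const_mul _ hG', lintegral_refSquare_coord i hG]
      rfl

theorem lTwoNorm_sq (Ω : Set Plane) (f : Plane → ℝ) :
    lTwoNorm Ω f ^ 2 = ∫⁻ x in Ω, ENNReal.ofReal (f x ^ 2) := by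
  have h : lTwoNorm Ω f ^ 2 = lTwoNorm Ω f ^ (2 : ℝ) := (ENNReal.rpow_ofNat _ 2).symm
  rw [h, lTwoNorm, eLpNorm_eq_lintegral_rpow_enorm_toReal two_ne_zero ENNReal.ofNat_ne_top]
  simp only [ENNReal.toReal_ofNat]
  rw [← ENNReal.rpow_mul, one_div_mul_cancel two_ne_zero, ENNReal.rpow_one]
  refine lintegral_congr fun x => ?_
  rw [Real.enorm_eq_ofReal_abs, ENNReal.ofReal_rpow_of_nonneg (abs_nonneg _) zero_le_two]
  congr 1
  rw [show (2 : ℝ) = (2 : ℕ) by norm_num, Real.rpow_natCast, sq_abs]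

theorem hsNorm_sq (s : ℝ) (Ω : Set Plane) (f : Plane → ℝ) :
    hsNorm s Ω f ^ 2 = lTwoNorm Ω f ^ 2 + slobodeckijSq s Ω f := by
  rw [hsNorm, ← ENNReal.rpow_natCast, ← ENNReal.rpow_mul]
  norm_num

theorem hsNorm_mono_set (s : ℝ) {Ω Ω' : Set Plane} (h : Ω ⊆ Ω') (f : Plane → ℝ) :
    hsNorm s Ω f ≤ hsNorm s Ω' f := by
  unfold hsNorm lTwoNorm slobodeckijSq
  gcongr

theorem hsNorm_half_le {F : ℝ → ℝ} (hF : Measurable F) {K : Set Plane} (hK : K ⊆ refSquare)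
    (i : Fin 2) : hsNorm (1 / 2) K (fun x => F (x i)) ^ 2 ≤
      lTwoSqInterval F + ENNReal.ofReal Real.pi * hHalfSqInterval F := by
  refine (pow_le_pow_left' (hsNorm_mono_set _ hK _) 2).trans ?_
  rw [hsNorm_sq, lTwoNorm_sq, lintegral_refSquare_coord i (G := fun t => ENNReal.ofReal (F t ^ 2))
    (by fun_prop)]
  exact add_le_add le_rfl (slobodeckijSq_half_le hF i)

theorem dist_lt_two {x y : Plane} (hx : x ∈ refSquare) (hy : y ∈ refSquare) : dist x y < 2 := by
  have h := dist_sq_plane 0 x y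
  obtain ⟨h1, h2, h3, h4⟩ := hx
  obtain ⟨h5, h6, h7, h8⟩ := hy
  have e : Fin.rev (0 : Fin 2) = 1 := rfl
  rw [e] at h
  nlinarith [dist_nonneg (x := x) (y := y)]

/-- The norm of `H^s` is weaker than that of `H^(1/2)`, for `s ≤ 1/2`. -/
theorem hsNorm_le_hsNorm_half {s : ℝ} (hs0 : 0 < s) (hs : s ≤ 1 / 2) {K : Set Plane}
    (hKo : IsOpen K) (hK : K ⊆ refSquare) (f : Plane → ℝ) :
    hsNorm s K f ^ 2 ≤ 2 * hsNorm (1 / 2) K f ^ 2 := by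
  rw [hsNorm_sq, hsNorm_sq, mul_add]
  refine add_le_add ?_ ?_
  · rw [two_mul]
    exact le_add_of_nonneg_left zero_le
  · unfold slobodeckijSq
    rw [← lintegral_const_mul' _ _ ENNReal.ofNat_ne_top]
    refine setLIntegral_mono' hKo.measurableSet fun x hx => ?_
    rw [← lintegral_const_mul' _ _ ENNReal.ofNat_ne_top]
    refine setLIntegral_mono' hKo.measurableSet fun y hy => ?_
    rcases eq_or_ne x y with rfl | hne
    · simp
    have hd := dist_pos.2 hne
    rw [slobodeckij_integrand_eq hne, slobodeckij_integrand_eq hne]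
    refine (ENNReal.ofReal_le_ofReal ?_).trans_eq ((ENNReal.ofReal_mul zero_le_two).trans
      (congrArg (· * _) (ENNReal.ofReal_ofNat 2)))
    -- The kernels differ by the factor `|x - y|^(1 - 2s)`, which is at most `2` since distances in
    -- the square are below `2` and the exponent lies in `[0, 1]`.
    have e : dist x y ^ (2 + 2 * (1 / 2) : ℝ) = dist x y ^ (2 + 2 * s) * dist x y ^ (1 - 2 * s) := by
      rw [← Real.rpow_add hd]
      ring_nf
    have h2 : dist x y ^ (1 - 2 * s) ≤ 2 := by
      calc dist x y ^ (1 - 2 * s) ≤ 2 ^ (1 - 2 * s) :=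
            Real.rpow_le_rpow hd.le (dist_lt_two (hK hx) (hK hy)).le (by linarith)
        _ ≤ 2 ^ (1 : ℝ) := Real.rpow_le_rpow_of_exponent_le one_le_two (by linarith)
        _ = 2 := Real.rpow_one 2
    rw [e, ← mul_div_assoc, div_le_div_iff₀ (by positivity) (by positivity)]
    have h3 : 0 ≤ (f x - f y) ^ 2 * dist x y ^ (2 + 2 * s) := by positivity
    nlinarith [mul_le_mul_of_nonneg_left h2 h3]

/-! ### Weak gradients of Lipschitz functions -/

theorem measurable_gradient {E : Type*} [NormedAddCommGroup E] [InnerProductSpace ℝ E]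
    [CompleteSpace E] [MeasurableSpace E] [BorelSpace E] (F : E → ℝ) : Measurable (gradient F) :=
  (LinearIsometryEquiv.continuous _).measurable.comp (measurable_fderiv ℝ F)

theorem norm_gradient {E : Type*} [NormedAddCommGroup E] [InnerProductSpace ℝ E]
    [CompleteSpace E] (F : E → ℝ) (x : E) : ‖gradient F x‖ = ‖fderiv ℝ F x‖ :=
  LinearIsometryEquiv.norm_map _ _

/-- A function which agrees with a Lipschitz function in a bounded open set has the pointwise
gradient as its weak gradient. -/
theorem hasWeakGradient_of_lipschitzWith {E : Type*} [NormedAddCommGroup E]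
    [InnerProductSpace ℝ E] [FiniteDimensional ℝ E] [MeasureSpace E] [BorelSpace E]
    [(volume : Measure E).IsAddHaarMeasure] {Ω : Set E} (hΩ : IsOpen Ω) (hb : Bornology.IsBounded Ω)
    {f F : E → ℝ} {C : ℝ≥0} (hF : LipschitzWith C F) (hf : ∀ x ∈ Ω, f x = F x) :
    HasWeakGradient Ω f (gradient F) := by
  have ae := ae_restrict_mem (μ := (volume : Measure E)) hΩ.measurableSet
  have : IsFiniteMeasure (volume.restrict Ω) := ⟨by simpa using hb.measure_lt_top⟩
  refine ⟨?_, ?_, fun φ hφ v => ?_⟩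
  · refine MemLp.ae_eq (f := F) (ae.mono fun x hx => (hf x hx).symm) ?_
    obtain ⟨B, hB⟩ := (hb.isCompact_closure.exists_bound_of_continuousOn hF.continuous.continuousOn)
    exact MemLp.of_bound hF.continuous.aestronglyMeasurable B
      (ae.mono fun x hx => hB x (subset_closure hx))
  · refine MemLp.of_bound (measurable_gradient F).aestronglyMeasurable C
      (Eventually.of_forall fun x => ?_)
    rw [norm_gradient]
    exact norm_fderiv_le_of_lipschitz ℝ hF
  · have hφ0 : ∀ x ∉ Ω, φ x = 0 := fun x hx =>
      image_eq_zero_of_notMem_tsupport fun h => hx (hφ.2.2 h)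
    have hφ1 : ∀ x ∉ Ω, fderiv ℝ φ x = 0 := fun x hx => by
      by_contra h
      exact hx (hφ.2.2 (support_fderiv_subset ℝ h))
    obtain ⟨D, hD⟩ := hφ.1.lipschitzWith_of_hasCompactSupport hφ.2.1 (by simp)
    have hφd : Differentiable ℝ φ := hφ.1.differentiable (by simp)
    -- Integration by parts on the whole space, available for the Lipschitz extension `F`; the
    -- support of `φ` restricts both sides to `Ω`. Rademacher's theorem then identifies the line
    -- derivatives with the gradient.
    have key := hF.integral_lineDeriv_mul_eq (μ := volume) hD hφ.2.1 v
    have e1 : ∫ x in Ω, f x * fderiv ℝ φ x v = ∫ x, F x * fderiv ℝ φ x v := by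
      rw [setIntegral_congr_fun hΩ.measurableSet (g := fun x => F x * fderiv ℝ φ x v)
        fun x hx => by simp only [hf x hx]]
      exact setIntegral_eq_integral_of_forall_compl_eq_zero fun x hx => by simp [hφ1 x hx]
    have e2 : ∫ x in Ω, inner ℝ (gradient F x) v * φ x = ∫ x, inner ℝ (gradient F x) v * φ x :=
      setIntegral_eq_integral_of_forall_compl_eq_zero fun x hx => by simp [hφ0 x hx]
    have e3 : ∫ x, inner ℝ (gradient F x) v * φ x = ∫ x, lineDeriv ℝ F x v * φ x := by
      refine integral_congr_ae ?_
      filter_upwards [hF.ae_differentiableAt (μ := volume)] with x hx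
      rw [hx.lineDeriv_eq_fderiv, gradient, InnerProductSpace.toDual_symm_apply]
    rw [e1, e2, e3, key, ← integral_neg]
    refine integral_congr_ae (Eventually.of_forall fun x => ?_)
    simp only
    rw [(hφd x).lineDeriv_eq_fderiv, map_neg]
    ring

theorem hOneNorm_le {E : Type*} [NormedAddCommGroup E] [InnerProductSpace ℝ E]
    [MeasureSpace E] {Ω : Set E} {f : E → ℝ} {g : E → E} (h : HasWeakGradient Ω f g) :
    hOneNorm Ω f ≤
      (eLpNorm f 2 (volume.restrict Ω) ^ 2 + eLpNorm g 2 (volume.restrict Ω) ^ 2) ^ (1 / 2 : ℝ) :=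
  iInf₂_le g h

/-! ### Smooth fields -/

theorem hHalfSqInterval_id : hHalfSqInterval id < ⊤ := by
  have h : ∀ s t : ℝ, ENNReal.ofReal ((id s - id t) ^ 2 / (s - t) ^ 2) ≤ 1 := fun s t => by
    rw [← ENNReal.ofReal_one]
    exact ENNReal.ofReal_le_ofReal (div_self_le_one _)
  refine (lintegral_mono fun s => lintegral_mono fun t => h s t).trans_lt ?_
  simp

/-- The bound `|f x - f y|² ≤ C² ((x₁ - y₁)² + (x₂ - y₂)²)` reduces the seminorm to those of the
coordinates, which are finite by `slobodeckijSq_half_le` since the difference quotient of the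
identity is bounded. -/
theorem memHs_half_of_lipschitzOnWith {K : Set Plane} (hKo : IsOpen K) (hK : K ⊆ refSquare)
    {f : Plane → ℝ} {C : ℝ≥0} (hf : LipschitzOnWith C f K) : MemHs (1 / 2) K f := by
  have ae := ae_restrict_mem (μ := (volume : Measure Plane)) hKo.measurableSet
  have hm : AEStronglyMeasurable f (volume.restrict K) :=
    hf.continuousOn.aestronglyMeasurable hKo.measurableSet
  refine ⟨hm, ?_⟩
  have h1 : lTwoNorm K f ^ 2 < ⊤ := by
    have : IsFiniteMeasure (volume.restrict K) :=
      ⟨by simpa using (measure_mono hK).trans_lt isSliced_refSquare.volume_lt_top⟩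
    refine ENNReal.pow_lt_top ?_
    rcases K.eq_empty_or_nonempty with rfl | ⟨x₀, hx₀⟩
    · simp [lTwoNorm]
    refine MemLp.eLpNorm_lt_top (MemLp.of_bound hm (|f x₀| + C * 2) (ae.mono fun x hx => ?_))
    have h2 := hf.dist_le_mul x hx x₀ hx₀
    have h3 : C * dist x x₀ ≤ C * 2 :=
      mul_le_mul_of_nonneg_left (dist_lt_two (hK hx) (hK hx₀)).le C.2
    rw [Real.dist_eq] at h2
    have h4 := abs_sub_abs_le_abs_sub (f x) (f x₀)
    rw [Real.norm_eq_abs]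
    linarith
  have h2 : slobodeckijSq (1 / 2) K f ≤ ENNReal.ofReal (C ^ 2) *
      (slobodeckijSq (1 / 2) refSquare (fun x => id (x 0)) +
        slobodeckijSq (1 / 2) refSquare (fun x => id (x 1))) := by
    unfold slobodeckijSq
    have m : ∀ i : Fin 2, Measurable fun p : Plane × Plane => ‖id (p.1 i) - id (p.2 i)‖ₑ ^ 2 /
        edist p.1 p.2 ^ (2 + 2 * (1 / 2) : ℝ) := fun i => by
      simp only [id]
      fun_prop
    have m' : ∀ (i : Fin 2) (x : Plane), Measurable fun y : Plane => ‖id (x i) - id (y i)‖ₑ ^ 2 /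
        edist x y ^ (2 + 2 * (1 / 2) : ℝ) := fun i x => by
      simp only [id]
      fun_prop
    have m'' : ∀ (i : Fin 2), Measurable fun x : Plane => ∫⁻ y in refSquare,
        ‖id (x i) - id (y i)‖ₑ ^ 2 / edist x y ^ (2 + 2 * (1 / 2) : ℝ) :=
      fun i => (m i).lintegral_prod_right'
    rw [← lintegral_add_left (m'' 0), ← lintegral_const_mul' _ _ ENNReal.ofReal_ne_top]
    refine (lintegral_mono_set hK).trans' (setLIntegral_mono' hKo.measurableSet fun x hx => ?_)
    rw [← lintegral_add_left (m' 0 x), ← lintegral_const_mul' _ _ ENNReal.ofReal_ne_top]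
    refine (lintegral_mono_set hK).trans' (setLIntegral_mono' hKo.measurableSet fun y hy => ?_)
    rcases eq_or_ne x y with rfl | hne
    · simp
    rw [slobodeckij_integrand_eq hne, slobodeckij_integrand_eq hne, slobodeckij_integrand_eq hne,
      ← ENNReal.ofReal_add (div_nonneg (sq_nonneg _) (Real.rpow_nonneg dist_nonneg _))
        (div_nonneg (sq_nonneg _) (Real.rpow_nonneg dist_nonneg _)),
      ← ENNReal.ofReal_mul (by positivity)]
    refine ENNReal.ofReal_le_ofReal ?_
    rw [← add_div, ← mul_div_assoc ((C : ℝ) ^ 2)]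
    gcongr ?_ / _
    have h3 := hf.dist_le_mul x hx y hy
    have h4 := dist_sq_plane 0 x y
    rw [Real.dist_eq] at h3
    calc (f x - f y) ^ 2 = |f x - f y| ^ 2 := (sq_abs _).symm
      _ ≤ (C * dist x y) ^ 2 := by gcongr
      _ = _ := by rw [mul_pow, h4]; rfl
  have h3 : ∀ i : Fin 2, slobodeckijSq (1 / 2) refSquare (fun x => id (x i)) < ⊤ := fun i =>
    (slobodeckijSq_half_le measurable_id i).trans_lt
      (ENNReal.mul_lt_top ENNReal.ofReal_lt_top hHalfSqInterval_id)
  rw [hsNorm]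
  refine ENNReal.rpow_lt_top_of_nonneg (by norm_num) (ENNReal.add_lt_top.2 ⟨h1, h2.trans_lt ?_⟩).ne
  exact ENNReal.mul_lt_top ENNReal.ofReal_lt_top (ENNReal.add_lt_top.2 ⟨h3 0, h3 1⟩)

theorem MemHs.of_half {s : ℝ} (hs0 : 0 < s) (hs : s ≤ 1 / 2) {K : Set Plane} (hKo : IsOpen K)
    (hK : K ⊆ refSquare) {f : Plane → ℝ} (hf : MemHs (1 / 2) K f) : MemHs s K f := by
  refine ⟨hf.1, ?_⟩
  have h := (hsNorm_le_hsNorm_half hs0 hs hKo hK f).trans_lt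
    (ENNReal.mul_lt_top ENNReal.ofNat_lt_top (ENNReal.pow_lt_top hf.2))
  by_contra h'
  rw [not_lt, top_le_iff] at h'
  simp [h'] at h

theorem vecMemHs_of_contDiff {s : ℝ} (hs0 : 0 < s) (hs : s ≤ 1 / 2) {K : Set Plane} (hKo : IsOpen K)
    (hK : K ⊆ refSquare) {u : Plane → Plane} (hu : ∀ i, ContDiff ℝ 1 fun x => u x i) :
    VecMemHs s K u := fun i => by
  obtain ⟨C, hC⟩ := (hu i).contDiffOn.exists_lipschitzOnWith one_ne_zero
    (convex_closedBall (0 : Plane) 2) (isCompact_closedBall (0 : Plane) 2)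
  refine (memHs_half_of_lipschitzOnWith hKo hK (hC.mono fun x hx => ?_)).of_half hs0 hs hKo hK
  obtain ⟨h1, h2, h3, h4⟩ := hK hx
  rw [mem_closedBall_zero_iff, EuclideanSpace.norm_eq, Fin.sum_univ_two]
  refine Real.sqrt_le_iff.2 ⟨by norm_num, ?_⟩
  simp only [Real.norm_eq_abs, sq_abs]
  nlinarith

/-! ### Smooth truncations of the iterated logarithm -/

/-- A smooth function with the value `0` outside `(a, 2)` and `1` on `[b, 1]`. -/
def logCutoff (a b t : ℝ) : ℝ :=
  Real.smoothTransition ((t - a) / (b - a)) * Real.smoothTransition (2 - t)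

/-- Minus the derivative of `logLog`, cut off smoothly. -/
def truncSlope (a b t : ℝ) : ℝ := logCutoff a b t * (1 / (t * (1 - Real.log t)))

/-- The smooth truncation of `logLog`. -/
def truncLogLog (a b y : ℝ) : ℝ := -∫ t in (1 : ℝ)..y, truncSlope a b t

section

variable {a b : ℝ}

theorem logCutoff_nonneg (t : ℝ) : 0 ≤ logCutoff a b t :=
  mul_nonneg (Real.smoothTransition.nonneg _) (Real.smoothTransition.nonneg _)

theorem logCutoff_le_one (t : ℝ) : logCutoff a b t ≤ 1 :=
  mul_le_one₀ (Real.smoothTransition.le_one _) (Real.smoothTransition.nonneg _)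
    (Real.smoothTransition.le_one _)

theorem logCutoff_of_le (hab : a < b) {t : ℝ} (ht : t ≤ a) : logCutoff a b t = 0 := by
  rw [logCutoff, Real.smoothTransition.zero_of_nonpos, zero_mul]
  exact div_nonpos_of_nonpos_of_nonneg (by linarith) (by linarith)

theorem logCutoff_of_two_le {t : ℝ} (ht : 2 ≤ t) : logCutoff a b t = 0 := by
  rw [logCutoff, Real.smoothTransition.zero_of_nonpos (x := 2 - t) (by linarith), mul_zero]

theorem logCutoff_eq_one (hab : a < b) {t : ℝ} (ht : b ≤ t) (ht1 : t ≤ 1) : logCutoff a b t = 1 := by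
  rw [logCutoff, Real.smoothTransition.one_of_one_le, Real.smoothTransition.one_of_one_le, mul_one]
  · linarith
  · rw [one_le_div (by linarith)]
    linarith

theorem truncSlope_of_le (hab : a < b) {t : ℝ} (ht : t ≤ a) : truncSlope a b t = 0 := by
  rw [truncSlope, logCutoff_of_le hab ht, zero_mul]

theorem truncSlope_of_two_le {t : ℝ} (ht : 2 ≤ t) : truncSlope a b t = 0 := by
  rw [truncSlope, logCutoff_of_two_le ht, zero_mul]

/-- The cutoff removes both singularities of `1 / (t (1 - log t))`: the one at `0` lies to the left
of `a`, the one at Euler's number to the right of `2`. -/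
theorem contDiff_truncSlope (ha : 0 < a) (hab : a < b) : ContDiff ℝ ∞ (truncSlope a b) := by
  rw [contDiff_iff_contDiffAt]
  intro t
  rcases lt_or_ge t a with h | h
  · refine (contDiffAt_const (c := (0 : ℝ))).congr_of_eventuallyEq ?_
    filter_upwards [gt_mem_nhds h] with s hs using truncSlope_of_le hab hs.le
  rcases lt_or_ge 2 t with h' | h'
  · refine (contDiffAt_const (c := (0 : ℝ))).congr_of_eventuallyEq ?_
    filter_upwards [lt_mem_nhds h'] with s hs using truncSlope_of_two_le hs.le
  have ht0 := ha.trans_le h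
  have h1 := one_sub_log_pos ht0 h'
  have h2 : ContDiffAt ℝ ∞ (fun t => logCutoff a b t) t := by
    unfold logCutoff
    exact ((Real.smoothTransition.contDiff.comp (by fun_prop)).mul
      (Real.smoothTransition.contDiff.comp (by fun_prop))).contDiffAt
  exact h2.mul (contDiffAt_const.div (contDiffAt_id.mul
    (contDiffAt_const.sub (Real.contDiffAt_log.2 ht0.ne'))) (mul_pos ht0 h1).ne')

theorem truncSlope_nonneg (ha : 0 < a) (hab : a < b) (t : ℝ) : 0 ≤ truncSlope a b t := by
  rcases le_or_gt t a with h | h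
  · rw [truncSlope_of_le hab h]
  rcases le_or_gt 2 t with h' | h'
  · rw [truncSlope_of_two_le h']
  have ht0 := ha.trans h
  have h1 := one_sub_log_pos ht0 h'.le
  exact mul_nonneg (logCutoff_nonneg t) (by positivity)

theorem truncSlope_le {t : ℝ} (ht0 : 0 < t) (ht : t ≤ 2) :
    truncSlope a b t ≤ 1 / (t * (1 - Real.log t)) := by
  have h1 := one_sub_log_pos ht0 ht
  exact mul_le_of_le_one_left (by positivity) (logCutoff_le_one t)

theorem hasDerivAt_truncLogLog (ha : 0 < a) (hab : a < b) (y : ℝ) :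
    HasDerivAt (truncLogLog a b) (-truncSlope a b y) y :=
  ((contDiff_truncSlope ha hab).continuous.integral_hasStrictDerivAt 1 y).hasDerivAt.neg

theorem contDiff_truncLogLog (ha : 0 < a) (hab : a < b) : ContDiff ℝ ∞ (truncLogLog a b) := by
  rw [contDiff_infty_iff_deriv]
  refine ⟨fun y => (hasDerivAt_truncLogLog ha hab y).differentiableAt, ?_⟩
  rw [funext fun y => (hasDerivAt_truncLogLog ha hab y).deriv]
  exact (contDiff_truncSlope ha hab).neg

theorem truncLogLog_one : truncLogLog a b 1 = 0 := by simp [truncLogLog]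

theorem antitone_truncLogLog (ha : 0 < a) (hab : a < b) : Antitone (truncLogLog a b) := by
  refine antitone_of_deriv_nonpos (fun y => (hasDerivAt_truncLogLog ha hab y).differentiableAt)
    fun y => ?_
  rw [(hasDerivAt_truncLogLog ha hab y).deriv]
  exact neg_nonpos.2 (truncSlope_nonneg ha hab y)

/-- `logLog` decreases faster than its truncation. -/
theorem truncLogLog_sub_le (ha : 0 < a) (hab : a < b) {s t : ℝ} (hs : 0 < s) (hst : s ≤ t)
    (ht : t ≤ 1) : truncLogLog a b s - truncLogLog a b t ≤ logLog s - logLog t := by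
  have hd : ∀ y ∈ Set.Icc s t, HasDerivAt (fun y => truncLogLog a b y - logLog y)
      (-truncSlope a b y - -(1 / (y * (1 - Real.log y)))) y := fun y hy =>
    (hasDerivAt_truncLogLog ha hab y).sub
      (hasDerivAt_logLog (hs.trans_le hy.1) (by linarith [hy.2]))
  have h := monotoneOn_of_deriv_nonneg (convex_Icc s t)
    (fun y hy => (hd y hy).continuousAt.continuousWithinAt)
    (fun y hy => (hd y (interior_subset hy)).differentiableAt.differentiableWithinAt)
    (fun y hy => by
      have hy := interior_subset hy
      rw [(hd y hy).deriv]
      have := truncSlope_le (a := a) (b := b) (hs.trans_le hy.1) (by linarith [hy.2])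
      linarith)
  have := h (Set.left_mem_Icc.2 hst) (Set.right_mem_Icc.2 hst) hst
  simp only at this
  linarith

theorem truncLogLog_eq_logLog (ha : 0 < a) (hab : a < b) {y : ℝ} (hy : b ≤ y) (hy1 : y ≤ 1) :
    truncLogLog a b y = logLog y := by
  have h0 : 0 < y := by linarith
  have hle := truncLogLog_sub_le ha hab h0 hy1 le_rfl
  rw [truncLogLog_one, logLog_one, sub_zero, sub_zero] at hle
  refine le_antisymm hle ?_
  have hd : ∀ z ∈ Set.Icc y 1, HasDerivAt (fun y => truncLogLog a b y - logLog y)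
      (-truncSlope a b z - -(1 / (z * (1 - Real.log z)))) z := fun z hz =>
    (hasDerivAt_truncLogLog ha hab z).sub
      (hasDerivAt_logLog (h0.trans_le hz.1) (by linarith [hz.2]))
  have h := antitoneOn_of_deriv_nonpos (convex_Icc y 1)
    (fun z hz => (hd z hz).continuousAt.continuousWithinAt)
    (fun z hz => (hd z (interior_subset hz)).differentiableAt.differentiableWithinAt)
    (fun z hz => by
      have hz := interior_subset hz
      rw [(hd z hz).deriv, truncSlope, logCutoff_eq_one hab (hy.trans hz.1) hz.2]
      linarith)
  have := h (Set.left_mem_Icc.2 hy1) (Set.right_mem_Icc.2 hy1) hy1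
  simp only [truncLogLog_one, logLog_one] at this
  linarith

theorem truncLogLog_eq_of_le (ha : 0 < a) (hab : a < b) {y : ℝ} (hy : y ≤ a) :
    truncLogLog a b y = truncLogLog a b a := by
  refine le_antisymm ?_ (antitone_truncLogLog ha hab hy)
  have hd := fun z => hasDerivAt_truncLogLog ha hab z
  have h := monotoneOn_of_deriv_nonneg (convex_Icc y a)
    (fun z hz => (hd z).continuousAt.continuousWithinAt)
    (fun z hz => (hd z).differentiableAt.differentiableWithinAt)
    (fun z hz => by
      have hz := interior_subset hz
      rw [(hd z).deriv, truncSlope_of_le hab hz.2, neg_zero])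
  exact h (Set.left_mem_Icc.2 hy) (Set.right_mem_Icc.2 hy) hy

/-- Both functions decrease on `(0, 1]` and vanish at `1`, and the truncation has the smaller slope.
The resulting norm bounds do not depend on `a` and `b`. -/
theorem isLogLogDominated_truncLogLog (ha : 0 < a) (hab : a < b) :
    IsLogLogDominated 1 (truncLogLog a b) := by
  have h : ∀ s ∈ Set.Ioo (0 : ℝ) 1, ∀ t ∈ Set.Ioc (0 : ℝ) 1, s ≤ t →
      |truncLogLog a b s - truncLogLog a b t| ≤ 1 * |logLog s - logLog t| := fun s hs t ht hst => by
    rw [one_mul, abs_of_nonneg (sub_nonneg.2 (antitone_truncLogLog ha hab hst)),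
      abs_of_nonneg (sub_nonneg.2 (logLog_le_logLog hs.1 hst (by linarith [ht.2])))]
    exact truncLogLog_sub_le ha hab hs.1 hst ht.2
  refine ⟨fun s hs => ?_, fun s hs t ht => ?_⟩
  · have := h s hs 1 (by simp) hs.2.le
    rwa [truncLogLog_one, logLog_one, sub_zero, sub_zero,
      abs_of_nonneg (logLog_nonneg hs.1 hs.2.le)] at this
  · rcases le_total s t with hst | hst
    · exact h s hs t ⟨ht.1, ht.2.le⟩ hst
    · rw [abs_sub_comm, abs_sub_comm (logLog s)]
      exact h t ht s ⟨hs.1, hs.2.le⟩ hst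

/-- The values at `0` are unbounded as `b → 0`, in contrast to the uniform norm bounds. -/
theorem logLog_le_truncLogLog_zero (ha : 0 < a) (hab : a < b) (hb : b ≤ 1) :
    logLog b ≤ truncLogLog a b 0 := by
  rw [← truncLogLog_eq_logLog ha hab le_rfl hb]
  exact antitone_truncLogLog ha hab (by linarith)

theorem hasBoundedDeriv_of_contDiff {g : ℝ → ℝ} (hg : ContDiff ℝ 1 g) :
    HasBoundedDeriv g (deriv g) where
  continuousOn := hg.continuous.continuousOn
  hasDerivAt := ⟨∅, Set.countable_empty, fun x _ =>
    (hg.differentiable one_ne_zero x).hasDerivAt⟩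
  measurable := measurable_deriv g
  bounded := by
    obtain ⟨C, hC⟩ := isCompact_Icc.exists_bound_of_continuousOn (s := Set.Icc (0 : ℝ) 1)
      (hg.continuous_deriv le_rfl).continuousOn
    exact ⟨C, fun x hx => hC x (Set.Ioo_subset_Icc_self hx)⟩

end

/-! ### The clamped iterated logarithm -/

/-- The largest slope of `logLog` on `[a, 2]` is at most `logLogSlope a`. -/
def logLogSlope (a : ℝ) : ℝ := 1 / (a * (1 - Real.log 2))

theorem one_div_mul_log_le {a t : ℝ} (ha : 0 < a) (hat : a ≤ t) (ht : t ≤ 2) :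
    1 / (t * (1 - Real.log t)) ≤ logLogSlope a := by
  have h1 := one_sub_log_pos two_pos le_rfl
  have h2 := Real.log_le_log (ha.trans_le hat) ht
  have h3 := (ha.trans_le hat).le
  unfold logLogSlope
  gcongr

/-- `logLog`, made constant to the left of `a` and to the right of `2`. -/
def clampLogLog (a y : ℝ) : ℝ := logLog (max a (min y 2))

theorem logLogSlope_nonneg {a : ℝ} (ha : 0 < a) : 0 ≤ logLogSlope a := by
  have h1 := one_sub_log_pos two_pos le_rfl
  unfold logLogSlope
  positivity

/-- Clamping the argument yields a Lipschitz function on the whole line, as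
`hasWeakGradient_of_lipschitzWith` requires. -/
theorem lipschitzWith_clampLogLog {a : ℝ} (ha : 0 < a) (ha2 : a ≤ 2) :
    LipschitzWith (logLogSlope a).toNNReal (clampLogLog a) := by
  have h : LipschitzOnWith (logLogSlope a).toNNReal logLog (Set.Icc a 2) := by
    refine (convex_Icc a 2).lipschitzOnWith_of_nnnorm_hasDerivWithin_le
      (fun t ht => (hasDerivAt_logLog (ha.trans_le ht.1) ht.2).hasDerivWithinAt) fun t ht => ?_
    have h1 := one_sub_log_pos (ha.trans_le ht.1) ht.2
    have h2 := ha.trans_le ht.1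
    rw [← NNReal.coe_le_coe, coe_nnnorm, norm_neg, Real.norm_of_nonneg (by positivity),
      Real.coe_toNNReal _ (logLogSlope_nonneg ha)]
    exact one_div_mul_log_le ha ht.1 ht.2
  have h' : LipschitzWith 1 fun y : ℝ => max a (min y 2) :=
    (LipschitzWith.id.min_const 2).const_max a
  have := h.comp (h'.lipschitzOnWith (s := Set.univ)) fun y _ =>
    ⟨le_max_left _ _, max_le ha2 (min_le_right _ _)⟩
  rw [mul_one, lipschitzOnWith_univ] at this
  exact this

theorem lipschitzWith_truncLogLog {a b : ℝ} (ha : 0 < a) (hab : a < b) :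
    LipschitzWith (logLogSlope a).toNNReal (truncLogLog a b) := by
  refine lipschitzWith_of_nnnorm_deriv_le
    (fun y => (hasDerivAt_truncLogLog ha hab y).differentiableAt) fun t => ?_
  rw [(hasDerivAt_truncLogLog ha hab t).deriv, ← NNReal.coe_le_coe, coe_nnnorm, norm_neg,
    Real.norm_of_nonneg (truncSlope_nonneg ha hab t), Real.coe_toNNReal _ (logLogSlope_nonneg ha)]
  rcases le_or_gt t a with h | h
  · rw [truncSlope_of_le hab h]
    exact logLogSlope_nonneg ha
  rcases le_or_gt 2 t with h' | h'
  · rw [truncSlope_of_two_le h']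
    exact logLogSlope_nonneg ha
  exact (truncSlope_le (ha.trans h) h'.le).trans (one_div_mul_log_le ha h.le h'.le)

/-! ### Failure of the isotropic estimates -/

theorem le_one_add_sq (x : ℝ≥0∞) : x ≤ 1 + x ^ 2 := by
  rcases le_total x 1 with h | h
  · exact h.trans (le_add_of_nonneg_right zero_le)
  · refine le_trans ?_ (le_add_of_nonneg_left zero_le)
    rw [sq]
    exact le_mul_of_one_le_right zero_le h

theorem IsLogLogDominated.hsNorm_half_sq_le {c : ℝ} {F : ℝ → ℝ} (h : IsLogLogDominated c F)
    (hF : Measurable F) {K : Set Plane} (hK : K ⊆ refSquare) (i : Fin 2) :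
    hsNorm (1 / 2) K (fun x => F (x i)) ^ 2 ≤
      ENNReal.ofReal (c ^ 2) * (32 + ENNReal.ofReal Real.pi * 64) := by
  refine (hsNorm_half_le hF hK i).trans ?_
  rw [mul_add, mul_left_comm]
  exact add_le_add h.lTwoSqInterval_le (mul_le_mul_right h.hHalfSqInterval_le _)

theorem IsLogLogDominated.hsNorm_half_one_sub_sq_le {c : ℝ} {F : ℝ → ℝ}
    (h : IsLogLogDominated c F) (hF : Measurable F) {K : Set Plane} (hK : K ⊆ refSquare)
    (i : Fin 2) : hsNorm (1 / 2) K (fun x => F (1 - x i)) ^ 2 ≤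
      ENNReal.ofReal (c ^ 2) * (32 + ENNReal.ofReal Real.pi * 64) := by
  refine (hsNorm_half_le (F := fun s => F (1 - s)) (by fun_prop) hK i).trans ?_
  rw [mul_add, mul_left_comm, lTwoSqInterval_one_sub, hHalfSqInterval_one_sub]
  exact add_le_add h.lTwoSqInterval_le (mul_le_mul_right h.hHalfSqInterval_le _)

theorem lTwoNorm_weakDiv_eq_zero {K : Set Plane} (hK : IsOpen K) {u : Plane → Plane}
    (hu : HasWeakDiv K u 0) : lTwoNorm K (weakDiv K u) = 0 := by
  rw [lTwoNorm, eLpNorm_congr_ae (g := 0) (weakDiv_ae_eq_zero hK hu), eLpNorm_zero]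

theorem lTwoNorm_ne_zero {K : Set Plane} (hK : IsOpen K) (hne : K.Nonempty) {p : Plane → ℝ}
    (hp : ∀ x ∈ K, 0 < p x) (hc : Continuous p) : lTwoNorm K p ≠ 0 := by
  intro h
  rw [lTwoNorm, eLpNorm_eq_zero_iff hc.aestronglyMeasurable two_ne_zero, Filter.EventuallyEq,
    ae_restrict_iff' hK.measurableSet] at h
  have h0 : volume K = 0 := by
    refine measure_mono_null (fun x hx => ?_) h
    exact fun h' => (hp x hx).ne' (h' hx)
  exact (hK.measure_pos volume hne).ne' h0

theorem exists_logLog_ge (R : ℝ) : ∃ b : ℝ, 0 < b ∧ b ≤ 1 ∧ R ≤ logLog b := by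
  -- The solution of `logLog b = max R 0`; the maximum with `0` ensures `b ≤ 1`.
  refine ⟨Real.exp (1 - Real.exp (max R 0)), Real.exp_pos _, ?_, ?_⟩
  · rw [Real.exp_le_one_iff, sub_nonpos]
    exact Real.one_le_exp (le_max_right _ _)
  · rw [logLog, Real.log_exp, sub_sub_cancel, Real.log_exp]
    exact le_max_left _ _

/-- The field `(F(1 - x₁), x₂ F'(1 - x₁))`. -/
def fieldZero (F : ℝ → ℝ) : Plane → Plane :=
  curlProd (fun t => F (1 - t)) (deriv fun t => F (1 - t)) id (deriv id)

/-- The field `((1 - x₁) F'(x₂), F(x₂))`. -/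
def fieldOne (F : ℝ → ℝ) : Plane → Plane :=
  curlProd (fun t => 1 - t) (deriv fun t => 1 - t) F (deriv F)

theorem contDiff_curlProd {g h : ℝ → ℝ} (hg : ContDiff ℝ ∞ g) (hh : ContDiff ℝ ∞ h) (i : Fin 2) :
    ContDiff ℝ 1 fun x => curlProd g (deriv g) h (deriv h) x i := by
  have c : ∀ (f : ℝ → ℝ) (j : Fin 2), ContDiff ℝ ∞ f → ContDiff ℝ 1 fun x : Plane => f (x j) :=
    fun f j hf => (hf.of_le (by exact_mod_cast le_top)).comp (by fun_prop)
  have hg' := (contDiff_infty_iff_deriv.1 hg).2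
  have hh' := (contDiff_infty_iff_deriv.1 hh).2
  fin_cases i
  · exact (c g 0 hg).mul (c _ 1 hh')
  · exact ((c _ 0 hg').mul (c h 1 hh)).neg

theorem fieldZero_apply (F : ℝ → ℝ) (x : Plane) : fieldZero F x 0 = F (1 - x 0) := by
  simp [fieldZero, curlProd]

theorem fieldOne_apply (F : ℝ → ℝ) (x : Plane) : fieldOne F x 1 = F (x 1) := by
  simp [fieldOne, curlProd]

/-- A family of fields that violates an estimate by the `H^s` norm and the divergence. -/
theorem not_estimate {K : Set Plane} (hK : IsOpen K) (hKs : K ⊆ refSquare) (hne : K.Nonempty)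
    (interp : (Plane → Plane) → Plane → Plane) (l : Fin 2) {s : ℝ} (hs0 : 0 < s) (hs : s ≤ 1 / 2)
    {p : Plane → ℝ} (hp : ∀ x ∈ K, 0 < p x) (hc : Continuous p)
    (h : ∀ a b : ℝ, 0 < a → a < b → ∃ u : Plane → Plane, (∀ i, ContDiff ℝ 1 fun x => u x i) ∧
      HasWeakDiv K u 0 ∧ hsNorm (1 / 2) K (fun x => u x l) ^ 2 ≤
        32 + ENNReal.ofReal Real.pi * 64 ∧
      ∀ x ∈ K, truncLogLog a b 0 * p x ≤ interp u x l) :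
    ¬ ∃ C : ℝ≥0, ∀ u : Plane → Plane, VecMemHs s K u → MemHdiv K u →
        lTwoNorm K (fun x => interp u x l) ≤
          C * (hsNorm s K (fun x => u x l) + lTwoNorm K (weakDiv K u)) := by
  rintro ⟨C, hC⟩
  -- A bound for the right-hand side that is uniform in the truncation: `x ≤ 1 + x²` passes to
  -- squared norms, and the `2` compares `H^s` with `H^(1/2)`.
  set B : ℝ≥0∞ := C * (1 + 2 * (32 + ENNReal.ofReal Real.pi * 64)) with hB
  have hBt : B ≠ ⊤ := ENNReal.mul_ne_top ENNReal.coe_ne_top (ENNReal.add_ne_top.2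
    ⟨ENNReal.one_ne_top, ENNReal.mul_ne_top ENNReal.ofNat_ne_top (ENNReal.add_ne_top.2
      ⟨ENNReal.ofNat_ne_top, ENNReal.mul_ne_top ENNReal.ofReal_ne_top ENNReal.ofNat_ne_top⟩)⟩)
  have hp0 := lTwoNorm_ne_zero hK hne hp hc
  have key : ∀ R : ℝ, 0 ≤ R → ENNReal.ofReal R * lTwoNorm K p ≤ B := fun R hR => by
    -- With `b` so small that `logLog b ≥ R`, the truncation is at least `R` at `0`; any `a` in `(0,
    -- b)` would do.
    obtain ⟨b, hb0, hb1, hbR⟩ := exists_logLog_ge R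
    have ha : 0 < b / 2 := by positivity
    have hab : b / 2 < b := by linarith
    obtain ⟨u, h1, h2, h3, h4⟩ := h (b / 2) b ha hab
    have h5 := hC u (vecMemHs_of_contDiff hs0 hs hK hKs h1) ⟨0, h2⟩
    rw [lTwoNorm_weakDiv_eq_zero hK h2, add_zero] at h5
    have h6 : ENNReal.ofReal R * lTwoNorm K p ≤ lTwoNorm K (fun x => interp u x l) := by
      have e : ENNReal.ofReal R * lTwoNorm K p = lTwoNorm K (fun x => R * p x) := by
        rw [lTwoNorm, lTwoNorm, ← Real.enorm_of_nonneg hR]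
        exact (eLpNorm_const_smul R p 2 _).symm
      rw [e]
      refine eLpNorm_mono_ae ?_
      filter_upwards [ae_restrict_mem hK.measurableSet] with x hx
      have h7 : R * p x ≤ interp u x l := (mul_le_mul_of_nonneg_right
        (hbR.trans (logLog_le_truncLogLog_zero ha hab hb1)) (hp x hx).le).trans (h4 x hx)
      rw [Real.norm_of_nonneg (mul_nonneg hR (hp x hx).le)]
      exact h7.trans (le_abs_self _)
    refine h6.trans (h5.trans ?_)
    rw [hB]
    gcongr
    refine (le_one_add_sq _).trans ?_
    gcongr
    refine (hsNorm_le_hsNorm_half hs0 hs hK hKs _).trans ?_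
    gcongr
  have hlt : lTwoNorm K p ≠ ⊤ := by
    intro hT
    have := key 1 zero_le_one
    rw [hT, ENNReal.ofReal_one, one_mul, top_le_iff] at this
    exact hBt this
  obtain ⟨n, hn⟩ := ENNReal.exists_nat_mul_gt hp0 hBt
  have := key n (Nat.cast_nonneg n)
  rw [ENNReal.ofReal_natCast] at this
  exact absurd hn (not_lt.2 this)

theorem nonempty_refTriangle : refTriangle.Nonempty :=
  ⟨!₂[1 / 2, 1 / 4], by norm_num [refTriangle]⟩

theorem refTriangle_subset : refTriangle ⊆ refSquare := isSliced_refTriangle.subset_refSquare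

section

variable {a b : ℝ}

theorem hasBoundedDeriv_fieldZero (ha : 0 < a) (hab : a < b) :
    HasBoundedDeriv (fun t => truncLogLog a b (1 - t)) (deriv fun t => truncLogLog a b (1 - t)) :=
  hasBoundedDeriv_of_contDiff (((contDiff_truncLogLog ha hab).comp
    (contDiff_const.sub contDiff_id)).of_le (by exact_mod_cast le_top))

theorem hasBoundedDeriv_truncLogLog (ha : 0 < a) (hab : a < b) :
    HasBoundedDeriv (truncLogLog a b) (deriv (truncLogLog a b)) :=
  hasBoundedDeriv_of_contDiff ((contDiff_truncLogLog ha hab).of_le (by exact_mod_cast le_top))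

theorem hasBoundedDeriv_id : HasBoundedDeriv id (deriv id) :=
  hasBoundedDeriv_of_contDiff contDiff_id

theorem hasBoundedDeriv_one_sub : HasBoundedDeriv (fun t => 1 - t) (deriv fun t => 1 - t) :=
  hasBoundedDeriv_of_contDiff (contDiff_const.sub contDiff_id)

theorem contDiff_fieldZero (ha : 0 < a) (hab : a < b) (i : Fin 2) :
    ContDiff ℝ 1 fun x => fieldZero (truncLogLog a b) x i :=
  contDiff_curlProd ((contDiff_truncLogLog ha hab).comp (contDiff_const.sub contDiff_id))
    contDiff_id i

theorem contDiff_fieldOne (ha : 0 < a) (hab : a < b) (i : Fin 2) :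
    ContDiff ℝ 1 fun x => fieldOne (truncLogLog a b) x i :=
  contDiff_curlProd (contDiff_const.sub contDiff_id) (contDiff_truncLogLog ha hab) i

theorem hsNorm_fieldZero_le (ha : 0 < a) (hab : a < b) {K : Set Plane} (hK : K ⊆ refSquare) :
    hsNorm (1 / 2) K (fun x => fieldZero (truncLogLog a b) x 0) ^ 2 ≤
      32 + ENNReal.ofReal Real.pi * 64 := by
  simpa [fieldZero_apply] using (isLogLogDominated_truncLogLog ha hab).hsNorm_half_one_sub_sq_le
    (contDiff_truncLogLog ha hab).continuous.measurable hK 0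

theorem hsNorm_fieldOne_le (ha : 0 < a) (hab : a < b) {K : Set Plane} (hK : K ⊆ refSquare) :
    hsNorm (1 / 2) K (fun x => fieldOne (truncLogLog a b) x 1) ^ 2 ≤
      32 + ENNReal.ofReal Real.pi * 64 := by
  simpa [fieldOne_apply] using (isLogLogDominated_truncLogLog ha hab).hsNorm_half_sq_le
    (contDiff_truncLogLog ha hab).continuous.measurable hK 1

end

/-- The stream functions `x₂ F(1 - x₁)` and `(1 - x₁) F(x₂)` have the value `F 0` at one vertex,
`(1, 1)` and `(0, 0)` respectively, and vanish at the other two. The interpolants are the constants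
`(F 0, 0)` and `(0, F 0)`. -/
theorem not_triangle_estimate {s : ℝ} (hs0 : 0 < s) (hs : s ≤ 1 / 2) (l : Fin 2) :
    ¬ ∃ C : ℝ≥0, ∀ u : Plane → Plane, VecMemHs s refTriangle u → MemHdiv refTriangle u →
        lTwoNorm refTriangle (fun x => triInterp u x l) ≤
          C * (hsNorm s refTriangle (fun x => u x l) +
            lTwoNorm refTriangle (weakDiv refTriangle u)) := by
  refine not_estimate isSliced_refTriangle.isOpen refTriangle_subset nonempty_refTriangle _ l hs0 hs
    (p := fun _ => 1) (fun _ _ => one_pos) continuous_const fun a b ha hab => ?_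
  fin_cases l
  · refine ⟨fieldZero (truncLogLog a b), contDiff_fieldZero ha hab,
      hasWeakDiv_refTriangle (hasBoundedDeriv_fieldZero ha hab) hasBoundedDeriv_id fun _ _ => rfl,
      hsNorm_fieldZero_le ha hab refTriangle_subset, fun x hx => ?_⟩
    rw [triInterp_curlProd (u := fieldZero (truncLogLog a b)) (hasBoundedDeriv_fieldZero ha hab)
      hasBoundedDeriv_id fun _ _ => rfl]
    simp
  · refine ⟨fieldOne (truncLogLog a b), contDiff_fieldOne ha hab,
      hasWeakDiv_refTriangle hasBoundedDeriv_one_sub (hasBoundedDeriv_truncLogLog ha hab)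
        fun _ _ => rfl, hsNorm_fieldOne_le ha hab refTriangle_subset, fun x hx => ?_⟩
    rw [triInterp_curlProd (u := fieldOne (truncLogLog a b)) hasBoundedDeriv_one_sub
      (hasBoundedDeriv_truncLogLog ha hab) fun _ _ => rfl]
    simp

/-- At the fourth vertex `(0, 1)` the stream functions have the value `F 1 = 0`. The relevant
components of the interpolants are `F 0 * x₁` and `F 0 * (1 - x₂)`, positive multiples of `F 0` in
the open square. -/
theorem not_square_estimate {s : ℝ} (hs0 : 0 < s) (hs : s ≤ 1 / 2) (l : Fin 2) :
    ¬ ∃ C : ℝ≥0, ∀ u : Plane → Plane, VecMemHs s refSquare u → MemHdiv refSquare u →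
        lTwoNorm refSquare (fun x => sqInterp u x l) ≤
          C * (hsNorm s refSquare (fun x => u x l) +
            lTwoNorm refSquare (weakDiv refSquare u)) := by
  have hne := nonempty_refTriangle.mono refTriangle_subset
  fin_cases l
  · refine not_estimate isSliced_refSquare.isOpen le_rfl hne _ 0 hs0 hs (p := fun x => x 0)
      (fun x hx => hx.1) (by fun_prop) fun a b ha hab => ?_
    refine ⟨fieldZero (truncLogLog a b), contDiff_fieldZero ha hab,
      hasWeakDiv_refSquare (hasBoundedDeriv_fieldZero ha hab) hasBoundedDeriv_id fun _ _ => rfl,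
      hsNorm_fieldZero_le ha hab le_rfl, fun x hx => ?_⟩
    rw [sqInterp_curlProd (u := fieldZero (truncLogLog a b)) (hasBoundedDeriv_fieldZero ha hab)
      hasBoundedDeriv_id fun _ _ => rfl]
    simp [truncLogLog_one]
  · refine not_estimate isSliced_refSquare.isOpen le_rfl hne _ 1 hs0 hs (p := fun x => 1 - x 1)
      (fun x hx => sub_pos.2 hx.2.2.2) (by fun_prop) fun a b ha hab => ?_
    refine ⟨fieldOne (truncLogLog a b), contDiff_fieldOne ha hab,
      hasWeakDiv_refSquare hasBoundedDeriv_one_sub (hasBoundedDeriv_truncLogLog ha hab)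
        fun _ _ => rfl, hsNorm_fieldOne_le ha hab le_rfl, fun x hx => ?_⟩
    rw [sqInterp_curlProd (u := fieldOne (truncLogLog a b)) hasBoundedDeriv_one_sub
      (hasBoundedDeriv_truncLogLog ha hab) fun _ _ => rfl]
    simp [truncLogLog_one]
    linarith

/-! ### The functions `w^ε` -/

/-- The radius below which `w^ε = 1`. -/
def plateau (ε : ℝ) : ℝ := Real.exp (1 - Real.exp (1 / ε))

theorem plateau_pos (ε : ℝ) : 0 < plateau ε := Real.exp_pos _

theorem plateau_lt_one {ε : ℝ} (hε : 0 < ε) : plateau ε < 1 := by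
  rw [plateau, Real.exp_lt_one_iff, sub_neg]
  exact Real.one_lt_exp_iff.2 (by positivity)

theorem mul_logLog_plateau {ε : ℝ} (hε : 0 < ε) : ε * logLog (plateau ε) = 1 := by
  rw [logLog, plateau, Real.log_exp, sub_sub_cancel, Real.log_exp, mul_one_div_cancel hε.ne']

theorem wEps_eq_min (ε : ℝ) {x y r : ℝ} (hr : 0 < r) (h : √(x ^ 2 + y ^ 2) = r) :
    wEps ε x y = min 1 (ε * logLog r) := by
  rw [wEps, h, Real.log_div (Real.exp_pos 1).ne' hr.ne', Real.log_exp, logLog]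

theorem wEps_zero_eq_min (ε : ℝ) {y : ℝ} (hy : 0 < y) : wEps ε y 0 = min 1 (ε * logLog y) :=
  wEps_eq_min ε hy (by rw [zero_pow two_ne_zero, add_zero, Real.sqrt_sq hy.le])

/-- Since `ε logLog` decreases and reaches `1` exactly at `plateau ε`, truncating its values at `1`
amounts to clamping its argument. -/
theorem min_one_eq_clampLogLog {ε r : ℝ} (hε : 0 < ε) (hr : 0 < r) (hr2 : r ≤ 2) :
    min 1 (ε * logLog r) = ε * clampLogLog (plateau ε) r := by
  have h1 := mul_logLog_plateau hε
  rw [clampLogLog, min_eq_left hr2]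
  rcases le_total r (plateau ε) with h | h
  · rw [max_eq_left h, h1, min_eq_left]
    rw [← h1]
    have := logLog_le_logLog hr h (by linarith [plateau_lt_one hε])
    gcongr
  · rw [max_eq_right h, min_eq_right]
    rw [← h1]
    have := logLog_le_logLog (plateau_pos ε) h hr2
    gcongr

theorem wEps_zero_eq_clampLogLog {ε y : ℝ} (hε : 0 < ε) (hy : y ∈ Set.Ioo (0 : ℝ) 1) :
    wEps ε y 0 = ε * clampLogLog (plateau ε) y := by
  rw [wEps_zero_eq_min ε hy.1, min_one_eq_clampLogLog hε hy.1 (by linarith [hy.2])]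

theorem abs_min_one_sub_le (p q : ℝ) : |min 1 p - min 1 q| ≤ |p - q| := by
  have := abs_min_sub_min_le_max 1 p 1 q
  rwa [sub_self, abs_zero, max_eq_right (abs_nonneg _)] at this

/-- Taking the minimum with `1` does not increase distances, so the increments are at most those of
`ε logLog`, and the norms are of order `ε`. -/
theorem isLogLogDominated_wEps {ε : ℝ} (hε : 0 < ε) :
    IsLogLogDominated ε fun y => wEps ε y 0 := by
  refine ⟨fun s hs => ?_, fun s hs t ht => ?_⟩
  · have := logLog_nonneg hs.1 hs.2.le
    rw [wEps_zero_eq_min ε hs.1, abs_of_nonneg (by positivity)]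
    exact min_le_right _ _
  · rw [wEps_zero_eq_min ε hs.1, wEps_zero_eq_min ε ht.1]
    refine (abs_min_one_sub_le _ _).trans (le_of_eq ?_)
    rw [← mul_sub, abs_mul, abs_of_pos hε]

theorem measurable_wEps_zero (ε : ℝ) : Measurable fun y => wEps ε y 0 := by
  unfold wEps
  fun_prop

theorem tendsto_zero_of_sq {α : Type*} {l : Filter α} {f : α → ℝ≥0∞}
    (h : Tendsto (fun x => f x ^ 2) l (𝓝 0)) : Tendsto f l (𝓝 0) := by
  have h1 := ((ENNReal.continuous_rpow_const (y := (1 / 2 : ℝ))).tendsto 0).comp h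
  rw [ENNReal.zero_rpow_of_pos (by norm_num)] at h1
  refine h1.congr fun x => ?_
  simp only [Function.comp]
  rw [← ENNReal.rpow_natCast, ← ENNReal.rpow_mul]
  norm_num

theorem tendsto_ofReal_sq_mul {B : ℝ≥0∞} (hB : B ≠ ⊤) :
    Tendsto (fun ε : ℝ => ENNReal.ofReal (ε ^ 2) * B) (𝓝[>] 0) (𝓝 0) := by
  have h1 : Tendsto (fun ε : ℝ => ENNReal.ofReal (ε ^ 2)) (𝓝[>] 0) (𝓝 0) := by
    have : Continuous fun ε : ℝ => ENNReal.ofReal (ε ^ 2) := ENNReal.continuous_ofReal.comp (by fun_prop)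
    have h2 := (this.tendsto 0).mono_left (nhdsWithin_le_nhds (s := Set.Ioi 0))
    simpa using h2
  simpa using ENNReal.Tendsto.mul_const h1 (Or.inr hB)

theorem tendsto_hsNorm_uEps :
    Tendsto (fun ε : ℝ => hsNorm (1 / 2) refTriangle (fun x => uEps ε x 1)) (𝓝[>] 0) (𝓝 0) := by
  refine tendsto_zero_of_sq (tendsto_of_tendsto_of_tendsto_of_le_of_le' tendsto_const_nhds
    (tendsto_ofReal_sq_mul (B := 32 + ENNReal.ofReal Real.pi * 64) ?_)
    (Eventually.of_forall fun _ => zero_le) ?_)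
  · exact ENNReal.add_ne_top.2 ⟨ENNReal.ofNat_ne_top,
      ENNReal.mul_ne_top ENNReal.ofReal_ne_top ENNReal.ofNat_ne_top⟩
  · filter_upwards [self_mem_nhdsWithin] with ε hε
    exact (isLogLogDominated_wEps hε).hsNorm_half_sq_le (measurable_wEps_zero ε)
      refTriangle_subset 1

/-! ### Divergence and interpolant of `u^ε` -/

theorem differentiableAt_clampLogLog {a y : ℝ} (ha : 0 < a) (hy2 : y < 2) (hne : y ≠ a) :
    DifferentiableAt ℝ (clampLogLog a) y := by
  rcases hne.lt_or_gt with h | h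
  · refine (differentiableAt_const (logLog a)).congr_of_eventuallyEq ?_
    filter_upwards [gt_mem_nhds h] with z hz
    rw [clampLogLog, max_eq_left (min_le_iff.2 (Or.inl hz.le))]
  · refine (hasDerivAt_logLog (ha.trans h) hy2.le).differentiableAt.congr_of_eventuallyEq ?_
    filter_upwards [lt_mem_nhds h, gt_mem_nhds hy2] with z hz hz2
    rw [clampLogLog, min_eq_left hz2.le, max_eq_right hz.le]

/-- The clamped function is the representative of `w^ε(·, 0)` that is continuous up to `0`: by the
conventions for division and logarithm at `0`, `wEps ε 0 0 = 0`, although the limit is `1`. The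
exceptional set consists of the kink at `plateau ε`. -/
theorem hasBoundedDeriv_wEps {ε : ℝ} (hε : 0 < ε) :
    HasBoundedDeriv (fun y => ε * clampLogLog (plateau ε) y) (deriv fun y => wEps ε y 0) := by
  have hL := lipschitzWith_clampLogLog (plateau_pos ε) (by linarith [plateau_lt_one hε])
  have hd : ∀ y ∈ Set.Ioo (0 : ℝ) 1, deriv (fun y => wEps ε y 0) y =
      ε * deriv (clampLogLog (plateau ε)) y := fun y hy => by
    rw [← deriv_const_mul_field]
    refine Filter.EventuallyEq.deriv_eq ?_
    filter_upwards [Ioo_mem_nhds hy.1 hy.2] with z hz using wEps_zero_eq_clampLogLog hε hz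
  refine ⟨(continuous_const.mul hL.continuous).continuousOn, ⟨{plateau ε}, Set.countable_singleton _,
    fun y hy => ?_⟩, measurable_deriv _, ε * logLogSlope (plateau ε), fun y hy => ?_⟩
  · rw [hd y hy.1]
    exact (differentiableAt_clampLogLog (plateau_pos ε) (by linarith [hy.1.2])
      hy.2).hasDerivAt.const_mul ε
  · rw [hd y hy, abs_mul, abs_of_pos hε]
    have := norm_deriv_le_of_lipschitz (x₀ := y) hL
    rw [Real.coe_toNNReal _ (logLogSlope_nonneg (plateau_pos ε)), Real.norm_eq_abs] at this
    gcongr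

theorem deriv_one_sub_id (t : ℝ) : deriv (fun t : ℝ => 1 - t) t = -1 := by
  simp

theorem uEps_eq_curlProd {ε : ℝ} (hε : 0 < ε) : ∀ x ∈ refTriangle, uEps ε x =
    curlProd (fun t => 1 - t) (deriv fun t => 1 - t) (fun y => ε * clampLogLog (plateau ε) y)
      (deriv fun y => wEps ε y 0) x := fun x hx => by
  have h := refTriangle_subset hx
  simp only [uEps, curlField, curlProd, deriv_one_sub_id]
  rw [wEps_zero_eq_clampLogLog hε ⟨h.2.2.1, h.2.2.2⟩]
  simp

theorem hasWeakDiv_uEps {ε : ℝ} (hε : 0 < ε) : HasWeakDiv refTriangle (uEps ε) 0 :=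
  hasWeakDiv_refTriangle hasBoundedDeriv_one_sub (hasBoundedDeriv_wEps hε) (uEps_eq_curlProd hε)

theorem triInterp_uEps {ε : ℝ} (hε : 0 < ε) : triInterp (uEps ε) = fun _ => !₂[0, 1] := by
  rw [triInterp_curlProd hasBoundedDeriv_one_sub (hasBoundedDeriv_wEps hε) (uEps_eq_curlProd hε)]
  have h : clampLogLog (plateau ε) 0 = logLog (plateau ε) := by
    rw [clampLogLog, max_eq_left (min_le_iff.2 (Or.inl (plateau_pos ε).le))]
  simp [h, mul_logLog_plateau hε]

/-! ### Fields `((1 - x₁) w'(x₂), w(x₂))` with smooth `w` -/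

theorem curlField_eq_curlProd (w : ℝ → ℝ) (x : Plane) :
    curlField w x = curlProd (fun t => 1 - t) (deriv fun t => 1 - t) w (deriv w) x := by
  simp [curlField, curlProd]

theorem hasWeakDiv_curlField {w : ℝ → ℝ} (hw : ContDiff ℝ ∞ w) :
    HasWeakDiv refTriangle (curlField w) 0 :=
  hasWeakDiv_refTriangle hasBoundedDeriv_one_sub
    (hasBoundedDeriv_of_contDiff (hw.of_le (by exact_mod_cast le_top)))
    fun x _ => curlField_eq_curlProd w x

/-- Only `w 0` enters, so approximations of `w^ε(·, 0)` with the value `1` at `0` already have the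
right interpolant. -/
theorem triInterp_curlField {w : ℝ → ℝ} (hw : ContDiff ℝ ∞ w) :
    triInterp (curlField w) = fun _ => !₂[0, w 0] := by
  rw [triInterp_curlProd hasBoundedDeriv_one_sub
    (hasBoundedDeriv_of_contDiff (hw.of_le (by exact_mod_cast le_top)))
    fun x _ => curlField_eq_curlProd w x]
  simp

theorem vecMemHs_curlField {w : ℝ → ℝ} (hw : ContDiff ℝ ∞ w) :
    VecMemHs (1 / 2) refTriangle (curlField w) := by
  refine vecMemHs_of_contDiff (by norm_num) le_rfl isSliced_refTriangle.isOpen refTriangle_subset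
    fun i => ?_
  simp only [curlField_eq_curlProd]
  exact contDiff_curlProd (contDiff_const.sub contDiff_id) hw i

/-! ### Smooth approximations of `w^ε` -/

/-- A smooth function which agrees with `w^ε(·, 0)` up to the end of the plateau, and with
`w^ε(·, 0)` up to a constant beyond `b`. -/
def smoothApprox (ε b y : ℝ) : ℝ :=
  1 - ε * (truncLogLog (plateau ε) b 0 - truncLogLog (plateau ε) b y)

section

variable {ε b : ℝ}

theorem contDiff_smoothApprox (hb : plateau ε < b) : ContDiff ℝ ∞ (smoothApprox ε b) :=
  contDiff_const.sub (contDiff_const.mul (contDiff_const.sub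
    (contDiff_truncLogLog (plateau_pos ε) hb)))

theorem smoothApprox_zero : smoothApprox ε b 0 = 1 := by simp [smoothApprox]

theorem smoothApprox_sub_eq_zero (hε : 0 < ε) (hb : plateau ε < b) {y : ℝ}
    (hy : y ≤ plateau ε) : smoothApprox ε b y - ε * clampLogLog (plateau ε) y = 0 := by
  rw [smoothApprox, clampLogLog, max_eq_left (min_le_iff.2 (Or.inl hy)), mul_logLog_plateau hε,
    truncLogLog_eq_of_le (plateau_pos ε) hb hy,
    truncLogLog_eq_of_le (plateau_pos ε) hb (plateau_pos ε).le]
  ring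

theorem smoothApprox_sub_eq (hε : 0 < ε) (hb : plateau ε < b) {y : ℝ} (hy : plateau ε ≤ y)
    (hy1 : y ≤ 1) : smoothApprox ε b y - ε * clampLogLog (plateau ε) y =
      ε * ((logLog (plateau ε) - logLog y) -
        (truncLogLog (plateau ε) b (plateau ε) - truncLogLog (plateau ε) b y)) := by
  rw [smoothApprox, clampLogLog, min_eq_left (by linarith), max_eq_right hy,
    truncLogLog_eq_of_le (plateau_pos ε) hb (plateau_pos ε).le]
  linear_combination -mul_logLog_plateau hε

theorem smoothApprox_sub_eq_const (hε : 0 < ε) (hb : plateau ε < b) {y : ℝ} (hy : b ≤ y)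
    (hy1 : y ≤ 1) : smoothApprox ε b y - ε * clampLogLog (plateau ε) y =
      ε * (logLog (plateau ε) - truncLogLog (plateau ε) b (plateau ε)) := by
  rw [smoothApprox_sub_eq hε hb (hb.le.trans hy) hy1,
    truncLogLog_eq_logLog (plateau_pos ε) hb hy hy1]
  ring

/-- The difference vanishes on the plateau. Beyond it, it is `ε` times the drop of `logLog` since
`plateau ε` minus the drop of the truncation, hence nonnegative. Up to `b` the drop of `logLog`
alone gives the bound; after `b` the difference is constant, and the truncation at `plateau ε` is at
least `logLog b`. -/
theorem abs_smoothApprox_sub_le (hε : 0 < ε) (hb : plateau ε < b) (hb1 : b ≤ 1) {y : ℝ}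
    (hy1 : y ≤ 1) : |smoothApprox ε b y - ε * clampLogLog (plateau ε) y| ≤
      ε * (logLog (plateau ε) - logLog b) := by
  have ha := plateau_pos ε
  have h0 := logLog_le_logLog ha hb.le (by linarith)
  rcases le_total y (plateau ε) with h | h
  · rw [smoothApprox_sub_eq_zero hε hb h, abs_zero]
    exact mul_nonneg hε.le (sub_nonneg.2 h0)
  · have h1 := truncLogLog_sub_le ha hb ha h hy1
    rw [smoothApprox_sub_eq hε hb h hy1, abs_mul, abs_of_pos hε, abs_of_nonneg (sub_nonneg.2 h1)]
    refine mul_le_mul_of_nonneg_left ?_ hε.le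
    have h2 := antitone_truncLogLog ha hb h
    rcases le_total y b with h' | h'
    · have := logLog_le_logLog (ha.trans_le h) h' (by linarith)
      linarith
    · rw [truncLogLog_eq_logLog ha hb h' hy1]
      have := logLog_le_truncLogLog_zero ha hb hb1
      rw [truncLogLog_eq_of_le ha hb ha.le] at this
      linarith

theorem lipschitzWith_smoothApprox_sub (hε : 0 < ε) (hb : plateau ε < b) :
    LipschitzWith (2 * ε * logLogSlope (plateau ε)).toNNReal
      (fun y => smoothApprox ε b y - ε * clampLogLog (plateau ε) y) := by
  have ha := plateau_pos ε
  have h1 := lipschitzWith_truncLogLog ha hb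
  have h2 := lipschitzWith_clampLogLog ha (by linarith [plateau_lt_one hε])
  have hs := logLogSlope_nonneg ha
  refine LipschitzWith.of_dist_le_mul fun x y => ?_
  have h3 := h1.dist_le_mul x y
  have h4 := h2.dist_le_mul x y
  rw [Real.coe_toNNReal _ hs, Real.dist_eq, Real.dist_eq] at h3 h4
  rw [Real.coe_toNNReal _ (by positivity), Real.dist_eq, Real.dist_eq]
  calc _ = |ε * (truncLogLog (plateau ε) b x - truncLogLog (plateau ε) b y) -
        ε * (clampLogLog (plateau ε) x - clampLogLog (plateau ε) y)| := by
        congr 1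
        simp only [smoothApprox]
        ring
    _ ≤ ε * |truncLogLog (plateau ε) b x - truncLogLog (plateau ε) b y| +
        ε * |clampLogLog (plateau ε) x - clampLogLog (plateau ε) y| := by
        refine (abs_sub _ _).trans (le_of_eq ?_)
        rw [abs_mul, abs_mul, abs_of_pos hε]
    _ ≤ ε * (logLogSlope (plateau ε) * |x - y|) + ε * (logLogSlope (plateau ε) * |x - y|) := by
        gcongr
    _ = _ := by ring

/-- The difference is locally constant outside `[plateau ε, b]`. Inside, the Lipschitz constant does
not depend on `b`, so the `L²` norm of the gradient tends to zero with the length of the interval.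
-/
theorem norm_gradient_smoothApprox_sub_le (hε : 0 < ε) (hb : plateau ε < b) {y : ℝ} (hy : y < 1) :
    ‖gradient (fun y => smoothApprox ε b y - ε * clampLogLog (plateau ε) y) y‖ ≤
      ‖(Set.Icc (plateau ε) b).indicator
        (fun _ => 2 * ε * logLogSlope (plateau ε)) y‖ := by
  have hs := logLogSlope_nonneg (plateau_pos ε)
  rw [norm_gradient]
  by_cases hm : y ∈ Set.Icc (plateau ε) b
  · rw [Set.indicator_of_mem hm, Real.norm_of_nonneg (by positivity)]
    refine (norm_fderiv_le_of_lipschitz ℝ (lipschitzWith_smoothApprox_sub hε hb)).trans_eq ?_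
    rw [Real.coe_toNNReal _ (by positivity)]
  · rw [Set.indicator_of_notMem hm, norm_zero, norm_le_zero_iff]
    rw [Set.mem_Icc, not_and_or, not_le, not_le] at hm
    rcases hm with h | h
    · rw [Filter.EventuallyEq.fderiv_eq (f := fun _ => (0 : ℝ)), fderiv_fun_const, Pi.zero_apply]
      filter_upwards [gt_mem_nhds h] with z hz using smoothApprox_sub_eq_zero hε hb hz.le
    · rw [Filter.EventuallyEq.fderiv_eq (f := fun _ => ε * (logLog (plateau ε) -
        truncLogLog (plateau ε) b (plateau ε))), fderiv_fun_const, Pi.zero_apply]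
      filter_upwards [lt_mem_nhds h, gt_mem_nhds hy] with z hz hz1 using
        smoothApprox_sub_eq_const hε hb hz.le hz1.le

theorem hOneNorm_smoothApprox_sub_le (hε : 0 < ε) (hb : plateau ε < b) (hb1 : b ≤ 1) :
    hOneNorm (Set.Ioo (0 : ℝ) 1) (fun y => smoothApprox ε b y - wEps ε y 0) ≤
      (ENNReal.ofReal (ε * (logLog (plateau ε) - logLog b)) ^ 2 +
        (ENNReal.ofReal (2 * ε * logLogSlope (plateau ε)) *
          ENNReal.ofReal (b - plateau ε) ^ (1 / 2 : ℝ)) ^ 2) ^ (1 / 2 : ℝ) := by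
  have ae := ae_restrict_mem (μ := (volume : Measure ℝ)) (measurableSet_Ioo (a := (0 : ℝ)) (b := 1))
  have hs := logLogSlope_nonneg (plateau_pos ε)
  refine (hOneNorm_le (hasWeakGradient_of_lipschitzWith isOpen_Ioo (Metric.isBounded_Ioo 0 1)
    (lipschitzWith_smoothApprox_sub hε hb) fun y hy => by
      rw [wEps_zero_eq_clampLogLog hε hy])).trans ?_
  gcongr
  · refine (eLpNorm_le_of_ae_bound (C := ε * (logLog (plateau ε) - logLog b)) ?_).trans ?_
    · filter_upwards [ae] with y hy
      rw [wEps_zero_eq_clampLogLog hε hy]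
      exact abs_smoothApprox_sub_le hε hb hb1 hy.2.le
    · simp
  · refine (eLpNorm_mono_ae (ae.mono fun y hy =>
      norm_gradient_smoothApprox_sub_le hε hb hy.2)).trans ?_
    rw [eLpNorm_indicator_const measurableSet_Icc two_ne_zero ENNReal.ofNat_ne_top,
      Real.enorm_of_nonneg (by positivity), ENNReal.toReal_ofNat]
    gcongr
    refine (Measure.restrict_apply_le _ _).trans (le_of_eq ?_)
    rw [Real.volume_Icc]

end

/-- The end points `b` of the smooth approximations. -/
def approxEnd (ε : ℝ) (n : ℕ) : ℝ := plateau ε + (1 - plateau ε) / (n + 1)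

theorem plateau_lt_approxEnd {ε : ℝ} (hε : 0 < ε) (n : ℕ) : plateau ε < approxEnd ε n := by
  have := plateau_lt_one hε
  have h : 0 < (1 - plateau ε) / (n + 1) := div_pos (by linarith) (by positivity)
  unfold approxEnd
  linarith

theorem approxEnd_le_one {ε : ℝ} (hε : 0 < ε) (n : ℕ) : approxEnd ε n ≤ 1 := by
  have h0 := plateau_lt_one hε
  have h : (1 - plateau ε) / (n + 1) ≤ 1 - plateau ε :=
    div_le_self (by linarith) (by linarith [Nat.cast_nonneg (α := ℝ) n])
  unfold approxEnd
  linarith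

theorem tendsto_approxEnd (ε : ℝ) : Tendsto (approxEnd ε) atTop (𝓝 (plateau ε)) := by
  have h := (tendsto_one_div_add_atTop_nhds_zero_nat (𝕜 := ℝ)).const_mul (1 - plateau ε)
  have h' := h.const_add (plateau ε)
  rw [mul_zero, add_zero] at h'
  refine h'.congr fun n => ?_
  rw [approxEnd, mul_one_div]

theorem tendsto_hOneNorm_smoothApprox {ε : ℝ} (hε : 0 < ε) :
    Tendsto (fun n => hOneNorm (Set.Ioo (0 : ℝ) 1)
      (fun y => smoothApprox ε (approxEnd ε n) y - wEps ε y 0)) atTop (𝓝 0) := by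
  have hb := tendsto_approxEnd ε
  have h1 : Tendsto (fun n => ENNReal.ofReal (ε * (logLog (plateau ε) - logLog (approxEnd ε n))))
      atTop (𝓝 0) := by
    have hc := (hasDerivAt_logLog (plateau_pos ε)
      (by linarith [plateau_lt_one hε])).continuousAt.tendsto.comp hb
    have := ENNReal.tendsto_ofReal ((hc.const_sub (logLog (plateau ε))).const_mul ε)
    simpa using this
  have h2 : Tendsto (fun n => ENNReal.ofReal (approxEnd ε n - plateau ε)) atTop (𝓝 0) := by
    simpa using ENNReal.tendsto_ofReal (hb.sub_const (plateau ε))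
  have h3 : Tendsto (fun n => ENNReal.ofReal (2 * ε * logLogSlope (plateau ε)) *
      ENNReal.ofReal (approxEnd ε n - plateau ε) ^ (1 / 2 : ℝ)) atTop (𝓝 0) := by
    have := ENNReal.Tendsto.const_mul (a := ENNReal.ofReal (2 * ε * logLogSlope (plateau ε)))
      (((ENNReal.continuous_rpow_const (y := (1 / 2 : ℝ))).tendsto 0).comp h2)
      (Or.inr ENNReal.ofReal_ne_top)
    rwa [ENNReal.zero_rpow_of_pos (by norm_num), mul_zero] at this
  have h4 := ((ENNReal.continuous_rpow_const (y := (1 / 2 : ℝ))).tendsto _).comp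
    ((ENNReal.Tendsto.pow (n := 2) h1).add (ENNReal.Tendsto.pow (n := 2) h3))
  rw [zero_pow two_ne_zero, add_zero, ENNReal.zero_rpow_of_pos (by norm_num)] at h4
  exact tendsto_of_tendsto_of_tendsto_of_le_of_le tendsto_const_nhds h4 (fun _ => zero_le)
    fun n => hOneNorm_smoothApprox_sub_le hε (plateau_lt_approxEnd hε n) (approxEnd_le_one hε n)

/-! ### The `H¹` norm of `w^ε` on the prism -/

/-- Splitting off the first coordinate of space. -/
def spaceProd (x : EuclideanSpace ℝ (Fin 3)) : ℝ × Plane := (x 0, !₂[x 1, x 2])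

theorem measurePreserving_spaceProd : MeasurePreserving spaceProd volume volume := by
  have h1 := EuclideanSpace.volume_preserving_symm_measurableEquiv_toLp (Fin 3)
  have h2 := volume_preserving_piFinSuccAbove (fun _ : Fin 3 => ℝ) 0
  have h3 : MeasurePreserving (Prod.map id (MeasurableEquiv.toLp 2 (Fin 2 → ℝ)) :
      ℝ × (Fin 2 → ℝ) → ℝ × Plane) volume volume :=
    (MeasurePreserving.id volume).prod
      (EuclideanSpace.volume_preserving_symm_measurableEquiv_toLp (Fin 2)).symm
  have h4 := h3.comp (h2.comp h1)
  have e : spaceProd = Prod.map id (MeasurableEquiv.toLp 2 (Fin 2 → ℝ)) ∘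
      (MeasurableEquiv.piFinSuccAbove (fun _ : Fin 3 => ℝ) 0) ∘
      (MeasurableEquiv.toLp 2 (Fin 3 → ℝ)).symm := by
    funext x
    refine Prod.ext rfl ?_
    ext i
    fin_cases i <;> rfl
  rw [e]
  exact h4

/-- The prism is enlarged to the unit cube, where the first coordinate integrates out. -/
theorem lintegral_refPrism_le {k : Plane → ℝ≥0∞} (hk : Measurable k) :
    ∫⁻ x in refPrism, k !₂[x 1, x 2] ≤ ∫⁻ p in refSquare, k p := by
  have hsub : refPrism ⊆ spaceProd ⁻¹' (Set.Ioo 0 1 ×ˢ refSquare) := fun x hx => by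
    obtain ⟨h1, h2, h3, h4, h5, h6⟩ := hx
    exact ⟨⟨h1, h2⟩, h3, h4.trans h2, h5, h6⟩
  have hQ : MeasurableSet refSquare := isSliced_refSquare.isOpen.measurableSet
  calc ∫⁻ x in refPrism, k !₂[x 1, x 2]
      ≤ ∫⁻ x in spaceProd ⁻¹' (Set.Ioo 0 1 ×ˢ refSquare), k (spaceProd x).2 :=
        lintegral_mono_set hsub
    _ = ∫⁻ z in Set.Ioo 0 1 ×ˢ refSquare, k z.2 :=
        measurePreserving_spaceProd.setLIntegral_comp_preimage (measurableSet_Ioo.prod hQ)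
          (hk.comp measurable_snd)
    _ = ∫⁻ p in refSquare, k p := by
        have hm : Measurable fun z : ℝ × Plane => k z.2 := by fun_prop
        rw [Measure.volume_eq_prod, ← Measure.prod_restrict, lintegral_prod _ hm.aemeasurable]
        simp

theorem eLpNorm_two_sq_le {α E : Type*} [MeasurableSpace α] {μ : Measure α} [NormedAddCommGroup E]
    {f : α → E} {k : α → ℝ≥0∞} (h : ∀ᵐ x ∂μ, ENNReal.ofReal (‖f x‖ ^ 2) ≤ k x) :
    eLpNorm f 2 μ ^ 2 ≤ ∫⁻ x, k x ∂μ := by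
  have e : eLpNorm f 2 μ ^ 2 = ∫⁻ x, ‖f x‖ₑ ^ 2 ∂μ := by
    simpa using eLpNorm_nnreal_pow_eq_lintegral (f := f) (μ := μ) (p := 2) two_ne_zero
  rw [e]
  refine lintegral_mono_ae (h.mono fun x hx => le_trans (le_of_eq ?_) hx)
  rw [← ofReal_norm, ENNReal.ofReal_pow (norm_nonneg _)]

/-- The distance to the first axis. -/
def axisDist (x : EuclideanSpace ℝ (Fin 3)) : ℝ := √(x 1 ^ 2 + x 2 ^ 2)

theorem axisDist_eq_norm (x : EuclideanSpace ℝ (Fin 3)) : axisDist x = ‖(!₂[x 1, x 2] : Plane)‖ := by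
  rw [EuclideanSpace.norm_eq, Fin.sum_univ_two]
  simp [axisDist]

theorem lipschitzWith_axisDist : LipschitzWith 1 axisDist := by
  refine LipschitzWith.of_dist_le_mul fun x y => ?_
  rw [axisDist_eq_norm, axisDist_eq_norm, Real.dist_eq, NNReal.coe_one, one_mul]
  refine (abs_norm_sub_norm_le _ _).trans ?_
  rw [EuclideanSpace.norm_eq, EuclideanSpace.dist_eq, Fin.sum_univ_two, Fin.sum_univ_three]
  refine Real.sqrt_le_sqrt ?_
  simp [Real.dist_eq, sq_nonneg]

/-- The distance to the axis is comparable to the maximum of the two coordinates; `1.5` stands for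
`√2`. The maximum is easier to integrate over the square. -/
theorem axisDist_mem {x : EuclideanSpace ℝ (Fin 3)} (hx : x ∈ refPrism) :
    x 1 ≤ axisDist x ∧ x 2 ≤ axisDist x ∧ axisDist x < 2 ∧
      axisDist x ≤ 1.5 * max (x 1) (x 2) := by
  obtain ⟨h1, h2, h3, h4, h5, h6⟩ := hx
  have hm1 := le_max_left (x 1) (x 2)
  have hm2 := le_max_right (x 1) (x 2)
  refine ⟨Real.le_sqrt_of_sq_le (by nlinarith), Real.le_sqrt_of_sq_le (by nlinarith), ?_, ?_⟩
  · rw [axisDist, Real.sqrt_lt' two_pos]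
    nlinarith
  · refine Real.sqrt_le_iff.2 ⟨by linarith, ?_⟩
    nlinarith

/-- The Lipschitz function on space that agrees with `w^ε` in the prism. -/
def spaceW (ε : ℝ) (x : EuclideanSpace ℝ (Fin 3)) : ℝ := ε * clampLogLog (plateau ε) (axisDist x)

theorem lipschitzWith_spaceW {ε : ℝ} (hε : 0 < ε) :
    LipschitzWith (ε * logLogSlope (plateau ε)).toNNReal (spaceW ε) := by
  have h := (lipschitzWith_clampLogLog (plateau_pos ε) (by linarith [plateau_lt_one hε])).comp
    lipschitzWith_axisDist
  have hs := logLogSlope_nonneg (plateau_pos ε)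
  refine LipschitzWith.of_dist_le_mul fun x y => ?_
  have := h.dist_le_mul x y
  rw [mul_one, Real.coe_toNNReal _ hs, Real.dist_eq] at this
  rw [Real.coe_toNNReal _ (by positivity), Real.dist_eq, spaceW, spaceW, ← mul_sub, abs_mul,
    abs_of_pos hε, mul_assoc]
  exact mul_le_mul_of_nonneg_left this hε.le

theorem spaceW_eq_min {ε : ℝ} (hε : 0 < ε) {x : EuclideanSpace ℝ (Fin 3)} (h0 : 0 < axisDist x)
    (h2 : axisDist x ≤ 2) : spaceW ε x = min 1 (ε * logLog (axisDist x)) :=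
  (min_one_eq_clampLogLog hε h0 h2).symm

theorem wEps_eq_spaceW {ε : ℝ} (hε : 0 < ε) {x : EuclideanSpace ℝ (Fin 3)} (hx : x ∈ refPrism) :
    wEps ε (x 1) (x 2) = spaceW ε x := by
  have h := axisDist_mem hx
  have h0 := hx.2.2.1.trans_le h.1
  rw [wEps_eq_min ε h0 rfl, spaceW_eq_min hε h0 h.2.2.1.le]

/-- A pointwise Lipschitz bound is used in place of the chain rule, so the kink of the minimum does
no harm. The factor `2` allows for the remainder in the first order expansion of `logLog`, which is
at most `c |t - r|` near `r`. -/
theorem norm_gradient_spaceW_le {ε : ℝ} (hε : 0 < ε) {x : EuclideanSpace ℝ (Fin 3)}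
    (h0 : 0 < axisDist x) (h2 : axisDist x < 2) :
    ‖gradient (spaceW ε) x‖ ≤ 2 * ε * (1 / (axisDist x * (1 - Real.log (axisDist x)))) := by
  have hl := one_sub_log_pos h0 h2.le
  set c := 1 / (axisDist x * (1 - Real.log (axisDist x)))
  have hc : 0 < c := by positivity
  rw [norm_gradient]
  refine norm_fderiv_le_of_lip' ℝ (by positivity) ?_
  have hev : ∀ᶠ t in 𝓝 (axisDist x),
      |logLog t - logLog (axisDist x)| ≤ 2 * c * |t - axisDist x| := by
    have h3 := (hasDerivAt_iff_isLittleO.1 (hasDerivAt_logLog h0 h2.le)).def hc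
    filter_upwards [h3] with t ht
    simp only [Real.norm_eq_abs, smul_eq_mul] at ht
    have h4 := abs_add_le (logLog t - logLog (axisDist x) - (t - axisDist x) * -c)
      ((t - axisDist x) * -c)
    rw [sub_add_cancel, abs_mul (t - axisDist x), abs_neg, abs_of_pos hc] at h4
    linarith
  have hcont := lipschitzWith_axisDist.continuous.continuousAt (x := x)
  filter_upwards [hcont.eventually hev, hcont.eventually (Ioo_mem_nhds h0 h2)] with y hy hy'
  rw [spaceW_eq_min hε h0 h2.le, spaceW_eq_min hε hy'.1 hy'.2.le, Real.norm_eq_abs]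
  have h5 := lipschitzWith_axisDist.dist_le_mul y x
  rw [Real.dist_eq, NNReal.coe_one, one_mul, dist_eq_norm] at h5
  calc _ ≤ |ε * logLog (axisDist y) - ε * logLog (axisDist x)| := abs_min_one_sub_le _ _
    _ = ε * |logLog (axisDist y) - logLog (axisDist x)| := by
        rw [← mul_sub, abs_mul, abs_of_pos hε]
    _ ≤ ε * (2 * c * ‖y - x‖) := by
        refine mul_le_mul_of_nonneg_left (hy.trans ?_) hε.le
        gcongr
    _ = _ := by ring

/-- `log 1.5 ≤ 1 / 2`, so `1 - log r ≥ 1 / 2 - log m ≥ (1 - log m) / 2`, as `log m < 0`. -/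
theorem half_mul_log_le {m r : ℝ} (hm : 0 < m) (hm1 : m < 1) (hmr : m ≤ r) (hr : r ≤ 1.5 * m) :
    1 / (r * (1 - Real.log r)) ≤ 2 * (1 / (m * (1 - Real.log m))) := by
  have hlm := Real.log_neg hm hm1
  have h1 : Real.log r ≤ Real.log m + 1 / 2 := by
    have h2 := Real.log_le_log (hm.trans_le hmr) hr
    rw [Real.log_mul (by norm_num) hm.ne'] at h2
    have h3 := Real.log_le_sub_one_of_pos (show (0 : ℝ) < 1.5 by norm_num)
    linarith
  have h0 : 0 < m * (1 - Real.log m) / 2 := div_pos (mul_pos hm (by linarith)) two_pos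
  have h5 : 2 * (1 / (m * (1 - Real.log m))) = 1 / (m * (1 - Real.log m) / 2) := by
    rw [one_div_div, mul_one_div]
  rw [h5]
  refine one_div_le_one_div_of_le h0 ?_
  have h4 : (1 - Real.log m) / 2 ≤ 1 - Real.log r := by linarith
  calc m * (1 - Real.log m) / 2 = m * ((1 - Real.log m) / 2) := by ring
    _ ≤ r * (1 - Real.log r) := mul_le_mul hmr h4 (by linarith) (by linarith)

/-- A majorant of `|∇ log log (e / r)|²` in the square. -/
def slopeMajorant (p : Plane) : ℝ≥0∞ :=
  ENNReal.ofReal (1 / (max (p 0) (p 1) * (1 - Real.log (max (p 0) (p 1)))) ^ 2)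

theorem measurable_slopeMajorant : Measurable slopeMajorant := by
  unfold slopeMajorant
  fun_prop

theorem lintegral_slopeMajorant_le : ∫⁻ p in refSquare, slopeMajorant p ≤ 2 := by
  -- Where the coordinate `t = p i` is the larger one, the other ranges over an interval of length
  -- `t`. This cancels one power of `t` and leaves `1 / (t (1 - log t)²)`, with integral `1`.
  have half : ∀ i : Fin 2, ∫⁻ p in refSquare, {p : Plane | p i.rev ≤ p i}.indicator
      (fun p => ENNReal.ofReal (1 / (p i * (1 - Real.log (p i))) ^ 2)) p = 1 := fun i => by
    have hs : MeasurableSet {p : Plane | p i.rev ≤ p i} :=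
      measurableSet_le (by fun_prop) (by fun_prop)
    rw [lintegral_refSquare i (Measurable.indicator (by fun_prop) hs),
      ← lintegral_one_div_mul_log_sq]
    refine setLIntegral_congr_fun measurableSet_Ioo fun t ht => ?_
    have e : ∀ r : ℝ, {p : Plane | p i.rev ≤ p i}.indicator
        (fun p => ENNReal.ofReal (1 / (p i * (1 - Real.log (p i))) ^ 2)) (planeMk i t r) =
        (Set.Iic t).indicator (fun _ => ENNReal.ofReal (1 / (t * (1 - Real.log t)) ^ 2)) r :=
      fun r => by
        simp only [Set.indicator, Set.mem_ofPred_eq, planeMk_apply_self, planeMk_apply_rev,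
          Set.mem_Iic]
    simp only [e]
    rw [lintegral_indicator_const measurableSet_Iic, Measure.restrict_apply measurableSet_Iic,
      show Set.Iic t ∩ Set.Ioo (0 : ℝ) 1 = Set.Ioc 0 t by
        ext r
        have := ht.2
        simp only [Set.mem_inter_iff, Set.mem_Iic, Set.mem_Ioo, Set.mem_Ioc]
        grind, Real.volume_Ioc, sub_zero, ← ENNReal.ofReal_mul (by positivity)]
    congr 1
    have h1 := one_sub_log_pos ht.1 (by linarith [ht.2])
    have h2 := ht.1
    field_simp
  have h0 := half 0
  have h1 := half 1
  calc ∫⁻ p in refSquare, slopeMajorant p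
      ≤ ∫⁻ p in refSquare, ({p : Plane | p (Fin.rev 0) ≤ p 0}.indicator
          (fun p => ENNReal.ofReal (1 / (p 0 * (1 - Real.log (p 0))) ^ 2)) p +
          {p : Plane | p (Fin.rev 1) ≤ p 1}.indicator
          (fun p => ENNReal.ofReal (1 / (p 1 * (1 - Real.log (p 1))) ^ 2)) p) := by
        refine lintegral_mono fun p => ?_
        have e0 : Fin.rev (0 : Fin 2) = 1 := rfl
        have e1 : Fin.rev (1 : Fin 2) = 0 := rfl
        simp only [slopeMajorant, Set.indicator, Set.mem_ofPred_eq, e0, e1]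
        rcases le_total (p 1) (p 0) with h | h
        · rw [max_eq_left h, if_pos h]
          exact le_add_of_nonneg_right zero_le
        · rw [max_eq_right h, if_pos h]
          exact le_add_of_nonneg_left zero_le
    _ = 2 := by
        rw [lintegral_add_left, h0, h1, one_add_one_eq_two]
        exact Measurable.indicator (by fun_prop) (measurableSet_le (by fun_prop) (by fun_prop))

theorem isOpen_refPrism : IsOpen refPrism := by
  have h (i : Fin 3) : Continuous fun x : EuclideanSpace ℝ (Fin 3) => x i := by fun_prop
  exact (isOpen_lt continuous_const (h 0)).inter ((isOpen_lt (h 0) continuous_const).inter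
    ((isOpen_lt continuous_const (h 1)).inter ((isOpen_lt (h 1) (h 0)).inter
    ((isOpen_lt continuous_const (h 2)).inter (isOpen_lt (h 2) continuous_const)))))

theorem isBounded_refPrism : Bornology.IsBounded refPrism := by
  refine (Metric.isBounded_iff_subset_closedBall 0).2 ⟨2, fun x hx => ?_⟩
  obtain ⟨h1, h2, h3, h4, h5, h6⟩ := hx
  rw [mem_closedBall_zero_iff, EuclideanSpace.norm_eq, Fin.sum_univ_three]
  refine Real.sqrt_le_iff.2 ⟨by norm_num, ?_⟩
  simp only [Real.norm_eq_abs, sq_abs]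
  nlinarith

theorem neg_three_le_logLog_two : -3 ≤ logLog 2 := by
  have h1 := Real.log_two_lt_d9
  have h2 := one_sub_log_pos two_pos le_rfl
  have h3 := Real.one_sub_inv_le_log_of_pos h2
  have h4 : (1 - Real.log 2)⁻¹ ≤ 4 := by
    rw [inv_le_comm₀ h2 (by norm_num)]
    linarith
  rw [logLog]
  linarith

/-- From `x₂ ≤ r < 2` follows `-3 ≤ logLog r ≤ logLog x₂`, hence `|logLog r| ≤ logLog x₂ + 3`. The
constant `50 = 2 * 16 + 2 * 9` comes from `(L + 3)² ≤ 2 L² + 18`, `logLog_sq_le` and `1 ≤ 1 / √x₂`.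
-/
theorem wEps_sq_le {ε : ℝ} (hε : 0 < ε) {x : EuclideanSpace ℝ (Fin 3)} (hx : x ∈ refPrism) :
    wEps ε (x 1) (x 2) ^ 2 ≤ ε ^ 2 * 50 * (1 / √(x 1)) := by
  have h := axisDist_mem hx
  have h1 : 0 < x 1 := hx.2.2.1
  have h1' : x 1 < 1 := hx.2.2.2.1.trans hx.2.1
  have h0 := h1.trans_le h.1
  have hL := logLog_nonneg h1 h1'.le
  have h2 : |logLog (axisDist x)| ≤ logLog (x 1) + 3 := by
    have a1 := logLog_le_logLog h1 h.1 h.2.2.1.le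
    have a2 := logLog_le_logLog h0 h.2.2.1.le le_rfl
    have a3 := neg_three_le_logLog_two
    rw [abs_le]
    constructor <;> linarith
  have h3 : |wEps ε (x 1) (x 2)| ≤ ε * (logLog (x 1) + 3) := by
    rw [wEps_eq_min ε h0 rfl]
    have a1 := abs_min_one_sub_le (ε * logLog (axisDist x)) 0
    rw [min_eq_right zero_le_one, sub_zero, sub_zero, abs_mul, abs_of_pos hε] at a1
    exact a1.trans (mul_le_mul_of_nonneg_left h2 hε.le)
  have h4 : 1 ≤ 1 / √(x 1) := by
    rw [le_div_iff₀ (Real.sqrt_pos.2 h1), one_mul]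
    exact Real.sqrt_le_one.2 h1'.le
  have h5 := logLog_sq_le h1 h1'
  calc wEps ε (x 1) (x 2) ^ 2 = |wEps ε (x 1) (x 2)| ^ 2 := (sq_abs _).symm
    _ ≤ (ε * (logLog (x 1) + 3)) ^ 2 := by gcongr
    _ = ε ^ 2 * (logLog (x 1) + 3) ^ 2 := mul_pow _ _ _
    _ ≤ ε ^ 2 * (50 * (1 / √(x 1))) := by
        gcongr
        nlinarith [sq_nonneg (logLog (x 1) - 3)]
    _ = _ := by ring

theorem hOneNorm_wEps_sq_le {ε : ℝ} (hε : 0 < ε) :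
    hOneNorm refPrism (fun x => wEps ε (x 1) (x 2)) ^ 2 ≤ ENNReal.ofReal (ε ^ 2) * 132 := by
  have ae := ae_restrict_mem (μ := (volume : Measure (EuclideanSpace ℝ (Fin 3))))
    isOpen_refPrism.measurableSet
  have h1 : eLpNorm (fun x : EuclideanSpace ℝ (Fin 3) => wEps ε (x 1) (x 2)) 2
      (volume.restrict refPrism) ^ 2 ≤ ENNReal.ofReal (ε ^ 2) * 100 := by
    refine (eLpNorm_two_sq_le (k := fun x => ENNReal.ofReal (ε ^ 2 * 50) *
      ENNReal.ofReal (1 / √((!₂[x 1, x 2] : Plane) 0))) ?_).trans ?_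
    · filter_upwards [ae] with x hx
      rw [← ENNReal.ofReal_mul (by positivity), Real.norm_eq_abs, sq_abs]
      exact ENNReal.ofReal_le_ofReal (wEps_sq_le hε hx)
    · refine (lintegral_refPrism_le (k := fun p => ENNReal.ofReal (ε ^ 2 * 50) *
        ENNReal.ofReal (1 / √(p 0))) (by fun_prop)).trans (le_of_eq ?_)
      rw [lintegral_const_mul _ (by fun_prop), lintegral_refSquare_coord 0
        (G := fun t => ENNReal.ofReal (1 / √t)) (by fun_prop), lintegral_one_div_sqrt zero_le_one,
        ENNReal.ofReal_mul (by positivity), mul_assoc, ← ENNReal.ofReal_mul (by norm_num)]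
      norm_num
  have h2 : eLpNorm (gradient (spaceW ε)) 2 (volume.restrict refPrism) ^ 2 ≤
      ENNReal.ofReal (ε ^ 2) * 32 := by
    refine (eLpNorm_two_sq_le (k := fun x => ENNReal.ofReal (ε ^ 2 * 16) *
      slopeMajorant !₂[x 1, x 2]) ?_).trans ?_
    · filter_upwards [ae] with x hx
      obtain ⟨a1, a2, a3, a4⟩ := axisDist_mem hx
      have b1 : 0 < x 1 := hx.2.2.1
      have b2 : max (x 1) (x 2) < 1 := max_lt (hx.2.2.2.1.trans hx.2.1) hx.2.2.2.2.2
      have b3 := half_mul_log_le (lt_max_of_lt_left b1) b2 (max_le a1 a2) a4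
      have b4 := norm_gradient_spaceW_le hε (b1.trans_le a1) a3
      rw [slopeMajorant, ← ENNReal.ofReal_mul (by positivity)]
      refine ENNReal.ofReal_le_ofReal ?_
      calc ‖gradient (spaceW ε) x‖ ^ 2
          ≤ (2 * ε * (2 * (1 / (max (x 1) (x 2) * (1 - Real.log (max (x 1) (x 2))))))) ^ 2 := by
            refine pow_le_pow_left₀ (norm_nonneg _) (b4.trans ?_) 2
            gcongr
        _ = ε ^ 2 * 16 * (1 / (max (x 1) (x 2) * (1 - Real.log (max (x 1) (x 2)))) ^ 2) := by
            rw [← one_div_pow]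
            ring
    · refine (lintegral_refPrism_le (k := fun p => ENNReal.ofReal (ε ^ 2 * 16) * slopeMajorant p)
        (measurable_slopeMajorant.const_mul _)).trans ?_
      rw [lintegral_const_mul _ measurable_slopeMajorant]
      refine (mul_le_mul_right lintegral_slopeMajorant_le _).trans (le_of_eq ?_)
      rw [ENNReal.ofReal_mul (by positivity), mul_assoc]
      norm_num
  have h3 := hOneNorm_le (hasWeakGradient_of_lipschitzWith isOpen_refPrism isBounded_refPrism
    (lipschitzWith_spaceW hε) fun x hx => wEps_eq_spaceW hε hx)
  refine (pow_le_pow_left' h3 2).trans ?_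
  rw [← ENNReal.rpow_natCast, ← ENNReal.rpow_mul]
  norm_num
  refine (add_le_add h1 h2).trans (le_of_eq ?_)
  rw [← mul_add]
  norm_num

theorem tendsto_hOneNorm_wEps :
    Tendsto (fun ε : ℝ => hOneNorm refPrism (fun x => wEps ε (x 1) (x 2))) (𝓝[>] 0) (𝓝 0) := by
  refine tendsto_zero_of_sq (tendsto_of_tendsto_of_tendsto_of_le_of_le' tendsto_const_nhds
    (tendsto_ofReal_sq_mul (B := 132) ENNReal.ofNat_ne_top)
    (Eventually.of_forall fun _ => zero_le) ?_)
  filter_upwards [self_mem_nhdsWithin] with ε hε using hOneNorm_wEps_sq_le hε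

end

theorem mainTheorem8 :
    -- the estimates without the anisotropic seminorm fail on the triangle and on the square
    (∀ s : ℝ, 0 < s → s ≤ 1 / 2 → ∀ l : Fin 2,
      (¬ ∃ C : ℝ≥0, ∀ u : Plane → Plane, VecMemHs s refTriangle u → MemHdiv refTriangle u →
        lTwoNorm refTriangle (fun x => triInterp u x l) ≤
          C * (hsNorm s refTriangle (fun x => u x l) +
            lTwoNorm refTriangle (weakDiv refTriangle u))) ∧
      (¬ ∃ C : ℝ≥0, ∀ u : Plane → Plane, VecMemHs s refSquare u → MemHdiv refSquare u →
        lTwoNorm refSquare (fun x => sqInterp u x l) ≤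
          C * (hsNorm s refSquare (fun x => u x l) +
            lTwoNorm refSquare (weakDiv refSquare u)))) ∧
    -- the fields `u^ε` on the triangle
    Tendsto (fun ε : ℝ => hOneNorm refPrism (fun x => wEps ε (x 1) (x 2))) (𝓝[>] 0) (𝓝 0) ∧
    Tendsto (fun ε : ℝ => hsNorm (1 / 2) refTriangle (fun x => uEps ε x 1)) (𝓝[>] 0) (𝓝 0) ∧
    (∀ ε : ℝ, 0 < ε →
      HasWeakDiv refTriangle (uEps ε) 0 ∧
      triInterp (uEps ε) = (fun _ => !₂[0, 1]) ∧
      -- they are limits of smooth divergence-free fields of the same form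
      ∃ w : ℕ → ℝ → ℝ, (∀ n, ContDiff ℝ ∞ (w n)) ∧
        Tendsto (fun n => hOneNorm (Set.Ioo (0 : ℝ) 1) (fun y => w n y - wEps ε y 0))
          atTop (𝓝 0) ∧
        (∀ n, VecMemHs (1 / 2) refTriangle (curlField (w n)) ∧
          HasWeakDiv refTriangle (curlField (w n)) 0) ∧
        ∀ l : Fin 2, Tendsto (fun n => lTwoNorm refTriangle
          (fun x => triInterp (curlField (w n)) x l - triInterp (uEps ε) x l)) atTop (𝓝 0)) := by
  refine ⟨fun s hs0 hs l => ⟨not_triangle_estimate hs0 hs l, not_square_estimate hs0 hs l⟩,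
    tendsto_hOneNorm_wEps, tendsto_hsNorm_uEps, fun ε hε => ?_⟩
  have hw n := contDiff_smoothApprox (plateau_lt_approxEnd hε n)
  refine ⟨hasWeakDiv_uEps hε, triInterp_uEps hε, fun n => smoothApprox ε (approxEnd ε n), hw,
    tendsto_hOneNorm_smoothApprox hε,
    fun n => ⟨vecMemHs_curlField (hw n), hasWeakDiv_curlField (hw n)⟩, fun l => ?_⟩
  -- The interpolants coincide for every `n`, so the sequence of norms is constantly zero.
  simp [triInterp_curlField (hw _), smoothApprox_zero, triInterp_uEps hε, lTwoNorm]
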